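/- Let $n\ge 1$ and let $\sigma$ be a permutation of the letters $0,\dots,n$. Let $S_\sigma$ be the closed oriented surface obtained from a $2(n+1)$-gon, with top side labelled $0,1,\dots,n$ and bottom side labelled $\sigma(0),\dots,\sigma(n)$ (both from left to right), by gluing edges with the same label. Assume that $\sigma$ has genus $1$, i.e. $S_\sigma$ is a torus; equivalently the gluing has $n$ vertices. (Nontrivial circular permutations are of this kind.) Removing the vertices gives the $n$-punctured torus $\Sigma_{1,n}$; its fundamental group is free on $\gamma_0,\dots,\gamma_n$, where $\gamma_i$ crosses the edge $i$. A *piecewise Möbius IET* $T$ with permutation $\sigma$ on $[a,b]$ is given by two subdivisions $a=t_0<\dots<t_{n+1}=b$ and $a=b_0<\dots<b_{n+1}=b$ and elements $f_0,\dots,f_n\in \mathrm{PSL}(2,\mathbb R)$ such that $f_{\sigma(j)}$ maps $[t_{\sigma(j)},t_{\sigma(j)+1}]$ onto $[b_j,b_{j+1}]$ for every $j$; $T$ equals $f_i$ on $[t_i,t_{i+1})$. Its representation is $\rho_T\colon\pi_1\Sigma_{1,n}\to\mathrm{PSL}(2,\mathbb R)$, $\gamma_i\mapsto f_i$. The size of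 the break at a vertex $v$ is the product over the points $t_p$ belonging to $v$ of (right derivative)/(left derivative) of $T$ at $t_p$, where at $a$ (at $b$) only the right (left) derivative is taken. For each corner $t_p$ let $\delta_p\in\pi_1\Sigma_{1,n}$ be the peripheral loop that turns once around the vertex of $t_p$ starting at that corner; the distinguished loop $\delta_0$ starts at $t_0=a$ by crossing the leftmost top edge. Fix $\mathbf c=(c_v)_v$ with $c_v>0$ and $c_v\neq 1$ for each vertex $v$. Let $\mathcal E_\sigma(\mathbf c)$ be the set of piecewise Möbius IETs $T$ with permutation $\sigma$, domain $[0,1]$ and break sizes $\mathbf c$, for which $\rho_T(\delta_0)$ is affine (fixes $\infty$). It carries the topology and the smooth functions induced by the parameters $(t_0,\dots,t_{n+1},f_0,\dots,f_n)\in\mathbb R^{n+2}\times\mathrm{PSL}(2,\mathbb R)^{n+1}$. Let $h_v$ be the conjugacy class of $x\mapsto c_v x$ in $\mathrm{PSL}(2,\mathbb R)$. Let $R_{\mathbf h}\subset\mathrm{Hom}(\pi_1\Sigma_{1,n},\mathrm{PSL}(2,\mathbb R))=\mathrm{PSL}(2,\mathbb R)^{n+1}$ be the set of representations that map the peripheral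 loops around each vertex $v$ into $h_v$. Let $\mathcal O_{\mathbf h}$ be the image of $R_{\mathbf h}$ in the topological quotient of $\mathrm{Hom}(\pi_1\Sigma_{1,n},\mathrm{PSL}(2,\mathbb R))$ by conjugation, and let $\chi_{1,n}(\mathrm{PSL}(2,\mathbb R),\mathbf h)$ be its image in the largest Hausdorff quotient of that space (the relative character variety). A function on $\mathcal O_{\mathbf h}$ or $\chi_{1,n}(\mathrm{PSL}(2,\mathbb R),\mathbf h)$ is smooth when its pull-back to $R_{\mathbf h}$ is smooth, i.e. locally the restriction of a smooth function of the matrix entries. A map is a local diffeomorphism at a point when it restricts to a homeomorphism from an open neighbourhood of the point onto an open set under which smooth functions correspond to smooth functions. Then: 1. $\mathcal E_\sigma(\mathbf c)$ is locally diffeomorphic to $\mathbb R^{2n}$ at each of its points. 2. For every $T\in\mathcal E_\sigma(\mathbf c)$ the class of $\rho_T$ lies in $\chi_{1,n}(\mathrm{PSL}(2,\mathbb R),\mathbf h)$, and the projection $\pi\colon\mathcal E_\sigma(\mathbf c)\to\chi_{1,n}(\mathrm{PSL}(2,\mathbb R),\mathbf h)$, $T\mapsto[\rho_T]$, is a local diffeomorphism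 at every $T$ whose branches $f_0,\dots,f_n$ have no common fixed point in $\mathbb R\cup\{\infty\}$. 3. The class of $\rho_T$ lies in $\mathcal O_{\mathbf h}$ for every $T\in\mathcal E_\sigma(\mathbf c)$, and the projection $\mathcal E_\sigma(\mathbf c)\to\mathcal O_{\mathbf h}$ to the space of conjugacy classes is a local diffeomorphism at every point. 4. Each conjugacy class of representations contains $\rho_T$ for at most one $T\in\mathcal E_\sigma(\mathbf c)$. If $T$ is any piecewise Möbius IET with permutation $\sigma$ and break sizes $\mathbf c$, on any interval $[a,b]$, then the conjugacy class of $\rho_T$ contains $\rho_{T'}$ for some $T'\in\mathcal E_\sigma(\mathbf c)$ if and only if $\rho_T(\delta_0)$ has no fixed point in $(a,b]$. -/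

import Mathlib

open Matrix Topology

noncomputable section

namespace MoebiusIET

/-! ### The group `PSL(2, ℝ)` and its action on the projective line -/

/-- The Lie group `PSL(2, ℝ) = SL(2, ℝ) / {±1}`, with the quotient topology. -/
abbrev PSL2R : Type := Matrix.ProjectiveSpecialLinearGroup (Fin 2) ℝ

/-- The homomorphism from `SL(2, ℝ)` to the permutations of the projective line `ℝ ∪ {∞}`,
given by `x ↦ (a x + b) / (c x + d)`. -/
def moebiusSL : SpecialLinearGroup (Fin 2) ℝ →* Equiv.Perm (OnePoint ℝ) :=
  (MulAction.toPermHom (GL (Fin 2) ℝ) (OnePoint ℝ)).comp Matrix.SpecialLinearGroup.toGL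

theorem moebiusSL_center (A : SpecialLinearGroup (Fin 2) ℝ)
    (hA : A ∈ Subgroup.center (SpecialLinearGroup (Fin 2) ℝ)) : moebiusSL A = 1 := by
  obtain ⟨r, hr, hr'⟩ := Matrix.SpecialLinearGroup.mem_center_iff.mp hA
  have h00 : A 0 0 = r := by
    have := congrFun (congrFun hr' 0) 0
    simpa using this.symm
  have h01 : A 0 1 = 0 := by
    have := congrFun (congrFun hr' 0) 1
    simpa using this.symm
  have h10 : A 1 0 = 0 := by
    have := congrFun (congrFun hr' 1) 0
    simpa using this.symm
  have h11 : A 1 1 = r := by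
    have := congrFun (congrFun hr' 1) 1
    simpa using this.symm
  have hr0 : r ≠ 0 := by
    rintro rfl
    simp at hr
  ext x
  change (Matrix.SpecialLinearGroup.toGL A) • x = x
  induction x using OnePoint.rec with
  | infty =>
    rw [OnePoint.smul_infty_eq_self_iff]
    simpa using h10
  | coe x =>
    rw [OnePoint.smul_some_eq_ite]
    simp [h00, h01, h10, h11, hr0]

/-- The action of `PSL(2, ℝ)` on the projective line `ℝ ∪ {∞}` by Möbius transformations. -/
def moebius : PSL2R →* Equiv.Perm (OnePoint ℝ) :=
  QuotientGroup.lift _ moebiusSL moebiusSL_center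

/-- The Möbius transformation of `g` as a real function, with value `0` at the pole. It is only
used near points that are not mapped to `∞`. -/
def realMoebius (g : PSL2R) (x : ℝ) : ℝ := (moebius g x).elim 0 id

/-- The affine subgroup of `PSL(2, ℝ)`: the elements that fix `∞`. -/
def IsAffine (g : PSL2R) : Prop := moebius g OnePoint.infty = OnePoint.infty

/-- The matrix `diag(√c, 1/√c)`. -/
def dilationSL (c : ℝ) (hc : 0 < c) : SpecialLinearGroup (Fin 2) ℝ :=
  ⟨!![√c, 0; 0, (√c)⁻¹], by
    have := (Real.sqrt_pos.mpr hc).ne'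
    simp [Matrix.det_fin_two, this]⟩

/-- The element of `PSL(2, ℝ)` that acts by the dilation `x ↦ c x`. -/
def dilation (c : ℝ) (hc : 0 < c) : PSL2R := QuotientGroup.mk (dilationSL c hc)

/-! ### The polygonal model of the punctured torus

Let `σ` be a permutation of the `n + 1` letters `0, …, n`. Take the `2(n+1)`-gon whose top side is
the broken line with consecutive edges labelled `0, 1, …, n` and whose bottom side is the broken
line with consecutive edges labelled `σ 0, σ 1, …, σ n`, both read from left to right, and glue
the two edges with the same label. The top corners are `t 0, …, t (n+1)`, the bottom corners
`b 0, …, b (n+1)`, with `b 0 = t 0` and `b (n+1) = t (n+1)`. -/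

section Polygon

variable {n : ℕ}

/-- Crossing upwards near left endpoints: the top corner `t i` (left endpoint of the top
edge `i`) goes to the left endpoint of the bottom edge with label `i`, which is the bottom corner
`b (σ⁻¹ i)`; the last corner `t (n+1) = b (n+1)` stays where it is. -/
def upPerm (σ : Equiv.Perm (Fin (n + 1))) : Equiv.Perm (Fin (n + 2)) :=
  finSuccEquivLast.permCongr.symm (Equiv.optionCongr σ⁻¹)

/-- Crossing downwards near right endpoints: the bottom corner `b (j+1)` (right endpoint of the
bottom edge at place `j`, with label `σ j`) goes to the right endpoint of the top edge with that
label, which is the top corner `t (σ j + 1)`; the first corner `b 0 = t 0` stays where it is. -/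
def downPerm (σ : Equiv.Perm (Fin (n + 1))) : Equiv.Perm (Fin (n + 2)) :=
  (finSuccEquiv (n + 1)).permCongr.symm (Equiv.optionCongr σ)

/-- Turning around a vertex of the glued surface, from one top corner to the next. -/
def cornerPerm (σ : Equiv.Perm (Fin (n + 1))) : Equiv.Perm (Fin (n + 2)) :=
  downPerm σ * upPerm σ

/-- The vertices of the glued surface, which are the marked points (punctures): the cycles of the
permutation `cornerPerm σ` of the top corners. -/
abbrev Vertices (σ : Equiv.Perm (Fin (n + 1))) : Type :=
  Quotient (Equiv.Perm.SameCycle.setoid (cornerPerm σ))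

/-- The vertex to which the top corner `t p` belongs. -/
def vertexOf (σ : Equiv.Perm (Fin (n + 1))) (p : Fin (n + 2)) : Vertices σ :=
  Quotient.mk _ p

instance (σ : Equiv.Perm (Fin (n + 1))) : Fintype (Vertices σ) := Fintype.ofFinite _

/-- The glued surface is a torus. It has one face, `n + 1` edges and `#(Vertices σ)` vertices, so
its Euler characteristic `#(Vertices σ) - (n + 1) + 1` is zero exactly when there are `n`
vertices. -/
def IsGenusOne (σ : Equiv.Perm (Fin (n + 1))) : Prop :=
  Fintype.card (Vertices σ) = n

/-- The letter crossed by `upPerm` at the top corner `t p`. Words are multiplied so that under a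
left action the rightmost letter acts first. -/
def upWord (p : Fin (n + 2)) : FreeGroup (Fin (n + 1)) :=
  Fin.lastCases (motive := fun _ => FreeGroup (Fin (n + 1))) 1 (fun i => FreeGroup.of i) p

/-- The inverse letter crossed by `downPerm` at the bottom corner `b q`. -/
def downWord (σ : Equiv.Perm (Fin (n + 1))) (q : Fin (n + 2)) : FreeGroup (Fin (n + 1)) :=
  Fin.cases (motive := fun _ => FreeGroup (Fin (n + 1))) 1 (fun j => (FreeGroup.of (σ j))⁻¹) q

/-- The word crossed when turning from the top corner `t p` to `t (cornerPerm σ p)`. -/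
def stepWord (σ : Equiv.Perm (Fin (n + 1))) (p : Fin (n + 2)) : FreeGroup (Fin (n + 1)) :=
  downWord σ (upPerm σ p) * upWord p

/-- The word crossed in `k` successive steps around a vertex, starting at the top corner `t p`. -/
def walkWord (σ : Equiv.Perm (Fin (n + 1))) (p : Fin (n + 2)) : ℕ → FreeGroup (Fin (n + 1))
  | 0 => 1
  | k + 1 => stepWord σ ((cornerPerm σ ^ k) p) * walkWord σ p k

/-- The peripheral loop that turns once around the vertex of the top corner `t p`, starting at
that corner, as an element of the fundamental group of the punctured surface. That group is free
on the loops `γ 0, …, γ n`, where `γ i` crosses the glued edge `i`. -/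
def peripheralLoop (σ : Equiv.Perm (Fin (n + 1))) (p : Fin (n + 2)) : FreeGroup (Fin (n + 1)) :=
  walkWord σ p (Function.minimalPeriod (cornerPerm σ) p)

end Polygon

/-! ### Piecewise Möbius interval exchange transformations -/

/-- A piecewise Möbius interval exchange transformation with permutation `σ`, on the interval
`[top 0, top (n+1)]`: the interval is cut at the points `top i` and also at the points `bot j`, and
the transformation is equal on the interval `[top i, top (i+1))` to the Möbius map `branch i`,
which maps the interval with label `i = σ j` of the top partition onto the interval at place `j`
of the bottom partition. -/
@[ext] structure PIET {n : ℕ} (σ : Equiv.Perm (Fin (n + 1))) where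
  top : Fin (n + 2) → ℝ
  bot : Fin (n + 2) → ℝ
  branch : Fin (n + 1) → PSL2R
  top_strictMono : StrictMono top
  bot_strictMono : StrictMono bot
  bot_zero : bot 0 = top 0
  bot_last : bot (Fin.last (n + 1)) = top (Fin.last (n + 1))
  image_eq : ∀ j : Fin (n + 1),
    moebius (branch (σ j)) ''
        (((↑) : ℝ → OnePoint ℝ) '' Set.Icc (top (σ j).castSucc) (top (σ j).succ)) =
      ((↑) : ℝ → OnePoint ℝ) '' Set.Icc (bot j.castSucc) (bot j.succ)

/-- The representations of the fundamental group (free on `γ 0, …, γ n`) into `PSL(2, ℝ)`. -/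
def Rep (n : ℕ) : Type := FreeGroup (Fin (n + 1)) →* PSL2R

/-- The topology of `Hom(π₁, PSL(2, ℝ)) = PSL(2, ℝ)^(n+1)`. -/
instance (n : ℕ) : TopologicalSpace (Rep n) :=
  TopologicalSpace.induced
    (fun (ρ : FreeGroup (Fin (n + 1)) →* PSL2R) (i : Fin (n + 1)) => ρ (FreeGroup.of i))
    inferInstance

/-- The value of a representation. -/
def Rep.eval {n : ℕ} (ρ : Rep n) (w : FreeGroup (Fin (n + 1))) : PSL2R :=
  (show FreeGroup (Fin (n + 1)) →* PSL2R from ρ) w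

/-- The representation with prescribed values on the free generators `γ 0, …, γ n`. -/
def Rep.ofGens {n : ℕ} (g : Fin (n + 1) → PSL2R) : Rep n :=
  (FreeGroup.lift g : FreeGroup (Fin (n + 1)) →* PSL2R)

namespace PIET

variable {n : ℕ} {σ : Equiv.Perm (Fin (n + 1))}

/-- The representation `γ i ↦ branch i` associated with a piecewise Möbius IET. -/
def rep (T : PIET σ) : Rep n := Rep.ofGens T.branch

open Classical in
/-- The size of the break at the vertex `v`: the product over the points `top p` that belong to
`v` of the ratio of the right derivative and the left derivative of the transformation, where at
the left (right) end of the interval only the right (left) derivative is taken. -/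
def breakSize (T : PIET σ) (v : Vertices σ) : ℝ :=
  (∏ i : Fin (n + 1), if vertexOf σ i.castSucc = v then
      deriv (realMoebius (T.branch i)) (T.top i.castSucc) else 1) /
  (∏ i : Fin (n + 1), if vertexOf σ i.succ = v then
      deriv (realMoebius (T.branch i)) (T.top i.succ) else 1)

end PIET

/-- The normalised family `E_σ(c)`: the piecewise Möbius IETs with domain `[0, 1]` whose break
sizes are given by `c` and for which the loop around the distinguished vertex (the one that starts
at the corner `t 0` and crosses the leftmost top edge first) is mapped into the affine group. -/
def E {n : ℕ} (σ : Equiv.Perm (Fin (n + 1))) (c : Vertices σ → ℝ) : Type :=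
  {T : PIET σ // T.top 0 = 0 ∧ T.top (Fin.last (n + 1)) = 1 ∧
    IsAffine (T.rep.eval (peripheralLoop σ 0)) ∧ ∀ v, T.breakSize v = c v}

/-- The topology of `E_σ(c)` in terms of the end points of the intervals and the branches. -/
instance {n : ℕ} (σ : Equiv.Perm (Fin (n + 1))) (c : Vertices σ → ℝ) :
    TopologicalSpace (E σ c) :=
  TopologicalSpace.induced (fun T => (T.1.top, T.1.branch)) inferInstance

/-! ### Character varieties -/

/-- Representations are equivalent when they are conjugate by an element of `PSL(2, ℝ)`. -/
def conjSetoid (n : ℕ) : Setoid (Rep n) where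
  r ρ ρ' := ∃ g : PSL2R, ∀ w, ρ'.eval w = g * ρ.eval w * g⁻¹
  iseqv :=
    { refl := fun ρ => ⟨1, fun w => by simp⟩
      symm := by
        rintro ρ ρ' ⟨g, hg⟩
        refine ⟨g⁻¹, fun w => ?_⟩
        rw [hg w]
        group
      trans := by
        rintro ρ ρ' ρ'' ⟨g, hg⟩ ⟨k, hk⟩
        refine ⟨k * g, fun w => ?_⟩
        rw [hk w, hg w]
        group }

/-- The space of conjugacy classes of representations, with the quotient topology. -/
abbrev OrbitSpace (n : ℕ) : Type := Quotient (conjSetoid n)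

/-- The character variety: the Hausdorff quotient of `Hom(π₁, PSL(2, ℝ))` by conjugation, i.e. the
largest Hausdorff quotient of the space of conjugacy classes. -/
abbrev CharVar (n : ℕ) : Type := T2Quotient (OrbitSpace n)

/-- The conjugacy class of a representation. -/
def Rep.orbit {n : ℕ} (ρ : Rep n) : OrbitSpace n := Quotient.mk (conjSetoid n) ρ

/-- The point of the character variety given by a representation. -/
def Rep.char {n : ℕ} (ρ : Rep n) : CharVar n := T2Quotient.mk ρ.orbit

section Relative

variable {n : ℕ} (σ : Equiv.Perm (Fin (n + 1)))

/-- The representations that map the peripheral loops into prescribed conjugacy classes. -/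
def relRep (h : Vertices σ → ConjClasses PSL2R) : Set (Rep n) :=
  {ρ | ∀ p, ConjClasses.mk (ρ.eval (peripheralLoop σ p)) = h (vertexOf σ p)}

/-- The conjugacy classes of representations with prescribed peripheral conjugacy classes. -/
def RelOrbitSpace (h : Vertices σ → ConjClasses PSL2R) : Set (OrbitSpace n) :=
  Rep.orbit '' relRep σ h

/-- The relative character variety. -/
def RelCharVar (h : Vertices σ → ConjClasses PSL2R) : Set (CharVar n) :=
  Rep.char '' relRep σ h

/-- The hyperbolic conjugacy classes that belong to the break sizes `c`. -/
def boundaryClass (c : Vertices σ → ℝ) (hc : ∀ v, 0 < c v) : Vertices σ → ConjClasses PSL2R :=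
  fun v => ConjClasses.mk (dilation (c v) (hc v))

end Relative

/-! ### Smooth functions and local diffeomorphisms -/

/-- Let `q : S → X` be a surjection and let `emb : S → V` realise `S` as a subset of a normed
space. A real function `f` on `X` is smooth near `x` (for the structure defined by `q` and `emb`)
when near each point of `S` above `x` the function `f ∘ q` is the restriction to `S` of a smooth
function on an open subset of `V`. -/
def SmoothVia {S X V : Type} [NormedAddCommGroup V] [NormedSpace ℝ V] (emb : S → V) (q : S → X)
    (f : X → ℝ) (x : X) : Prop :=
  ∀ s, q s = x → ∃ W : Set V, IsOpen W ∧ emb s ∈ W ∧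
    ∃ F : V → ℝ, ContDiffOn ℝ (⊤ : ℕ∞) F W ∧ ∀ s', emb s' ∈ W → f (q s') = F (emb s')

/-- `φ : X → Y` is a local diffeomorphism at `x`, where the smooth structures of `X` and `Y` are
given by their germs of smooth functions: near `x` it is a homeomorphism between open
sets under which smooth functions correspond to smooth functions. -/
def IsLocalDiffeoAt {X Y : Type} [TopologicalSpace X] [TopologicalSpace Y]
    (smoothX : (X → ℝ) → X → Prop) (smoothY : (Y → ℝ) → Y → Prop) (φ : X → Y) (x : X) : Prop :=
  ∃ e : OpenPartialHomeomorph X Y, x ∈ e.source ∧ Set.EqOn φ e e.source ∧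
    ∀ x' ∈ e.source, ∀ g : Y → ℝ, smoothY g (φ x') ↔ smoothX (g ∘ φ) x'

/-- The entries of a tuple of matrices in `SL(2, ℝ)`. -/
def entries {n : ℕ} (A : Fin (n + 1) → SpecialLinearGroup (Fin 2) ℝ) :
    Fin (n + 1) → Fin 2 → Fin 2 → ℝ :=
  fun i j k => A i j k

/-- Smooth functions on `E_σ(c)`: smooth in the end points of the intervals and in the entries of
the matrices of the branches. (`SL(2, ℝ) → PSL(2, ℝ)` is a covering.) -/
def smoothE {n : ℕ} (σ : Equiv.Perm (Fin (n + 1))) (c : Vertices σ → ℝ) :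
    (E σ c → ℝ) → E σ c → Prop :=
  SmoothVia
    (S := {s : E σ c × (Fin (n + 1) → SpecialLinearGroup (Fin 2) ℝ) //
      ∀ i, (QuotientGroup.mk (s.2 i) : PSL2R) = s.1.1.branch i})
    (fun s => (s.1.1.1.top, entries s.1.2)) (fun s => s.1.1)

/-- The tuples of matrices in `SL(2, ℝ)` that represent elements of `relRep σ h`. -/
def RelLift {n : ℕ} (σ : Equiv.Perm (Fin (n + 1))) (h : Vertices σ → ConjClasses PSL2R) : Type :=
  {A : Fin (n + 1) → SpecialLinearGroup (Fin 2) ℝ //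
    Rep.ofGens (fun i => (QuotientGroup.mk (A i) : PSL2R)) ∈ relRep σ h}

/-- The representation given by a tuple of matrices. -/
def RelLift.rep {n : ℕ} {σ : Equiv.Perm (Fin (n + 1))} {h : Vertices σ → ConjClasses PSL2R}
    (A : RelLift σ h) : Rep n :=
  Rep.ofGens (fun i => (QuotientGroup.mk (A.1 i) : PSL2R))

/-- Smooth functions on the space of conjugacy classes of representations with prescribed
peripheral classes: those whose pull-back to the representations is smooth. -/
def smoothRelOrbit {n : ℕ} (σ : Equiv.Perm (Fin (n + 1))) (h : Vertices σ → ConjClasses PSL2R) :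
    (RelOrbitSpace σ h → ℝ) → RelOrbitSpace σ h → Prop :=
  SmoothVia (S := RelLift σ h) (fun A => entries A.1)
    (fun A => ⟨A.rep.orbit, Set.mem_image_of_mem _ A.2⟩)

/-- Smooth functions on the relative character variety: those whose pull-back to the
representations is smooth. -/
def smoothRelChar {n : ℕ} (σ : Equiv.Perm (Fin (n + 1))) (h : Vertices σ → ConjClasses PSL2R) :
    (RelCharVar σ h → ℝ) → RelCharVar σ h → Prop :=
  SmoothVia (S := RelLift σ h) (fun A => entries A.1)
    (fun A => ⟨A.rep.char, Set.mem_image_of_mem _ A.2⟩)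

/-- Smooth functions on the Euclidean space `ℝ^m`. -/
def smoothEuclidean (m : ℕ) :
    (EuclideanSpace ℝ (Fin m) → ℝ) → EuclideanSpace ℝ (Fin m) → Prop :=
  SmoothVia id id

end MoebiusIET

end

namespace MoebiusIET

/-! ### Matrices representing Möbius transformations -/

/-- The group `SL(2, ℝ)`. -/
abbrev SL2R : Type := Matrix.SpecialLinearGroup (Fin 2) ℝ

/-- The real two by two matrices. -/
abbrev M2 : Type := Matrix (Fin 2) (Fin 2) ℝ

/-- The class in `PSL(2, ℝ)` of a matrix. -/
abbrev proj (A : SL2R) : PSL2R := QuotientGroup.mk A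

theorem proj_surjective : Function.Surjective proj := QuotientGroup.mk_surjective

theorem det_eq_one (A : SL2R) : A 0 0 * A 1 1 - A 0 1 * A 1 0 = 1 := by
  have := A.det_coe
  rwa [det_fin_two] at this

theorem neg_one_mem_center : (-1 : SL2R) ∈ Subgroup.center SL2R := by
  rw [Subgroup.mem_center_iff]
  intro g
  simp

theorem proj_eq_iff (A B : SL2R) : proj A = proj B ↔ B = A ∨ B = -A := by
  rw [QuotientGroup.eq]
  constructor
  · intro h
    obtain ⟨r, hr, hr'⟩ := Matrix.SpecialLinearGroup.mem_center_iff.mp h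
    have hr2 : r = 1 ∨ r = -1 := by
      have h2 : r ^ 2 = 1 := by simpa using hr
      have h3 : (r - 1) * (r + 1) = 0 := by linear_combination h2
      rcases mul_eq_zero.mp h3 with h | h
      · left; linarith
      · right; linarith
    have hB : B = A * (A⁻¹ * B) := by group
    rcases hr2 with rfl | rfl
    · left
      have : A⁻¹ * B = 1 := by
        ext i j
        have := congrFun (congrFun hr' i) j
        simpa using this.symm
      rw [hB, this, mul_one]
    · right
      have : A⁻¹ * B = -1 := by
        ext i j
        have := congrFun (congrFun hr' i) j
        rw [← this]
        simp [scalar_apply, diagonal, one_apply, apply_ite]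
      rw [hB, this]
      simp
  · rintro (rfl | rfl)
    · simp
    · simpa using neg_one_mem_center

/-- The vector `(x, 1)` that represents the point `x` of the projective line. -/
def vec (x : ℝ) : Fin 2 → ℝ := ![x, 1]

@[simp] theorem vec_zero (x : ℝ) : vec x 0 = x := rfl
@[simp] theorem vec_one (x : ℝ) : vec x 1 = 1 := rfl

theorem moebius_proj (A : SL2R) (x : OnePoint ℝ) :
    moebius (proj A) x = (Matrix.SpecialLinearGroup.toGL A) • x := rfl

theorem moebius_proj_coe (A : SL2R) (x : ℝ) :
    moebius (proj A) (x : OnePoint ℝ) = if A 1 0 * x + A 1 1 = 0 then OnePoint.infty else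
      (((A 0 0 * x + A 0 1) / (A 1 0 * x + A 1 1) : ℝ) : OnePoint ℝ) := by
  rw [moebius_proj, OnePoint.smul_some_eq_ite]
  rfl

theorem isAffine_proj_iff (A : SL2R) : IsAffine (proj A) ↔ A 1 0 = 0 := by
  rw [IsAffine, moebius_proj, OnePoint.smul_infty_eq_self_iff]
  rfl

theorem mulVec_vec_eq_iff (A : SL2R) (x y j : ℝ) :
    (A : M2) *ᵥ vec x = j • vec y ↔
      A 0 0 * x + A 0 1 = j * y ∧ A 1 0 * x + A 1 1 = j := by
  constructor
  · intro h
    have h0 := congrFun h 0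
    have h1 := congrFun h 1
    simp [mulVec, dotProduct, Fin.sum_univ_two] at h0 h1
    exact ⟨h0, h1⟩
  · rintro ⟨h0, h1⟩
    ext i
    fin_cases i
    · simpa [mulVec, dotProduct, Fin.sum_univ_two] using h0
    · simpa [mulVec, dotProduct, Fin.sum_univ_two] using h1

theorem factor_ne_zero {A : SL2R} {x y j : ℝ}
    (h : (A : M2) *ᵥ vec x = j • vec y) : j ≠ 0 := by
  obtain ⟨h0, h1⟩ := (mulVec_vec_eq_iff A x y j).mp h
  rintro rfl
  have := det_eq_one A
  have : (A 0 0 * A 1 1 - A 0 1 * A 1 0) = 0 := by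
    linear_combination A 0 0 * h1 - A 1 0 * h0
  linarith

theorem moebius_proj_coe_eq_coe_iff (A : SL2R) (x y : ℝ) :
    moebius (proj A) (x : OnePoint ℝ) = (y : OnePoint ℝ) ↔
      ∃ j : ℝ, (A : M2) *ᵥ vec x = j • vec y := by
  rw [moebius_proj_coe]
  constructor
  · intro h
    split_ifs at h with h0
    · exact absurd h (OnePoint.infty_ne_coe y)
    rw [OnePoint.coe_eq_coe] at h
    refine ⟨A 1 0 * x + A 1 1, (mulVec_vec_eq_iff ..).mpr ⟨?_, rfl⟩⟩
    rw [← h, mul_div_assoc', mul_div_cancel_left₀ _ h0]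
  · rintro ⟨j, hj⟩
    have hj0 := factor_ne_zero hj
    obtain ⟨h0, h1⟩ := (mulVec_vec_eq_iff ..).mp hj
    rw [h1, if_neg hj0, h0, mul_div_cancel_left₀ _ hj0]

/-- The derivative of a Möbius transformation is the inverse square of the automorphy factor. -/
theorem deriv_realMoebius {A : SL2R} {x : ℝ} (h : A 1 0 * x + A 1 1 ≠ 0) :
    deriv (realMoebius (proj A)) x = ((A 1 0 * x + A 1 1) ^ 2)⁻¹ := by
  have hev : realMoebius (proj A) =ᶠ[𝓝 x]
      fun y => (A 0 0 * y + A 0 1) / (A 1 0 * y + A 1 1) := by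
    have : ContinuousAt (fun y => A 1 0 * y + A 1 1) x := by fun_prop
    filter_upwards [this.eventually_ne h] with y hy
    rw [realMoebius, moebius_proj_coe, if_neg hy]
    rfl
  rw [hev.deriv_eq]
  have h1 : HasDerivAt (fun y => A 0 0 * y + A 0 1) (A 0 0) x := by
    simpa using ((hasDerivAt_id x).const_mul (A 0 0)).add_const (A 0 1)
  have h2 : HasDerivAt (fun y => A 1 0 * y + A 1 1) (A 1 0) x := by
    simpa using ((hasDerivAt_id x).const_mul (A 1 0)).add_const (A 1 1)
  refine (h1.div h2 h).deriv.trans ?_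
  rw [← one_div]
  congr 1
  linear_combination det_eq_one A

theorem deriv_realMoebius_of_mulVec {A : SL2R} {x y j : ℝ}
    (h : (A : M2) *ᵥ vec x = j • vec y) :
    deriv (realMoebius (proj A)) x = (j ^ 2)⁻¹ := by
  obtain ⟨-, h1⟩ := (mulVec_vec_eq_iff ..).mp h
  rw [deriv_realMoebius (by rw [h1]; exact factor_ne_zero h), h1]

theorem sub_eq_of_mulVec {A : SL2R} {x y x' y' j k : ℝ}
    (hx : (A : M2) *ᵥ vec x = j • vec x')
    (hy : (A : M2) *ᵥ vec y = k • vec y') :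
    j * k * (y' - x') = y - x := by
  obtain ⟨h0, h1⟩ := (mulVec_vec_eq_iff ..).mp hx
  obtain ⟨k0, k1⟩ := (mulVec_vec_eq_iff ..).mp hy
  have := det_eq_one A
  linear_combination (y - x) * this + k * h0 - j * k0 - (A 0 0 * y + A 0 1) * h1 +
    (A 0 0 * x + A 0 1) * k1

/-- A Möbius transformation maps the interval `[x, y]` onto `[x', y']` when it maps the end points
to the end points in the right order. -/
theorem moebius_image_Icc {A : SL2R} {x y x' y' j k : ℝ} (hxy : x < y) (hxy' : x' < y')
    (hx : (A : M2) *ᵥ vec x = j • vec x')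
    (hy : (A : M2) *ᵥ vec y = k • vec y') :
    moebius (proj A) '' (((↑) : ℝ → OnePoint ℝ) '' Set.Icc x y) =
      ((↑) : ℝ → OnePoint ℝ) '' Set.Icc x' y' := by
  have key : ∀ {A : SL2R} {x y x' y' j k : ℝ}, x < y → x' < y' →
      (A : M2) *ᵥ vec x = j • vec x' →
      (A : M2) *ᵥ vec y = k • vec y' →
      ∀ z ∈ Set.Icc x y, ∃ w ∈ Set.Icc x' y', ∃ l : ℝ,
        (A : M2) *ᵥ vec z = l • vec w := by
    intro A x y x' y' j k hxy hxy' hx hy z hz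
    have hjk : 0 < j * k := by
      have := sub_eq_of_mulVec hx hy
      have h1 : 0 < j * k * (y' - x') := by rw [this]; linarith
      exact (mul_pos_iff_of_pos_right (by linarith)).mp h1
    obtain ⟨-, h1⟩ := (mulVec_vec_eq_iff ..).mp hx
    obtain ⟨-, k1⟩ := (mulVec_vec_eq_iff ..).mp hy
    obtain ⟨l, hl⟩ : ∃ l, l = A 1 0 * z + A 1 1 := ⟨_, rfl⟩
    have hlin : (y - x) * l = (y - z) * j + (z - x) * k := by
      rw [hl]; linear_combination (y - z) * h1 + (z - x) * k1
    have hjl : 0 < j * l := by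
      have h2 : 0 < (y - x) * (j * l) := by
        have : (y - x) * (j * l) = (y - z) * j ^ 2 + (z - x) * (j * k) := by
          linear_combination j * hlin
        rw [this]
        have hj2 : 0 < j ^ 2 := by have := factor_ne_zero hx; positivity
        rcases hz.1.eq_or_lt with h | h
        · subst h; simp; positivity
        · have := mul_pos (sub_pos.mpr h) hjk
          have := mul_nonneg (sub_nonneg.mpr hz.2) hj2.le
          linarith
      exact (mul_pos_iff_of_pos_left (by linarith)).mp h2
    have hl0 : l ≠ 0 := by rintro rfl; simp at hjl
    have hz' : (A : M2) *ᵥ vec z =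
        l • vec ((A 0 0 * z + A 0 1) / l) := by
      rw [mulVec_vec_eq_iff]
      exact ⟨by field_simp, hl.symm⟩
    have hkl : 0 < l * k := by
      have : 0 < (j * l) * (j * k) := by positivity
      have : 0 < j ^ 2 * (l * k) := by linarith
      exact (mul_pos_iff_of_pos_left (by have := factor_ne_zero hx; positivity)).mp this
    refine ⟨_, ⟨?_, ?_⟩, l, hz'⟩
    · have := sub_eq_of_mulVec hx hz'
      have h3 : 0 ≤ j * l * ((A 0 0 * z + A 0 1) / l - x') := by rw [this]; linarith [hz.1]
      have := (mul_nonneg_iff_of_pos_left hjl).mp h3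
      linarith
    · have := sub_eq_of_mulVec hz' hy
      have h3 : 0 ≤ l * k * (y' - (A 0 0 * z + A 0 1) / l) := by rw [this]; linarith [hz.2]
      have := (mul_nonneg_iff_of_pos_left hkl).mp h3
      linarith
  have inv : ∀ {z w l : ℝ}, (A : M2) *ᵥ vec z = l • vec w →
      ((A⁻¹ : SL2R) : M2) *ᵥ vec w = l⁻¹ • vec z := by
    intro z w l h
    have hl := factor_ne_zero h
    have h2 : ((A⁻¹ : SL2R) : M2) *ᵥ (l • vec w) = vec z := by
      rw [← h, mulVec_mulVec, ← Matrix.SpecialLinearGroup.coe_mul]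
      simp
    rw [mulVec_smul] at h2
    rw [← h2, smul_smul, inv_mul_cancel₀ hl, one_smul]
  ext p
  constructor
  · rintro ⟨_, ⟨z, hz, rfl⟩, rfl⟩
    obtain ⟨w, hw, hl⟩ := key hxy hxy' hx hy z hz
    exact ⟨w, hw, ((moebius_proj_coe_eq_coe_iff A z w).mpr hl).symm⟩
  · rintro ⟨w, hw, rfl⟩
    obtain ⟨z, hz, l, hl⟩ := key hxy' hxy (inv hx) (inv hy) w hw
    refine ⟨z, ⟨z, hz, rfl⟩, (moebius_proj_coe_eq_coe_iff A z w).mpr ⟨l⁻¹, ?_⟩⟩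
    have hl' := factor_ne_zero hl
    have h2 : (A : M2) *ᵥ (l • vec z) = vec w := by
      rw [← hl, mulVec_mulVec, ← Matrix.SpecialLinearGroup.coe_mul]
      simp
    rw [mulVec_smul] at h2
    rw [← h2, smul_smul, inv_mul_cancel₀ hl', one_smul]

end MoebiusIET

noncomputable section

namespace MoebiusIET

/-! ### Turning around the vertices -/

section Combinatorics

variable {n : ℕ} (σ : Equiv.Perm (Fin (n + 1)))

@[simp] theorem upPerm_castSucc (i : Fin (n + 1)) :
    upPerm σ i.castSucc = (σ⁻¹ i).castSucc := by
  simp [upPerm]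

@[simp] theorem upPerm_last : upPerm σ (Fin.last (n + 1)) = Fin.last (n + 1) := by
  simp [upPerm]

@[simp] theorem downPerm_succ (j : Fin (n + 1)) : downPerm σ j.succ = (σ j).succ := by
  simp [downPerm]

@[simp] theorem downPerm_zero : downPerm σ 0 = 0 := by
  simp [downPerm]

@[simp] theorem upWord_castSucc (i : Fin (n + 1)) :
    upWord i.castSucc = FreeGroup.of i := by simp [upWord]

@[simp] theorem upWord_last : upWord (Fin.last (n + 1)) = 1 := by simp [upWord]

@[simp] theorem downWord_succ (j : Fin (n + 1)) :
    downWord σ j.succ = (FreeGroup.of (σ j))⁻¹ := rfl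

@[simp] theorem downWord_zero : downWord σ 0 = 1 := rfl

theorem vertexOf_eq_iff (p q : Fin (n + 2)) :
    vertexOf σ p = vertexOf σ q ↔ (cornerPerm σ).SameCycle p q := Quotient.eq

theorem vertexOf_cornerPerm (p : Fin (n + 2)) :
    vertexOf σ (cornerPerm σ p) = vertexOf σ p :=
  (vertexOf_eq_iff σ _ _).mpr (Equiv.Perm.sameCycle_apply_left.mpr (Equiv.Perm.SameCycle.refl _ _))

theorem vertexOf_pow (p : Fin (n + 2)) (k : ℕ) :
    vertexOf σ ((cornerPerm σ ^ k) p) = vertexOf σ p := by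
  induction k with
  | zero => rfl
  | succ k ih => rw [pow_succ', Equiv.Perm.mul_apply, vertexOf_cornerPerm, ih]

theorem vertexOf_surjective : Function.Surjective (vertexOf σ) := Quotient.mk_surjective

theorem walkWord_succ' (p : Fin (n + 2)) (k : ℕ) :
    walkWord σ p (k + 1) = walkWord σ (cornerPerm σ p) k * stepWord σ p := by
  induction k with
  | zero => simp [walkWord]
  | succ k ih =>
    rw [walkWord, ih, walkWord, ← mul_assoc, pow_succ, Equiv.Perm.mul_apply]

theorem pow_minimalPeriod (p : Fin (n + 2)) :
    (cornerPerm σ ^ Function.minimalPeriod (cornerPerm σ) p) p = p := by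
  rw [Equiv.Perm.coe_pow]
  exact Function.iterate_minimalPeriod

theorem minimalPeriod_cornerPerm (p : Fin (n + 2)) :
    Function.minimalPeriod (cornerPerm σ) (cornerPerm σ p) =
      Function.minimalPeriod (cornerPerm σ) p :=
  Function.minimalPeriod_apply
    (Function.Injective.mem_periodicPts (cornerPerm σ).injective p)

/-- The peripheral loops at successive corners are conjugate. -/
theorem peripheralLoop_cornerPerm (p : Fin (n + 2)) :
    peripheralLoop σ (cornerPerm σ p) * stepWord σ p = stepWord σ p * peripheralLoop σ p := by
  rw [peripheralLoop, minimalPeriod_cornerPerm, ← walkWord_succ', walkWord, pow_minimalPeriod]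
  rfl

/-- A product over the steps of a loop is a product over the corners of a vertex. -/
@[to_additive /-- A sum over the steps of a loop is a sum over the corners of a vertex. -/]
theorem prod_range_minimalPeriod {M : Type*} [CommMonoid M] [DecidableEq (Vertices σ)]
    (f : Fin (n + 2) → M) (p : Fin (n + 2)) :
    ∏ k ∈ Finset.range (Function.minimalPeriod (cornerPerm σ) p), f ((cornerPerm σ ^ k) p) =
      ∏ q, if vertexOf σ q = vertexOf σ p then f q else 1 := by
  rw [← Finset.prod_filter]
  refine Finset.prod_bij (fun k _ => (cornerPerm σ ^ k) p) ?_ ?_ ?_ (fun _ _ => rfl)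
  · intro k _
    simp [vertexOf_pow]
  · intro k hk l hl h
    have := Function.iterate_injOn_Iio_minimalPeriod (f := cornerPerm σ) (x := p)
    refine this (by simpa using hk) (by simpa using hl) ?_
    simpa only [Equiv.Perm.coe_pow] using h
  · intro q hq
    rw [Finset.mem_filter, vertexOf_eq_iff] at hq
    obtain ⟨k, -, hk⟩ := hq.2.symm.exists_pow_eq'
    refine ⟨k % Function.minimalPeriod (cornerPerm σ) p, ?_, ?_⟩
    · rw [Finset.mem_range]
      exact Nat.mod_lt _ (Function.minimalPeriod_pos_of_mem_periodicPts
        (Function.Injective.mem_periodicPts (cornerPerm σ).injective p))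
    · rw [← hk, Equiv.Perm.coe_pow, Equiv.Perm.coe_pow]
      exact Function.iterate_mod_minimalPeriod_eq

@[to_additive]
theorem prod_vertex_cornerPerm {M : Type*} [CommMonoid M] [DecidableEq (Vertices σ)]
    (f : Fin (n + 2) → M) (v : Vertices σ) :
    (∏ q, if vertexOf σ q = v then f (cornerPerm σ q) else 1) =
      ∏ q, if vertexOf σ q = v then f q else 1 := by
  refine Fintype.prod_equiv (cornerPerm σ) _ _ fun q => ?_
  rw [vertexOf_cornerPerm]

theorem one_le_of_isGenusOne (hσ : IsGenusOne σ) : 1 ≤ n := by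
  have : 0 < Fintype.card (Vertices σ) := Fintype.card_pos_iff.mpr ⟨vertexOf σ 0⟩
  rw [hσ] at this
  exact this

end Combinatorics

/-! ### Representations given by tuples of matrices -/

section Words

variable {n : ℕ} (σ : Equiv.Perm (Fin (n + 1)))

/-- The value of a word at a tuple of matrices. -/
abbrev wordSL (A : Fin (n + 1) → SL2R) (w : FreeGroup (Fin (n + 1))) : SL2R :=
  FreeGroup.lift A w

/-- The value of the peripheral loop at a corner. -/
def loopSL (A : Fin (n + 1) → SL2R) (p : Fin (n + 2)) : SL2R := wordSL A (peripheralLoop σ p)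

/-- The value of the word of a step around a vertex. -/
def stepSL (A : Fin (n + 1) → SL2R) (p : Fin (n + 2)) : SL2R := wordSL A (stepWord σ p)

theorem loopSL_cornerPerm (A : Fin (n + 1) → SL2R) (p : Fin (n + 2)) :
    loopSL σ A (cornerPerm σ p) * stepSL σ A p = stepSL σ A p * loopSL σ A p := by
  simp only [loopSL, stepSL, wordSL, ← map_mul, peripheralLoop_cornerPerm]

/-- The representation given by a tuple of matrices. -/
def repSL (A : Fin (n + 1) → SL2R) : Rep n := Rep.ofGens (fun i => proj (A i))

theorem repSL_eval (A : Fin (n + 1) → SL2R) (w : FreeGroup (Fin (n + 1))) :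
    (repSL A).eval w = proj (wordSL A w) := by
  have : FreeGroup.lift (fun i => proj (A i)) = (QuotientGroup.mk' _).comp (FreeGroup.lift A) := by
    ext i
    simp
  exact DFunLike.congr_fun this w

@[ext] theorem Rep.ext_of {ρ ρ' : Rep n} (h : ∀ i, ρ.eval (FreeGroup.of i) = ρ'.eval (FreeGroup.of i)) :
    ρ = ρ' := FreeGroup.ext_hom ρ ρ' h

@[simp] theorem Rep.ofGens_eval_of (g : Fin (n + 1) → PSL2R) (i : Fin (n + 1)) :
    (Rep.ofGens g).eval (FreeGroup.of i) = g i := FreeGroup.lift_apply_of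

theorem Rep.ofGens_injective : Function.Injective (Rep.ofGens (n := n)) := by
  intro g g' h
  funext i
  rw [← Rep.ofGens_eval_of g, h, Rep.ofGens_eval_of]

theorem wordSL_conj (A : Fin (n + 1) → SL2R) (K : SL2R) (w : FreeGroup (Fin (n + 1))) :
    wordSL (fun i => K * A i * K⁻¹) w = K * wordSL A w * K⁻¹ := by
  have : FreeGroup.lift (fun i => K * A i * K⁻¹) =
      (MulAut.conj K).toMonoidHom.comp (FreeGroup.lift A) := by
    ext i
    simp
  simpa using DFunLike.congr_fun this w

theorem loopSL_conj (A : Fin (n + 1) → SL2R) (K : SL2R) (p : Fin (n + 2)) :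
    loopSL σ (fun i => K * A i * K⁻¹) p = K * loopSL σ A p * K⁻¹ := wordSL_conj A K _

theorem repSL_orbit_eq_iff (A B : Fin (n + 1) → SL2R) :
    (repSL A).orbit = (repSL B).orbit ↔ ∃ K : SL2R, repSL B = repSL fun i => K * A i * K⁻¹ := by
  rw [Rep.orbit, Rep.orbit, Quotient.eq]
  constructor
  · rintro ⟨g, hg⟩
    obtain ⟨K, rfl⟩ := proj_surjective g
    refine ⟨K, Rep.ext_of fun i => ?_⟩
    rw [hg, repSL_eval, repSL_eval, wordSL_conj]
    rfl
  · rintro ⟨K, hK⟩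
    refine ⟨proj K, fun w => ?_⟩
    rw [hK, repSL_eval, repSL_eval, wordSL_conj]
    rfl

theorem repSL_orbit_conj (A : Fin (n + 1) → SL2R) (K : SL2R) :
    (repSL fun i => K * A i * K⁻¹).orbit = (repSL A).orbit :=
  ((repSL_orbit_eq_iff A _).mpr ⟨K, rfl⟩).symm

theorem exists_repSL (ρ : Rep n) : ∃ A : Fin (n + 1) → SL2R, repSL A = ρ := by
  choose A hA using fun i => proj_surjective (ρ.eval (FreeGroup.of i))
  refine ⟨A, Rep.ext_of fun i => ?_⟩
  rw [repSL, Rep.ofGens_eval_of, hA]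

end Words

end MoebiusIET

end

noncomputable section

namespace MoebiusIET

/-! ### The corners of an interval exchange as fixed points of the peripheral elements -/

theorem inv_mulVec_of_mulVec {A : SL2R} {v w : Fin 2 → ℝ} {l : ℝ} (hl : l ≠ 0)
    (h : (A : M2) *ᵥ v = l • w) : ((A⁻¹ : SL2R) : M2) *ᵥ w = l⁻¹ • v := by
  have h2 : ((A⁻¹ : SL2R) : M2) *ᵥ (l • w) = v := by
    rw [← h, mulVec_mulVec, ← Matrix.SpecialLinearGroup.coe_mul]
    simp
  rw [mulVec_smul] at h2
  rw [← h2, smul_smul, inv_mul_cancel₀ hl, one_smul]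

theorem mul_mulVec_of_mulVec {A B : SL2R} {u v w : Fin 2 → ℝ} {j l : ℝ}
    (hA : (A : M2) *ᵥ u = j • v) (hB : (B : M2) *ᵥ v = l • w) :
    ((B * A : SL2R) : M2) *ᵥ u = (l * j) • w := by
  rw [Matrix.SpecialLinearGroup.coe_mul, ← mulVec_mulVec, hA, mulVec_smul, hB, smul_smul, mul_comm]

/-- The determinant of two vectors. -/
def cross (u v : Fin 2 → ℝ) : ℝ := u 0 * v 1 - u 1 * v 0

theorem cross_mulVec (M : M2) (u v : Fin 2 → ℝ) :
    cross (M *ᵥ u) (M *ᵥ v) = M.det * cross u v := by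
  simp only [cross, mulVec, dotProduct, Fin.sum_univ_two, det_fin_two]
  ring

theorem cross_smul_smul (a b : ℝ) (u v : Fin 2 → ℝ) :
    cross (a • u) (b • v) = a * b * cross u v := by
  simp only [cross, Pi.smul_apply, smul_eq_mul]
  ring

theorem eq_smul_vec_of_cross {x : ℝ} {v : Fin 2 → ℝ} (h : cross (vec x) v = 0) :
    v = v 1 • vec x := by
  simp only [cross, vec_zero, vec_one] at h
  ext i
  fin_cases i
  · simp; linarith
  · simp

/-- Two eigenvectors of an element of `SL(2, ℝ)` with the same multiplier are parallel. -/
theorem cross_eq_zero_of_eigen {D : SL2R} {u v : Fin 2 → ℝ} {l m : ℝ} (hu : (D : M2) *ᵥ u = l • u)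
    (hv : (D : M2) *ᵥ v = m • v) (hlm : l ^ 2 = m ^ 2) (h1 : l ^ 2 ≠ 1) : cross u v = 0 := by
  by_contra hne
  have h := cross_mulVec (D : M2) u v
  rw [hu, hv, cross_smul_smul, D.det_coe] at h
  have h2 : l * m = 1 := mul_right_cancel₀ hne h
  have h3 : (l ^ 2 - 1) * (l ^ 2 + 1) = 0 := by
    linear_combination (l * m + 1) * h2 + l ^ 2 * hlm
  rcases mul_eq_zero.mp h3 with h | h
  · exact h1 (by linarith)
  · nlinarith

namespace PIET

variable {n : ℕ} {σ : Equiv.Perm (Fin (n + 1))}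

/-- The matrices `A` represent the branches. -/
def IsLift (T : PIET σ) (A : Fin (n + 1) → SL2R) : Prop := ∀ i, proj (A i) = T.branch i

theorem exists_isLift (T : PIET σ) : ∃ A, T.IsLift A := by
  choose A hA using fun i => proj_surjective (T.branch i)
  exact ⟨A, hA⟩

theorem IsLift.rep_eq {T : PIET σ} {A : Fin (n + 1) → SL2R} (h : T.IsLift A) :
    T.rep = repSL A := by
  rw [rep, repSL]
  congr 1
  funext i
  exact (h i).symm

theorem IsLift.endpoints {T : PIET σ} {A : Fin (n + 1) → SL2R} (h : T.IsLift A)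
    (j : Fin (n + 1)) :
    (∃ l : ℝ, (A (σ j) : M2) *ᵥ vec (T.top (σ j).castSucc) = l • vec (T.bot j.castSucc)) ∧
    (∃ l : ℝ, (A (σ j) : M2) *ᵥ vec (T.top (σ j).succ) = l • vec (T.bot j.succ)) := by
  have himg := T.image_eq j
  rw [← h (σ j)] at himg
  set B := A (σ j)
  set x := T.top (σ j).castSucc
  set y := T.top (σ j).succ
  set x' := T.bot j.castSucc
  set y' := T.bot j.succ
  have hxy : x < y := T.top_strictMono (Fin.castSucc_lt_succ)
  have hxy' : x' < y' := T.bot_strictMono (Fin.castSucc_lt_succ)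
  have hmap : ∀ z ∈ Set.Icc x y, ∃ w ∈ Set.Icc x' y', ∃ l : ℝ, (B : M2) *ᵥ vec z = l • vec w := by
    intro z hz
    have : moebius (proj B) z ∈ ((↑) : ℝ → OnePoint ℝ) '' Set.Icc x' y' := by
      rw [← himg]
      exact ⟨z, ⟨z, hz, rfl⟩, rfl⟩
    obtain ⟨w, hw, hw'⟩ := this
    exact ⟨w, hw, (moebius_proj_coe_eq_coe_iff B z w).mp hw'.symm⟩
  have hsurj : ∀ w ∈ Set.Icc x' y', ∃ z ∈ Set.Icc x y, ∃ l : ℝ, (B : M2) *ᵥ vec z = l • vec w := by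
    intro w hw
    have : (w : OnePoint ℝ) ∈ ((↑) : ℝ → OnePoint ℝ) '' Set.Icc x' y' := ⟨w, hw, rfl⟩
    rw [← himg] at this
    obtain ⟨_, ⟨z, hz, rfl⟩, hw'⟩ := this
    exact ⟨z, hz, (moebius_proj_coe_eq_coe_iff B z w).mp hw'⟩
  have hpos : ∀ z ∈ Set.Icc x y, ∀ w ∈ Set.Icc x y,
      0 < (B 1 0 * z + B 1 1) * (B 1 0 * w + B 1 1) := by
    intro z hz w hw
    by_contra hneg
    have hcont : ContinuousOn (fun s : ℝ => B 1 0 * s + B 1 1) (Set.uIcc z w) := by fun_prop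
    have h0 : (0 : ℝ) ∈ Set.uIcc (B 1 0 * z + B 1 1) (B 1 0 * w + B 1 1) := by
      rw [Set.mem_uIcc]
      rcases le_total (B 1 0 * z + B 1 1) 0 with h1 | h1 <;>
      rcases le_total (B 1 0 * w + B 1 1) 0 with h2 | h2
      · rcases h1.eq_or_lt with h1 | h1
        · right; exact ⟨h2, h1.ge⟩
        · rcases h2.eq_or_lt with h2 | h2
          · left; exact ⟨h1.le, h2.ge⟩
          · exact absurd (mul_pos_of_neg_of_neg h1 h2) hneg
      · left; exact ⟨h1, h2⟩
      · right; exact ⟨h2, h1⟩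
      · rcases h1.eq_or_lt with h1 | h1
        · left; exact ⟨h1.ge, h2⟩
        · rcases h2.eq_or_lt with h2 | h2
          · right; exact ⟨h2.ge, h1.le⟩
          · exact absurd (mul_pos h1 h2) hneg
    obtain ⟨s, hs, hs0⟩ := intermediate_value_uIcc hcont h0
    have hs' : s ∈ Set.Icc x y := Set.uIcc_subset_Icc hz hw hs
    obtain ⟨w, -, l, hl⟩ := hmap s hs'
    have h1 := ((mulVec_vec_eq_iff ..).mp hl).2
    exact factor_ne_zero hl (by rw [← h1]; exact hs0)
  have hmono : ∀ {z w z' w' l m : ℝ}, z ∈ Set.Icc x y → w ∈ Set.Icc x y → z ≤ w →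
      (B : M2) *ᵥ vec z = l • vec z' → (B : M2) *ᵥ vec w = m • vec w' → z' ≤ w' := by
    intro z w z' w' l m hz hw hzw hl hm
    have h1 := ((mulVec_vec_eq_iff ..).mp hl).2
    have h2 := ((mulVec_vec_eq_iff ..).mp hm).2
    have h3 := hpos z hz w hw
    rw [h1, h2] at h3
    have h4 := sub_eq_of_mulVec hl hm
    have h5 : 0 ≤ l * m * (w' - z') := by rw [h4]; linarith
    have := (mul_nonneg_iff_of_pos_left h3).mp h5
    linarith
  have hx : x ∈ Set.Icc x y := ⟨le_rfl, hxy.le⟩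
  have hy : y ∈ Set.Icc x y := ⟨hxy.le, le_rfl⟩
  constructor
  · obtain ⟨w, hw, l, hl⟩ := hmap x hx
    obtain ⟨z, hz, m, hm⟩ := hsurj x' ⟨le_rfl, hxy'.le⟩
    have := hmono hx hz hz.1 hl hm
    exact ⟨l, by rw [hl, le_antisymm this hw.1]⟩
  · obtain ⟨w, hw, l, hl⟩ := hmap y hy
    obtain ⟨z, hz, m, hm⟩ := hsurj y' ⟨hxy'.le, le_rfl⟩
    have := hmono hz hy hz.2 hm hl
    exact ⟨l, by rw [hl, le_antisymm hw.2 this]⟩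

/-- The derivative to the right of a corner, with value `1` at the last corner. -/
def rightDeriv (T : PIET σ) : Fin (n + 2) → ℝ :=
  Fin.lastCases 1 fun i => deriv (realMoebius (T.branch i)) (T.top i.castSucc)

/-- The derivative to the left of a corner, with value `1` at the first corner. -/
def leftDeriv (T : PIET σ) : Fin (n + 2) → ℝ :=
  Fin.cases 1 fun i => deriv (realMoebius (T.branch i)) (T.top i.succ)

open Classical in
theorem breakSize_eq (T : PIET σ) (v : Vertices σ) :
    T.breakSize v = (∏ p, if vertexOf σ p = v then T.rightDeriv p else 1) /
      ∏ p, if vertexOf σ p = v then T.leftDeriv p else 1 := by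
  rw [Fin.prod_univ_castSucc, Fin.prod_univ_succ (n := n + 1)]
  simp [breakSize, rightDeriv, leftDeriv]

variable {T : PIET σ} {A : Fin (n + 1) → SL2R}

theorem IsLift.up (h : T.IsLift A) (p : Fin (n + 2)) :
    ∃ l : ℝ, (wordSL A (upWord p) : M2) *ᵥ vec (T.top p) = l • vec (T.bot (upPerm σ p)) ∧
      l ^ 2 * T.rightDeriv p = 1 := by
  induction p using Fin.lastCases with
  | last => exact ⟨1, by simp [T.bot_last], by simp [rightDeriv]⟩
  | cast i =>
    obtain ⟨l, hl⟩ := (h.endpoints (σ⁻¹ i)).1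
    rw [show σ (σ⁻¹ i) = i from σ.apply_symm_apply i] at hl
    refine ⟨l, by simpa using hl, ?_⟩
    simp only [rightDeriv, Fin.lastCases_castSucc]
    rw [← h i, deriv_realMoebius_of_mulVec hl]
    have := factor_ne_zero hl
    field_simp

theorem IsLift.down (h : T.IsLift A) (q : Fin (n + 2)) :
    ∃ l : ℝ, (wordSL A (downWord σ q) : M2) *ᵥ vec (T.bot q) = l • vec (T.top (downPerm σ q)) ∧
      l ^ 2 = T.leftDeriv (downPerm σ q) := by
  induction q using Fin.cases with
  | zero => exact ⟨1, by simp [T.bot_zero], by simp [leftDeriv]⟩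
  | succ j =>
    obtain ⟨l, hl⟩ := (h.endpoints j).2
    have hl0 := factor_ne_zero hl
    refine ⟨l⁻¹, ?_, ?_⟩
    · simpa using inv_mulVec_of_mulVec hl0 hl
    · rw [downPerm_succ]
      simp only [leftDeriv, Fin.cases_succ]
      rw [← h (σ j), deriv_realMoebius_of_mulVec hl, inv_pow]

theorem IsLift.step (h : T.IsLift A) (p : Fin (n + 2)) :
    ∃ l : ℝ, (stepSL σ A p : M2) *ᵥ vec (T.top p) = l • vec (T.top (cornerPerm σ p)) ∧
      l ^ 2 * T.rightDeriv p = T.leftDeriv (cornerPerm σ p) := by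
  obtain ⟨l, hl, hl'⟩ := h.up p
  obtain ⟨m, hm, hm'⟩ := h.down (upPerm σ p)
  refine ⟨m * l, ?_, ?_⟩
  · rw [stepSL, wordSL, stepWord, map_mul]
    exact mul_mulVec_of_mulVec hl hm
  · rw [mul_pow, mul_assoc, hl', mul_one, hm']
    rfl

theorem IsLift.walk (h : T.IsLift A) (p : Fin (n + 2)) (k : ℕ) :
    ∃ l : ℝ, (wordSL A (walkWord σ p k) : M2) *ᵥ vec (T.top p) =
        l • vec (T.top ((cornerPerm σ ^ k) p)) ∧
      l ^ 2 * ∏ j ∈ Finset.range k, T.rightDeriv ((cornerPerm σ ^ j) p) =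
        ∏ j ∈ Finset.range k, T.leftDeriv (cornerPerm σ ((cornerPerm σ ^ j) p)) := by
  induction k with
  | zero => exact ⟨1, by simp [walkWord], by simp⟩
  | succ k ih =>
    obtain ⟨l, hl, hl'⟩ := ih
    obtain ⟨m, hm, hm'⟩ := h.step ((cornerPerm σ ^ k) p)
    refine ⟨m * l, ?_, ?_⟩
    · rw [wordSL, walkWord, map_mul, pow_succ', Equiv.Perm.mul_apply]
      exact mul_mulVec_of_mulVec hl hm
    · rw [Finset.prod_range_succ, Finset.prod_range_succ, ← hl', ← hm']
      ring

theorem leftDeriv_ne_zero (T : PIET σ) (p : Fin (n + 2)) : T.leftDeriv p ≠ 0 := by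
  obtain ⟨A, h⟩ := T.exists_isLift
  obtain ⟨l, hl', hl⟩ := h.down ((downPerm σ).symm p)
  rw [Equiv.apply_symm_apply] at hl
  rw [← hl]
  exact pow_ne_zero _ (factor_ne_zero hl')

/-- The peripheral element at a corner fixes that corner and its multiplier is the break size. -/
theorem IsLift.loop (h : T.IsLift A) (p : Fin (n + 2)) :
    ∃ l : ℝ, (loopSL σ A p : M2) *ᵥ vec (T.top p) = l • vec (T.top p) ∧
      l ^ 2 * T.breakSize (vertexOf σ p) = 1 := by
  classical
  obtain ⟨l, hl, hl'⟩ := h.walk p (Function.minimalPeriod (cornerPerm σ) p)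
  rw [pow_minimalPeriod] at hl
  refine ⟨l, hl, ?_⟩
  rw [prod_range_minimalPeriod σ T.rightDeriv,
    prod_range_minimalPeriod σ (fun q => T.leftDeriv (cornerPerm σ q)),
    prod_vertex_cornerPerm] at hl'
  have hne : (∏ q, if vertexOf σ q = vertexOf σ p then T.leftDeriv q else 1) ≠ 0 := by
    refine Finset.prod_ne_zero_iff.mpr fun q _ => ?_
    split_ifs
    · exact T.leftDeriv_ne_zero q
    · exact one_ne_zero
  rw [breakSize_eq, ← mul_div_assoc, div_eq_one_iff_eq (by convert hne)]
  convert hl'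

/-- An interval exchange from the branches and the end points of the intervals. -/
def ofData (A : Fin (n + 1) → SL2R) (t b : Fin (n + 2) → ℝ) (ht : StrictMono t)
    (hb : StrictMono b) (h0 : b 0 = t 0) (hlast : b (Fin.last (n + 1)) = t (Fin.last (n + 1)))
    (hl : ∀ j, ∃ l : ℝ, (A (σ j) : M2) *ᵥ vec (t (σ j).castSucc) = l • vec (b j.castSucc))
    (hr : ∀ j, ∃ l : ℝ, (A (σ j) : M2) *ᵥ vec (t (σ j).succ) = l • vec (b j.succ)) : PIET σ where
  top := t
  bot := b
  branch i := proj (A i)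
  top_strictMono := ht
  bot_strictMono := hb
  bot_zero := h0
  bot_last := hlast
  image_eq j := by
    obtain ⟨l, hl⟩ := hl j
    obtain ⟨m, hm⟩ := hr j
    exact moebius_image_Icc (ht Fin.castSucc_lt_succ) (hb Fin.castSucc_lt_succ) hl hm

/-- The end points of the top intervals determine those of the bottom intervals. -/
theorem ext_of_top_branch {T T' : PIET σ} (ht : T.top = T'.top) (hb : T.branch = T'.branch) :
    T = T' := by
  refine PIET.ext ht ?_ hb
  obtain ⟨A, hA⟩ := T.exists_isLift
  have hA' : T'.IsLift A := fun i => by rw [hA i, hb]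
  funext q
  obtain ⟨l, hl, -⟩ := hA.up ((upPerm σ).symm q)
  obtain ⟨m, hm, -⟩ := hA'.up ((upPerm σ).symm q)
  rw [Equiv.apply_symm_apply] at hl hm
  rw [← ht] at hm
  obtain ⟨h0, h1⟩ := (mulVec_vec_eq_iff ..).mp hl
  obtain ⟨k0, k1⟩ := (mulVec_vec_eq_iff ..).mp hm
  have hlm : l = m := h1.symm.trans k1
  subst hlm
  exact mul_left_cancel₀ (factor_ne_zero hl) (h0.symm.trans k0)

/-- The top corners of conjugate interval exchanges with the same break sizes correspond. -/
theorem IsLift.top_conj {T' : PIET σ} {K : SL2R} (h : T.IsLift A)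
    (h' : T'.IsLift fun i => K * A i * K⁻¹) (hTT' : ∀ v, T.breakSize v = T'.breakSize v)
    (h1 : ∀ v, T.breakSize v ≠ 1) (p : Fin (n + 2)) :
    ∃ m : ℝ, (K : M2) *ᵥ vec (T.top p) = m • vec (T'.top p) := by
  obtain ⟨l, hl, hl'⟩ := h.loop p
  obtain ⟨m, hm, hm'⟩ := h'.loop p
  rw [loopSL_conj] at hm
  have hm0 := factor_ne_zero hm
  have hlm : l ^ 2 = m ^ 2 := by
    rw [← hTT'] at hm'
    have hb : T.breakSize (vertexOf σ p) ≠ 0 := fun h0 => by simp [h0] at hl'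
    exact mul_right_cancel₀ hb (hl'.trans hm'.symm)
  have hl1 : l ^ 2 ≠ 1 := fun h => h1 (vertexOf σ p) (by rw [h, one_mul] at hl'; exact hl')
  have key : (loopSL σ A p : M2) *ᵥ (((K⁻¹ : SL2R) : M2) *ᵥ vec (T'.top p)) =
      m • (((K⁻¹ : SL2R) : M2) *ᵥ vec (T'.top p)) := by
    rw [mulVec_mulVec, ← Matrix.SpecialLinearGroup.coe_mul]
    have : loopSL σ A p * K⁻¹ = K⁻¹ * (K * loopSL σ A p * K⁻¹) := by group
    rw [this, Matrix.SpecialLinearGroup.coe_mul, ← mulVec_mulVec, hm, mulVec_smul]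
  have h2 := eq_smul_vec_of_cross (cross_eq_zero_of_eigen hl key hlm hl1)
  have hv : (((K⁻¹ : SL2R) : M2) *ᵥ vec (T'.top p)) 1 ≠ 0 := by
    intro h0
    rw [h0, zero_smul] at h2
    have h3 : ((K : M2) * ((K⁻¹ : SL2R) : M2)) *ᵥ vec (T'.top p) = 0 := by
      rw [← mulVec_mulVec, h2, mulVec_zero]
    rw [← Matrix.SpecialLinearGroup.coe_mul, mul_inv_cancel] at h3
    simpa using congrFun h3 1
  exact ⟨_, by simpa using inv_mulVec_of_mulVec hv h2⟩

end PIET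

end MoebiusIET

end

noncomputable section

namespace MoebiusIET

/-! ### Conjugation of interval exchanges -/

/-- An element of `SL(2, ℝ)` with a fixed point of multiplier `c ≠ 1` is conjugate to the dilation
by `c`. -/
theorem conjClass_of_eigen {D : SL2R} {x l c : ℝ} (hc : 0 < c) (hc1 : c ≠ 1)
    (h : (D : M2) *ᵥ vec x = l • vec x) (hl : l ^ 2 * c = 1) :
    ConjClasses.mk (proj D) = ConjClasses.mk (dilation c hc) := by
  have hl0 := factor_ne_zero h
  obtain ⟨h0, h1⟩ := (mulVec_vec_eq_iff ..).mp h
  have hdet := det_eq_one D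
  have hl1 : l⁻¹ - l ≠ 0 := by
    intro h
    have h3 : l ^ 2 = 1 := by
      field_simp at h
      linarith
    rw [h3, one_mul] at hl
    exact hc1 hl
  set s := D 1 0 / (l⁻¹ - l) with hs
  have hs' : s * (l⁻¹ - l) = D 1 0 := div_mul_cancel₀ _ hl1
  let K : SL2R := ⟨!![1 + s * x, x; s, 1], by simp [det_fin_two, mul_comm]⟩
  have hr : √c ^ 2 = c := Real.sq_sqrt hc.le
  have hr0 : √c ≠ 0 := (Real.sqrt_pos.mpr hc).ne'
  have hlr : l * √c = 1 ∨ l * √c = -1 := by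
    have : (l * √c - 1) * (l * √c + 1) = 0 := by
      linear_combination hl + l ^ 2 * hr
    rcases mul_eq_zero.mp this with h | h
    · left; linarith
    · right; linarith
  have h00 : D 0 0 = l⁻¹ + x * D 1 0 := by
    field_simp
    linear_combination hdet + D 1 0 * h0 - D 0 0 * h1
  have h01 : D 0 1 = l * x - D 0 0 * x := by linarith
  have h11 : D 1 1 = l - D 1 0 * x := by linarith
  have hmul : ∀ ε : ℝ, ε * (√c)⁻¹ = l → ε * √c = l⁻¹ →
      (D : M2) * K = ε • ((K : M2) * dilationSL c hc) := by
    intro ε he1 he2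
    ext i j
    fin_cases i <;> fin_cases j <;>
      simp only [K, dilationSL, Matrix.mul_apply, Fin.sum_univ_two, h01, h11, h00, ← hs', Fin.zero_eta,
        Fin.mk_one, Matrix.smul_apply, of_apply, cons_val', cons_val_zero, cons_val_one, smul_eq_mul,
        cons_val_fin_one]
    · linear_combination -(1 + s * x) * he2
    · linear_combination -x * he1
    · linear_combination -s * he2
    · linear_combination -he1
  have hconj : proj D = proj K * dilation c hc * (proj K)⁻¹ := by
    rw [eq_mul_inv_iff_mul_eq]
    change proj (D * K) = proj (K * dilationSL c hc)
    rw [proj_eq_iff]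
    rcases hlr with h | h
    · left
      have := hmul 1 (by field_simp; linarith) (by field_simp; linarith)
      apply Subtype.ext
      simpa using this.symm
    · right
      have := hmul (-1) (by field_simp; linarith) (by field_simp; linarith)
      apply Subtype.ext
      simp only [Matrix.SpecialLinearGroup.coe_mul, Matrix.SpecialLinearGroup.coe_neg]
      rw [this]
      simp
  rw [ConjClasses.mk_eq_mk_iff_isConj, isConj_comm, isConj_iff]
  exact ⟨proj K, hconj.symm⟩

/-- The square of the trace of an element of `SL(2, ℝ)` that is conjugate to a dilation. -/
theorem trace_of_conjClass {D : SL2R} {l c : ℝ} (hc : 0 < c) (hl : l ^ 2 * c = 1)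
    (h : ConjClasses.mk (proj D) = ConjClasses.mk (dilation c hc)) :
    (D : M2).trace = l + l⁻¹ ∨ (D : M2).trace = -(l + l⁻¹) := by
  rw [ConjClasses.mk_eq_mk_iff_isConj, isConj_comm, isConj_iff] at h
  obtain ⟨g, hg⟩ := h
  obtain ⟨K, rfl⟩ := proj_surjective g
  have hr : √c ^ 2 = c := Real.sq_sqrt hc.le
  have hr0 : √c ≠ 0 := (Real.sqrt_pos.mpr hc).ne'
  have hl0 : l ≠ 0 := by rintro rfl; simp at hl
  have htr : ((K * dilationSL c hc * K⁻¹ : SL2R) : M2).trace = √c + (√c)⁻¹ := by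
    rw [Matrix.SpecialLinearGroup.coe_mul, Matrix.SpecialLinearGroup.coe_mul, trace_mul_comm, ← mul_assoc,
      ← Matrix.SpecialLinearGroup.coe_mul, inv_mul_cancel]
    simp [dilationSL, trace_fin_two]
  have hlr : l * √c = 1 ∨ l * √c = -1 := by
    have : (l * √c - 1) * (l * √c + 1) = 0 := by
      linear_combination hl + l ^ 2 * hr
    rcases mul_eq_zero.mp this with h | h
    · left; linarith
    · right; linarith
  have hval : √c + (√c)⁻¹ = l + l⁻¹ ∨ √c + (√c)⁻¹ = -(l + l⁻¹) := by
    rcases hlr with h | h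
    · left
      rw [eq_inv_of_mul_eq_one_left h, inv_inv]
      ring
    · right
      have : (-l) * √c = 1 := by linarith
      rw [show l = -(√c)⁻¹ by rw [← eq_inv_of_mul_eq_one_left this, neg_neg], inv_neg, inv_inv]
      ring
  have hD := (proj_eq_iff (K * dilationSL c hc * K⁻¹) D).mp hg
  rcases hD with rfl | rfl
  · rw [htr]; exact hval
  · rw [Matrix.SpecialLinearGroup.coe_neg, trace_neg, htr]
    rcases hval with h | h
    · right; rw [h]
    · left; rw [h, neg_neg]

namespace PIET

variable {n : ℕ} {σ : Equiv.Perm (Fin (n + 1))} {T : PIET σ} {A : Fin (n + 1) → SL2R}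

theorem IsLift.mem_relRep (h : T.IsLift A) (c : Vertices σ → ℝ) (hc : ∀ v, 0 < c v)
    (hc1 : ∀ v, c v ≠ 1) (hT : ∀ v, T.breakSize v = c v) :
    repSL A ∈ relRep σ (boundaryClass σ c hc) := by
  intro p
  obtain ⟨l, hl, hl'⟩ := h.loop p
  rw [hT] at hl'
  rw [repSL_eval]
  exact conjClass_of_eigen (hc _) (hc1 _) hl hl'

theorem mulVec_vec {K : SL2R} {x : ℝ} (h : K 1 0 * x + K 1 1 ≠ 0) :
    (K : M2) *ᵥ vec x = (K 1 0 * x + K 1 1) • vec ((K 0 0 * x + K 0 1) / (K 1 0 * x + K 1 1)) := by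
  rw [mulVec_vec_eq_iff]
  exact ⟨(mul_div_cancel₀ _ h).symm, rfl⟩

theorem IsLift.exists_conj (h : T.IsLift A) (K : SL2R)
    (hK : 0 < (K 1 0 * T.top 0 + K 1 1) * (K 1 0 * T.top (Fin.last (n + 1)) + K 1 1)) :
    ∃ T' : PIET σ, T'.IsLift (fun i => K * A i * K⁻¹) ∧
      (∀ p, T'.top p = (K 0 0 * T.top p + K 0 1) / (K 1 0 * T.top p + K 1 1)) ∧
      ∀ v, T'.breakSize v = T.breakSize v := by
  set a := T.top 0 with ha
  set b := T.top (Fin.last (n + 1)) with hb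
  have hab : a < b := T.top_strictMono (Fin.last_pos)
  have hda : ∀ x ∈ Set.Icc a b, 0 < (K 1 0 * a + K 1 1) * (K 1 0 * x + K 1 1) := by
    intro x hx
    have h0 : 0 < (K 1 0 * a + K 1 1) ^ 2 := by
      have : K 1 0 * a + K 1 1 ≠ 0 := fun h0 => by simp [h0] at hK
      positivity
    have h1 : (b - a) * ((K 1 0 * a + K 1 1) * (K 1 0 * x + K 1 1)) =
      (b - x) * (K 1 0 * a + K 1 1) ^ 2 + (x - a) *
        ((K 1 0 * a + K 1 1) * (K 1 0 * b + K 1 1)) := by ring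
    have h2 : 0 < (b - a) * ((K 1 0 * a + K 1 1) * (K 1 0 * x + K 1 1)) := by
      rw [h1]
      rcases hx.2.eq_or_lt with h | h
      · subst h
        have := mul_pos (sub_pos.mpr hab) hK
        linarith
      · have := mul_pos (sub_pos.mpr h) h0
        have := mul_nonneg (sub_nonneg.mpr hx.1) hK.le
        linarith
    exact (mul_pos_iff_of_pos_left (by linarith)).mp h2
  have hne : ∀ x ∈ Set.Icc a b, K 1 0 * x + K 1 1 ≠ 0 := fun x hx h0 => by
    have := hda x hx
    simp [h0] at this
  have hmono : ∀ x ∈ Set.Icc a b, ∀ y ∈ Set.Icc a b, x < y →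
      (K 0 0 * x + K 0 1) / (K 1 0 * x + K 1 1) < (K 0 0 * y + K 0 1) / (K 1 0 * y + K 1 1) := by
    intro x hx y hy hxy
    have h1 := sub_eq_of_mulVec (mulVec_vec (hne x hx)) (mulVec_vec (hne y hy))
    have h2 := mul_pos (hda x hx) (hda y hy)
    have h3 : 0 < (K 1 0 * x + K 1 1) * (K 1 0 * y + K 1 1) := by
      have h4 : 0 < (K 1 0 * a + K 1 1) ^ 2 * ((K 1 0 * x + K 1 1) * (K 1 0 * y + K 1 1)) := by
        linarith
      exact (mul_pos_iff_of_pos_left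
        (by have := hne a ⟨le_rfl, hab.le⟩; positivity)).mp h4
    rw [← sub_pos]
    exact (mul_pos_iff_of_pos_left h3).mp (by rw [h1]; linarith)
  have htop : ∀ p, T.top p ∈ Set.Icc a b := fun p =>
    ⟨T.top_strictMono.monotone (Fin.zero_le p), T.top_strictMono.monotone (Fin.le_last p)⟩
  have hbot : ∀ p, T.bot p ∈ Set.Icc a b := fun p =>
    ⟨by rw [ha, ← T.bot_zero]; exact T.bot_strictMono.monotone (Fin.zero_le p),
      by rw [hb, ← T.bot_last]; exact T.bot_strictMono.monotone (Fin.le_last p)⟩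
  have hconj : ∀ {B : SL2R} {x y l : ℝ}, x ∈ Set.Icc a b → y ∈ Set.Icc a b →
      (B : M2) *ᵥ vec x = l • vec y → ∃ m : ℝ, ((K * B * K⁻¹ : SL2R) : M2) *ᵥ
        vec ((K 0 0 * x + K 0 1) / (K 1 0 * x + K 1 1)) =
          m • vec ((K 0 0 * y + K 0 1) / (K 1 0 * y + K 1 1)) := by
    intro B x y l hx hy hB
    have h1 := inv_mulVec_of_mulVec (hne x hx) (mulVec_vec (hne x hx))
    have h2 := mul_mulVec_of_mulVec h1 (mul_mulVec_of_mulVec hB (mulVec_vec (hne y hy)))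
    exact ⟨_, h2⟩
  let T' : PIET σ := ofData (fun i => K * A i * K⁻¹)
    (fun p => (K 0 0 * T.top p + K 0 1) / (K 1 0 * T.top p + K 1 1))
    (fun p => (K 0 0 * T.bot p + K 0 1) / (K 1 0 * T.bot p + K 1 1))
    (fun p q hpq => hmono _ (htop p) _ (htop q) (T.top_strictMono hpq))
    (fun p q hpq => hmono _ (hbot p) _ (hbot q) (T.bot_strictMono hpq))
    (by simp only [T.bot_zero]) (by simp only [T.bot_last])
    (fun j => by
      obtain ⟨l, hl⟩ := (h.endpoints j).1
      exact hconj (htop _) (hbot _) hl)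
    (fun j => by
      obtain ⟨l, hl⟩ := (h.endpoints j).2
      exact hconj (htop _) (hbot _) hl)
  have hT' : T'.IsLift (fun i => K * A i * K⁻¹) := fun i => rfl
  refine ⟨T', hT', fun p => rfl, fun v => ?_⟩
  obtain ⟨p, rfl⟩ := vertexOf_surjective σ v
  obtain ⟨l, hl, hl'⟩ := h.loop p
  obtain ⟨m, hm, hm'⟩ := hT'.loop p
  have h1 := mulVec_vec (hne _ (htop p))
  have h2 := mul_mulVec_of_mulVec (inv_mulVec_of_mulVec (hne _ (htop p)) h1)
    (mul_mulVec_of_mulVec hl h1)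
  rw [loopSL_conj] at hm
  have h3 := congrFun (hm.symm.trans h2) 1
  simp only [Pi.smul_apply, vec_one, smul_eq_mul, mul_one] at h3
  rw [mul_comm _ l, mul_assoc, mul_inv_cancel₀ (hne _ (htop p)), mul_one] at h3
  rw [h3] at hm'
  exact mul_left_cancel₀ (pow_ne_zero 2 (factor_ne_zero hl)) (hm'.trans hl'.symm)

end PIET

/-- The matrix that maps `w`, `(a, 1)`, `(b, 1)` to multiples of `(1, 0)`, `(0, 1)`, `(1, 1)`. -/
def normMat (w : Fin 2 → ℝ) (a b : ℝ) : M2 :=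
  !![cross w (vec b), -(cross w (vec b) * a); -((b - a) * w 1), (b - a) * w 0]

theorem det_normMat (w : Fin 2 → ℝ) (a b : ℝ) :
    (normMat w a b).det = (b - a) * (cross w (vec a) * cross w (vec b)) := by
  simp [normMat, det_fin_two, cross]
  ring

/-- The point that corresponds to `x` under `normMat w a b`. -/
def normPt (w : Fin 2 → ℝ) (a b x : ℝ) : ℝ :=
  cross w (vec b) * (x - a) / ((b - a) * cross w (vec x))

theorem PIET.IsLift.exists_normalized {n : ℕ} {σ : Equiv.Perm (Fin (n + 1))} {T : PIET σ}
    {A : Fin (n + 1) → SL2R} (h : T.IsLift A) {c : Vertices σ → ℝ}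
    (hT : ∀ v, T.breakSize v = c v) {w : Fin 2 → ℝ} {m : ℝ} (hw : (loopSL σ A 0 : M2) *ᵥ w = m • w)
    (hpos : 0 < cross w (vec (T.top 0)) * cross w (vec (T.top (Fin.last (n + 1))))) :
    ∃ (T' : E σ c) (K : SL2R), T'.1.IsLift (fun i => K * A i * K⁻¹) ∧
      (∀ p, T'.1.top p = normPt w (T.top 0) (T.top (Fin.last (n + 1))) (T.top p)) ∧
      ∀ i, ((K * A i * K⁻¹ : SL2R) : M2) =
        ((normMat w (T.top 0) (T.top (Fin.last (n + 1)))).det)⁻¹ •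
          (normMat w (T.top 0) (T.top (Fin.last (n + 1))) * A i *
            (normMat w (T.top 0) (T.top (Fin.last (n + 1)))).adjugate) := by
  set a := T.top 0 with ha
  set b := T.top (Fin.last (n + 1)) with hb
  have hab : a < b := T.top_strictMono (Fin.last_pos)
  have hdet : 0 < (normMat w a b).det := by
    rw [det_normMat]
    exact mul_pos (by linarith) hpos
  set d := √(normMat w a b).det with hd
  have hd0 : 0 < d := Real.sqrt_pos.mpr hdet
  have hd2 : d ^ 2 = (normMat w a b).det := Real.sq_sqrt hdet.le
  let K : SL2R := ⟨d⁻¹ • normMat w a b, by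
    rw [det_smul, Fintype.card_fin, ← hd2, ← mul_pow, inv_mul_cancel₀ hd0.ne', one_pow]⟩
  have hKc : (K : M2) = d⁻¹ • normMat w a b := rfl
  have hK0 : ∀ x, K 0 0 * x + K 0 1 = d⁻¹ * (cross w (vec b) * (x - a)) := by
    intro x
    simp [K, normMat]
    ring
  have hK1 : ∀ x, K 1 0 * x + K 1 1 = d⁻¹ * ((b - a) * cross w (vec x)) := by
    intro x
    simp [K, normMat, cross]
    ring
  obtain ⟨T', hT', htop, hbr⟩ := h.exists_conj K (by
    rw [hK1, hK1]
    have : d⁻¹ * ((b - a) * cross w (vec a)) * (d⁻¹ * ((b - a) * cross w (vec b))) =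
      (d⁻¹ * (b - a)) ^ 2 * (cross w (vec a) * cross w (vec b)) := by ring
    rw [this]
    have : 0 < b - a := by linarith
    positivity)
  have htop' : ∀ p, T'.top p = normPt w a b (T.top p) := by
    intro p
    rw [htop, hK0, hK1, mul_div_mul_left _ _ (inv_pos.mpr hd0).ne', normPt]
  have hKinv : ((K⁻¹ : SL2R) : M2) = d⁻¹ • (normMat w a b).adjugate := by
    rw [Matrix.SpecialLinearGroup.coe_inv, hKc, adjugate_smul]
    simp
  have hwb : cross w (vec b) ≠ 0 := fun h0 => by simp [h0] at hpos
  have hwa : cross w (vec a) ≠ 0 := fun h0 => by simp [h0] at hpos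
  refine ⟨⟨T', ?_, ?_, ?_, fun v => by rw [hbr, hT]⟩, K, hT', htop', fun i => ?_⟩
  · rw [htop', normPt, ← ha]
    simp
  · rw [htop', normPt, ← hb]
    have : b - a ≠ 0 := by linarith
    field_simp
  · rw [hT'.rep_eq, repSL_eval, isAffine_proj_iff]
    change (loopSL σ (fun i => K * A i * K⁻¹) 0) 1 0 = 0
    have hKw : (K : M2) *ᵥ w = (d⁻¹ * (cross w (vec b) * cross w (vec a))) • ![1, 0] := by
      ext i
      fin_cases i <;> simp [hKc, normMat, mulVec, dotProduct, Fin.sum_univ_two, cross] <;> ring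
    have h0 : d⁻¹ * (cross w (vec b) * cross w (vec a)) ≠ 0 := by positivity
    have := mul_mulVec_of_mulVec (inv_mulVec_of_mulVec h0 hKw) (mul_mulVec_of_mulVec hw hKw)
    rw [← mul_assoc, ← loopSL_conj] at this
    simpa [mulVec, dotProduct, Fin.sum_univ_two] using congrFun this 1
  · rw [Matrix.SpecialLinearGroup.coe_mul, Matrix.SpecialLinearGroup.coe_mul, hKinv, hKc, smul_mul_assoc,
      smul_mul_assoc, mul_smul_comm, smul_smul, ← hd2, ← mul_inv, ← sq]

end MoebiusIET

end

noncomputable section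

namespace MoebiusIET

/-! ### Normalised representatives of conjugacy classes -/

/-- The second eigenvector of an element of `SL(2, ℝ)` that fixes `x`. -/
theorem exists_second_eigenvector {D : SL2R} {x l : ℝ} (h : (D : M2) *ᵥ vec x = l • vec x)
    (hl : l ^ 2 ≠ 1) :
    ∃ s : ℝ, (D : M2) *ᵥ ![1 + s * x, s] = l⁻¹ • ![1 + s * x, s] := by
  have hl0 := factor_ne_zero h
  obtain ⟨h0, h1⟩ := (mulVec_vec_eq_iff ..).mp h
  have hdet := det_eq_one D
  have hl1 : l⁻¹ - l ≠ 0 := by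
    intro h
    apply hl
    field_simp at h
    linarith
  have hs' := div_mul_cancel₀ (D 1 0) hl1
  set s := D 1 0 / (l⁻¹ - l)
  have h00 : D 0 0 = l⁻¹ + x * D 1 0 := by
    field_simp
    linear_combination hdet + D 1 0 * h0 - D 0 0 * h1
  have h01 : D 0 1 = l * x - D 0 0 * x := by linarith
  have h11 : D 1 1 = l - D 1 0 * x := by linarith
  refine ⟨s, ?_⟩
  ext i
  fin_cases i
  · simp [mulVec, dotProduct, Fin.sum_univ_two]
    rw [h01, h00, ← hs']
    ring
  · simp [mulVec, dotProduct, Fin.sum_univ_two]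
    rw [h11, ← hs']
    ring

variable {n : ℕ} {σ : Equiv.Perm (Fin (n + 1))} {c : Vertices σ → ℝ}

theorem sq_ne_one_of_mul_eq_one {l c : ℝ} (h : l ^ 2 * c = 1) (hc : c ≠ 1) : l ^ 2 ≠ 1 :=
  fun h1 => hc (by rw [h1, one_mul] at h; exact h)

theorem E.loop_zero (T : E σ c) {A : Fin (n + 1) → SL2R} (h : T.1.IsLift A) :
    ∃ l : ℝ, (loopSL σ A 0 : M2) = !![l⁻¹, 0; 0, l] ∧ l ^ 2 * c (vertexOf σ 0) = 1 := by
  obtain ⟨l, hl, hl'⟩ := h.loop 0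
  have haff := T.2.2.2.1
  rw [h.rep_eq, repSL_eval, isAffine_proj_iff] at haff
  change (loopSL σ A 0) 1 0 = 0 at haff
  rw [T.2.1] at hl
  rw [T.2.2.2.2] at hl'
  have hl0 := factor_ne_zero hl
  obtain ⟨h0, h1⟩ := (mulVec_vec_eq_iff ..).mp hl
  have hdet := det_eq_one (loopSL σ A 0)
  refine ⟨l, ?_, hl'⟩
  simp only [mul_zero, zero_add] at h0 h1
  rw [h0, h1, zero_mul, sub_zero] at hdet
  ext i j
  fin_cases i <;> fin_cases j
  · simpa using eq_inv_of_mul_eq_one_left hdet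
  · exact h0
  · exact haff
  · exact h1

theorem PIET.isLift_of_repSL_eq {T : PIET σ} {A : Fin (n + 1) → SL2R} (h : T.rep = repSL A) :
    T.IsLift A := fun i => (congrFun (Rep.ofGens_injective h) i).symm

theorem E.exists_conj_of_orbit_eq {T : PIET σ} {T' : PIET σ} {A : Fin (n + 1) → SL2R}
    (h : T.IsLift A) (hTT' : T.rep.orbit = T'.rep.orbit) :
    ∃ K : SL2R, T'.IsLift fun i => K * A i * K⁻¹ := by
  obtain ⟨A', hA'⟩ := T'.exists_isLift
  rw [h.rep_eq, hA'.rep_eq, repSL_orbit_eq_iff] at hTT'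
  obtain ⟨K, hK⟩ := hTT'
  exact ⟨K, PIET.isLift_of_repSL_eq (hA'.rep_eq.trans hK)⟩

/-- A conjugacy class contains at most one normalised representative. -/
theorem E.eq_of_orbit_eq (hc1 : ∀ v, c v ≠ 1) {T T' : E σ c}
    (h : T.1.rep.orbit = T'.1.rep.orbit) : T = T' := by
  obtain ⟨A, hA⟩ := T.1.exists_isLift
  obtain ⟨K, hK⟩ := exists_conj_of_orbit_eq hA h
  have htop := hA.top_conj hK (fun v => (T.2.2.2.2 v).trans (T'.2.2.2.2 v).symm)
    (fun v => by rw [T.2.2.2.2]; exact hc1 v)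
  obtain ⟨l, hl, hl'⟩ := T.loop_zero hA
  obtain ⟨m, hm, hm'⟩ := T'.loop_zero hK
  have hl1 := sq_ne_one_of_mul_eq_one hl' (hc1 _)
  have hl0 : l ≠ 0 := by rintro rfl; simp at hl'
  obtain ⟨r, hr⟩ := htop 0
  rw [T.2.1, T'.2.1, mulVec_vec_eq_iff] at hr
  obtain ⟨s, hs⟩ := htop (Fin.last (n + 1))
  rw [T.2.2.1, T'.2.2.1, mulVec_vec_eq_iff] at hs
  have h01 : K 0 1 = 0 := by simpa using hr.1
  have hdet := det_eq_one K
  rw [h01, zero_mul, sub_zero] at hdet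
  have h10 : K 1 0 = 0 := by
    have h2 : (K : M2) * (loopSL σ A 0 : M2) = (loopSL σ (fun i => K * A i * K⁻¹) 0 : M2) * K := by
      rw [← Matrix.SpecialLinearGroup.coe_mul, ← Matrix.SpecialLinearGroup.coe_mul, loopSL_conj,
        inv_mul_cancel_right]
    rw [hl, hm] at h2
    have h4 := congrFun (congrFun h2 1) 0
    have h5 := congrFun (congrFun h2 1) 1
    simp [Matrix.mul_apply, Fin.sum_univ_two] at h4 h5
    have hK11 : K 1 1 ≠ 0 := fun h => by simp [h] at hdet
    have hml : m = l := mul_right_cancel₀ hK11 (by linarith)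
    rw [hml] at h4
    have h6 : K 1 0 * (l⁻¹ - l) = 0 := by linarith
    rcases mul_eq_zero.mp h6 with h | h
    · exact h
    · exact absurd (by field_simp at h; linarith) hl1
  have h11 : K 0 0 = K 1 1 := by
    obtain ⟨h1, h2⟩ := hs
    rw [h01] at h1
    rw [h10] at h2
    linarith
  have htops : T.1.top = T'.1.top := by
    funext p
    obtain ⟨r, hr⟩ := htop p
    rw [mulVec_vec_eq_iff, h01, h10, h11] at hr
    have hK11 : K 1 1 ≠ 0 := fun h => by simp [h] at hdet
    rw [zero_mul, zero_add, add_zero] at hr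
    rw [← hr.2] at hr
    exact mul_left_cancel₀ hK11 hr.1
  have hcomm : ∀ i, K * A i * K⁻¹ = A i := by
    intro i
    rw [mul_inv_eq_iff_eq_mul]
    ext i j
    fin_cases i <;> fin_cases j <;>
      simp [Matrix.mul_apply, Fin.sum_univ_two, h01, h10, h11, mul_comm]
  refine Subtype.ext (PIET.ext_of_top_branch htops ?_)
  funext i
  rw [← hA i]
  exact (congrArg proj (hcomm i)).symm.trans (hK i)

/-- The conjugacy class of an interval exchange contains a normalised one exactly when the
distinguished loop has no fixed point in the domain besides the left end point. -/
theorem exists_normalized_iff (hc1 : ∀ v, c v ≠ 1) (T : PIET σ) (hT : ∀ v, T.breakSize v = c v) :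
    (∃ T' : E σ c, T'.1.rep.orbit = T.rep.orbit) ↔
      ∀ x ∈ Set.Ioc (T.top 0) (T.top (Fin.last (n + 1))),
        moebius (T.rep.eval (peripheralLoop σ 0)) x ≠ x := by
  have hab : T.top 0 < T.top (Fin.last (n + 1)) := T.top_strictMono (Fin.last_pos)
  constructor
  · rintro ⟨T', h⟩ x hx hfix
    obtain ⟨A, hA⟩ := T'.1.exists_isLift
    obtain ⟨K, hK⟩ := E.exists_conj_of_orbit_eq hA h
    have htop := hA.top_conj hK (fun v => (T'.2.2.2.2 v).trans (hT v).symm)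
      (fun v => by rw [T'.2.2.2.2]; exact hc1 v)
    obtain ⟨l, hl, hl'⟩ := T'.loop_zero hA
    have hl1 := sq_ne_one_of_mul_eq_one hl' (hc1 _)
    have hl0 : l ≠ 0 := by rintro rfl; simp at hl'
    obtain ⟨r, hr⟩ := htop 0
    have hr0 := factor_ne_zero hr
    rw [T'.2.1, mulVec_vec_eq_iff] at hr
    obtain ⟨s, hs⟩ := htop (Fin.last (n + 1))
    rw [T'.2.2.1, mulVec_vec_eq_iff] at hs
    rw [hK.rep_eq, repSL_eval, moebius_proj_coe_eq_coe_iff] at hfix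
    obtain ⟨m, hm⟩ := hfix
    change (loopSL σ (fun i => K * A i * K⁻¹) 0 : M2) *ᵥ vec x = m • vec x at hm
    have hx1 : (loopSL σ (fun i => K * A i * K⁻¹) 0 : M2) *ᵥ vec (T.top 0) = l • vec (T.top 0) := by
      obtain ⟨m, hm, -⟩ := hK.loop 0
      obtain ⟨r', hr'⟩ := htop 0
      have hDl : (loopSL σ A 0 : M2) *ᵥ vec (T'.1.top 0) = l • vec (T'.1.top 0) := by
        rw [hl, T'.2.1]
        ext i
        fin_cases i <;> simp [mulVec, dotProduct, Fin.sum_univ_two]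
      have := mul_mulVec_of_mulVec (inv_mulVec_of_mulVec (factor_ne_zero hr') hr')
        (mul_mulVec_of_mulVec hDl hr')
      rw [← loopSL_conj] at this
      rw [this, mul_comm r' l, mul_assoc, mul_inv_cancel₀ (factor_ne_zero hr'), mul_one]
    have hx2 : (loopSL σ (fun i => K * A i * K⁻¹) 0 : M2) *ᵥ ((K : M2) *ᵥ ![1, 0]) =
        l⁻¹ • ((K : M2) *ᵥ ![1, 0]) := by
      rw [mulVec_mulVec, ← Matrix.SpecialLinearGroup.coe_mul, loopSL_conj,
        inv_mul_cancel_right, Matrix.SpecialLinearGroup.coe_mul, ← mulVec_mulVec, hl, ← mulVec_smul]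
      congr 1
      ext i
      fin_cases i <;> simp [mulVec, dotProduct, Fin.sum_univ_two]
    have hlm : l * m = 1 := by
      have h3 := sub_eq_of_mulVec hx1 hm
      exact mul_right_cancel₀ (sub_ne_zero.mpr hx.1.ne') (by rw [h3, one_mul])
    have hml : m = l⁻¹ := eq_inv_of_mul_eq_one_right hlm
    have hcross := cross_eq_zero_of_eigen hm hx2 (by rw [hml]) (by
      rw [hml, inv_pow]
      exact fun h => hl1 (inv_eq_one.mp h))
    simp [cross, mulVec, dotProduct, Fin.sum_univ_two] at hcross
    have hdet := det_eq_one K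
    obtain ⟨h1, h2⟩ := hr
    obtain ⟨h3, h4⟩ := hs
    rw [mul_zero, zero_add] at h1 h2
    have h00 : K 0 0 = x * K 1 0 := by linarith
    have h5 : K 1 0 * r * (x - T.top 0) = 1 := by
      rw [h00, h1, h2] at hdet
      linarith
    have h6 : K 1 0 * (T.top (Fin.last (n + 1)) - x) +
        r * (T.top (Fin.last (n + 1)) - T.top 0) = 0 := by
      rw [h00, h1] at h3
      rw [h2] at h4
      rw [← h4] at h3
      linarith
    have h7 : 0 < K 1 0 * r := by
      have : 0 < K 1 0 * r * (x - T.top 0) := by rw [h5]; exact one_pos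
      exact (mul_pos_iff_of_pos_right (sub_pos.mpr hx.1)).mp this
    have h8 : K 1 0 ^ 2 * (T.top (Fin.last (n + 1)) - x) +
        (K 1 0 * r) * (T.top (Fin.last (n + 1)) - T.top 0) = 0 := by
      linear_combination K 1 0 * h6
    have h9 := mul_pos h7 (sub_pos.mpr hab)
    have h10 := mul_nonneg (sq_nonneg (K 1 0)) (sub_nonneg.mpr hx.2)
    linarith
  · intro hfix
    obtain ⟨A, hA⟩ := T.exists_isLift
    obtain ⟨l, hl, hl'⟩ := hA.loop 0
    rw [hT] at hl'
    obtain ⟨s, hs⟩ := exists_second_eigenvector hl (sq_ne_one_of_mul_eq_one hl' (hc1 _))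
    have hb : 0 < 1 + s * T.top 0 - s * T.top (Fin.last (n + 1)) := by
      by_contra hneg
      push Not at hneg
      have hs0 : 0 < s := by
        by_contra h
        push Not at h
        have := mul_nonneg (neg_nonneg.mpr h) (sub_pos.mpr hab).le
        linarith
      refine hfix (T.top 0 + s⁻¹) ⟨by linarith [inv_pos.mpr hs0], ?_⟩ ?_
      · have : s * (T.top 0 + s⁻¹) ≤ s * T.top (Fin.last (n + 1)) := by
          rw [mul_add, mul_inv_cancel₀ hs0.ne']
          linarith
        exact le_of_mul_le_mul_left this hs0
      · rw [hA.rep_eq, repSL_eval, moebius_proj_coe_eq_coe_iff]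
        refine ⟨l⁻¹, ?_⟩
        have hv : ![1 + s * T.top 0, s] = s • vec (T.top 0 + s⁻¹) := by
          ext i
          fin_cases i
          · simp [vec]
            field_simp
            ring
          · simp [vec]
        rw [hv, mulVec_smul, smul_comm] at hs
        exact smul_right_injective _ hs0.ne' hs
    obtain ⟨T', K, hK, -, -⟩ := hA.exists_normalized hT hs (by
      have h1 : cross ![1 + s * T.top 0, s] (vec (T.top 0)) = 1 := by
        simp [cross]
      rw [h1, one_mul]
      simpa [cross] using hb)
    exact ⟨T', by rw [hK.rep_eq, hA.rep_eq, repSL_orbit_conj]⟩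

end MoebiusIET

end

noncomputable section

namespace MoebiusIET

open scoped ContDiff

/-! ### Polynomial extension to tuples of arbitrary matrices -/

/-- The tuples of `n + 1` real two by two matrices. -/
abbrev MatTuple (n : ℕ) : Type := Fin (n + 1) → Fin 2 → Fin 2 → ℝ

section MatTuple

variable {n : ℕ} (σ : Equiv.Perm (Fin (n + 1)))

/-- The matrix of the upward half of a step. -/
def upM (M : MatTuple n) (p : Fin (n + 2)) : M2 :=
  Fin.lastCases (motive := fun _ => M2) 1 (fun i => Matrix.of (M i)) p

/-- The matrix of the downward half of a step, with adjugates instead of inverses. -/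
def downM (M : MatTuple n) (q : Fin (n + 2)) : M2 :=
  Fin.cases (motive := fun _ => M2) 1 (fun j => (Matrix.of (M (σ j))).adjugate) q

/-- The matrix of a step around a vertex. -/
def stepM (M : MatTuple n) (p : Fin (n + 2)) : M2 := downM σ M (upPerm σ p) * upM M p

/-- The matrix of several steps around a vertex. -/
def walkM (M : MatTuple n) (p : Fin (n + 2)) : ℕ → M2
  | 0 => 1
  | k + 1 => stepM σ M ((cornerPerm σ ^ k) p) * walkM M p k

/-- The matrix of a peripheral loop. -/
def loopM (M : MatTuple n) (p : Fin (n + 2)) : M2 :=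
  walkM σ M p (Function.minimalPeriod (cornerPerm σ) p)

theorem of_entries (A : Fin (n + 1) → SL2R) (i : Fin (n + 1)) :
    (Matrix.of (entries A i) : M2) = (A i : M2) := rfl

theorem entries_injective : Function.Injective (entries (n := n)) := fun A B h => by
  funext i
  ext j k
  exact congrFun (congrFun (congrFun h i) j) k

theorem upM_entries (A : Fin (n + 1) → SL2R) (p : Fin (n + 2)) :
    upM (entries A) p = (wordSL A (upWord p) : M2) := by
  induction p using Fin.lastCases with
  | last => simp [upM]
  | cast i => simp [upM, of_entries]

theorem downM_entries (A : Fin (n + 1) → SL2R) (q : Fin (n + 2)) :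
    downM σ (entries A) q = (wordSL A (downWord σ q) : M2) := by
  induction q using Fin.cases with
  | zero => simp [downM]
  | succ j => simp [downM, of_entries]

theorem stepM_entries (A : Fin (n + 1) → SL2R) (p : Fin (n + 2)) :
    stepM σ (entries A) p = (stepSL σ A p : M2) := by
  rw [stepM, stepSL, wordSL, stepWord, map_mul, Matrix.SpecialLinearGroup.coe_mul, upM_entries,
    downM_entries]

theorem walkM_entries (A : Fin (n + 1) → SL2R) (p : Fin (n + 2)) (k : ℕ) :
    walkM σ (entries A) p k = (wordSL A (walkWord σ p k) : M2) := by
  induction k with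
  | zero => simp [walkM, walkWord]
  | succ k ih =>
    rw [walkM, wordSL, walkWord, map_mul, Matrix.SpecialLinearGroup.coe_mul, ih, stepM_entries,
      stepSL]

theorem loopM_entries (A : Fin (n + 1) → SL2R) (p : Fin (n + 2)) :
    loopM σ (entries A) p = (loopSL σ A p : M2) := walkM_entries σ A p _

theorem contDiff_entry (i : Fin (n + 1)) (a b : Fin 2) :
    ContDiff ℝ ω fun M : MatTuple n => M i a b := by fun_prop

theorem contDiff_upM (p : Fin (n + 2)) (a b : Fin 2) :
    ContDiff ℝ ω fun M : MatTuple n => upM M p a b := by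
  induction p using Fin.lastCases with
  | last => simpa [upM] using contDiff_const
  | cast i => simpa [upM] using contDiff_entry i a b

theorem contDiff_downM (q : Fin (n + 2)) (a b : Fin 2) :
    ContDiff ℝ ω fun M : MatTuple n => downM σ M q a b := by
  induction q using Fin.cases with
  | zero => simpa [downM] using contDiff_const
  | succ j =>
    simp only [downM, Fin.cases_succ, adjugate_fin_two]
    fin_cases a <;> fin_cases b
    · simpa using contDiff_entry (σ j) 1 1
    · simpa using (contDiff_entry (σ j) 0 1).neg
    · simpa using (contDiff_entry (σ j) 1 0).neg
    · simpa using contDiff_entry (σ j) 0 0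

theorem contDiff_stepM (p : Fin (n + 2)) (a b : Fin 2) :
    ContDiff ℝ ω fun M : MatTuple n => stepM σ M p a b := by
  simp only [stepM, Matrix.mul_apply, Fin.sum_univ_two]
  exact ((contDiff_downM σ _ _ _).mul (contDiff_upM _ _ _)).add
    ((contDiff_downM σ _ _ _).mul (contDiff_upM _ _ _))

theorem contDiff_walkM (p : Fin (n + 2)) (k : ℕ) (a b : Fin 2) :
    ContDiff ℝ ω fun M : MatTuple n => walkM σ M p k a b := by
  induction k generalizing a b with
  | zero => simpa [walkM] using contDiff_const
  | succ k ih =>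
    simp only [walkM, Matrix.mul_apply, Fin.sum_univ_two]
    exact ((contDiff_stepM σ _ _ _).mul (ih _ _)).add ((contDiff_stepM σ _ _ _).mul (ih _ _))

theorem contDiff_loopM (p : Fin (n + 2)) (a b : Fin 2) :
    ContDiff ℝ ω fun M : MatTuple n => loopM σ M p a b := contDiff_walkM σ p _ a b

/-! ### Reconstruction of an interval exchange from its branches -/

/-- An eigenvector of the peripheral matrix at a corner, in terms of approximate fixed points `t`
and eigenvalues `l`. -/
def cornerVec (l t : Fin (n + 2) → ℝ) (M : MatTuple n) (p : Fin (n + 2)) : Fin 2 → ℝ :=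
  (loopM σ M p - (l p)⁻¹ • 1) *ᵥ vec (t p)

/-- The top corners reconstructed from the branches. -/
def corner (l t : Fin (n + 2) → ℝ) (M : MatTuple n) (p : Fin (n + 2)) : ℝ :=
  cornerVec σ l t M p 0 / cornerVec σ l t M p 1

/-- The bottom corners reconstructed from the branches. -/
def botCorner (l t : Fin (n + 2) → ℝ) (M : MatTuple n) (q : Fin (n + 2)) : ℝ :=
  (upM M ((upPerm σ).symm q) *ᵥ vec (corner σ l t M ((upPerm σ).symm q))) 0 /
    (upM M ((upPerm σ).symm q) *ᵥ vec (corner σ l t M ((upPerm σ).symm q))) 1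

theorem contDiff_cornerVec (l t : Fin (n + 2) → ℝ) (p : Fin (n + 2)) (a : Fin 2) :
    ContDiff ℝ ω fun M : MatTuple n => cornerVec σ l t M p a := by
  simp only [cornerVec, mulVec, dotProduct, Fin.sum_univ_two, Matrix.sub_apply]
  exact (((contDiff_loopM σ p a 0).sub contDiff_const).mul contDiff_const).add
    (((contDiff_loopM σ p a 1).sub contDiff_const).mul contDiff_const)

theorem contDiffAt_corner {l t : Fin (n + 2) → ℝ} {M : MatTuple n} {p : Fin (n + 2)}
    (h : cornerVec σ l t M p 1 ≠ 0) : ContDiffAt ℝ ω (fun M => corner σ l t M p) M :=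
  (contDiff_cornerVec σ l t p 0).contDiffAt.div (contDiff_cornerVec σ l t p 1).contDiffAt h

theorem contDiffAt_upM_corner {l t : Fin (n + 2) → ℝ} {M : MatTuple n} {p : Fin (n + 2)}
    (h : cornerVec σ l t M p 1 ≠ 0) (a : Fin 2) :
    ContDiffAt ℝ ω (fun M => (upM M p *ᵥ vec (corner σ l t M p)) a) M := by
  simp only [mulVec, dotProduct, Fin.sum_univ_two, vec_zero, vec_one]
  exact ((contDiff_upM p a 0).contDiffAt.mul (contDiffAt_corner σ h)).add
    ((contDiff_upM p a 1).contDiffAt.mul contDiffAt_const)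

/-- The eigenvalues of the peripheral matrices at the corners. -/
def IsEigen (T : PIET σ) (A : Fin (n + 1) → SL2R) (l : Fin (n + 2) → ℝ) : Prop :=
  ∀ p, (loopSL σ A p : M2) *ᵥ vec (T.top p) = l p • vec (T.top p) ∧
    l p ^ 2 * T.breakSize (vertexOf σ p) = 1

variable {σ}

theorem PIET.IsLift.exists_isEigen {T : PIET σ} {A : Fin (n + 1) → SL2R} (h : T.IsLift A) :
    ∃ l, IsEigen σ T A l := by
  choose l hl using h.loop
  exact ⟨l, hl⟩

variable {T : PIET σ} {A : Fin (n + 1) → SL2R} {l : Fin (n + 2) → ℝ}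

theorem IsEigen.ne_zero (h : IsEigen σ T A l) (p : Fin (n + 2)) : l p ≠ 0 :=
  factor_ne_zero (h p).1

theorem IsEigen.sq_ne_one (h : IsEigen σ T A l) (h1 : ∀ v, T.breakSize v ≠ 1) (p : Fin (n + 2)) :
    l p ^ 2 ≠ 1 := sq_ne_one_of_mul_eq_one (h p).2 (h1 _)

theorem sub_inv_ne_zero {l : ℝ} (h0 : l ≠ 0) (h : l ^ 2 ≠ 1) : l - l⁻¹ ≠ 0 := by
  intro h1
  apply h
  field_simp at h1
  linarith

theorem IsEigen.trace_loopSL (h : IsEigen σ T A l) (p : Fin (n + 2)) :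
    (loopSL σ A p : M2).trace = l p + (l p)⁻¹ := by
  obtain ⟨h0, h2⟩ := (mulVec_vec_eq_iff ..).mp (h p).1
  have hdet := det_eq_one (loopSL σ A p)
  have hl0 := h.ne_zero p
  rw [trace_fin_two]
  field_simp
  linear_combination hdet - ((loopSL σ A p) 0 0 - l p) * h2 + (loopSL σ A p) 1 0 * h0

theorem IsEigen.cornerVec_self (h : IsEigen σ T A l) (p : Fin (n + 2)) :
    cornerVec σ l T.top (entries A) p = (l p - (l p)⁻¹) • vec (T.top p) := by
  rw [cornerVec, loopM_entries, sub_mulVec, (h p).1, smul_mulVec, one_mulVec, sub_smul]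

theorem IsEigen.cornerVec_self_ne_zero (h : IsEigen σ T A l) (h1 : ∀ v, T.breakSize v ≠ 1)
    (p : Fin (n + 2)) : cornerVec σ l T.top (entries A) p 1 ≠ 0 := by
  rw [h.cornerVec_self]
  simpa using sub_inv_ne_zero (h.ne_zero p) (h.sq_ne_one h1 p)

theorem IsEigen.corner_self (h : IsEigen σ T A l) (h1 : ∀ v, T.breakSize v ≠ 1)
    (p : Fin (n + 2)) : corner σ l T.top (entries A) p = T.top p := by
  rw [corner, h.cornerVec_self]
  have := sub_inv_ne_zero (h.ne_zero p) (h.sq_ne_one h1 p)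
  simp only [Pi.smul_apply, vec_zero, vec_one, smul_eq_mul, mul_one]
  exact mul_div_cancel_left₀ _ this

theorem IsEigen.sq_cornerPerm (h : IsEigen σ T A l) (p : Fin (n + 2)) :
    l (cornerPerm σ p) ^ 2 = l p ^ 2 := by
  have h2 := (h (cornerPerm σ p)).2
  rw [vertexOf_cornerPerm] at h2
  have hb : T.breakSize (vertexOf σ p) ≠ 0 := fun h0 => by simp [h0] at h2
  exact mul_right_cancel₀ hb (h2.trans (h p).2.symm)

/-- By the theorem of Cayley and Hamilton, the columns of `D - l⁻¹` are eigenvectors of `D`. -/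
theorem mulVec_sub_inv_smul {D : SL2R} {l : ℝ} (hl : l ≠ 0) (h : (D : M2).trace = l + l⁻¹)
    (v : Fin 2 → ℝ) :
    (D : M2) *ᵥ (((D : M2) - l⁻¹ • 1) *ᵥ v) = l • (((D : M2) - l⁻¹ • 1) *ᵥ v) := by
  have hdet := det_eq_one D
  rw [trace_fin_two] at h
  have h11 : D 1 1 = l + l⁻¹ - D 0 0 := by linarith
  have hll : l * l⁻¹ = 1 := mul_inv_cancel₀ hl
  rw [h11] at hdet
  ext i
  fin_cases i <;> simp [mulVec, dotProduct, Fin.sum_univ_two, h11]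
  · linear_combination (-v 0) * hdet + v 0 * hll
  · linear_combination (-v 1) * hdet + v 1 * hll

/-- Nearby tuples of matrices with the same peripheral traces are the branches of a nearby interval
exchange with the same break sizes. -/
theorem IsEigen.eventually_reconstruct (hA : T.IsLift A) (h : IsEigen σ T A l)
    (h1 : ∀ v, T.breakSize v ≠ 1) :
    ∀ᶠ M in 𝓝 (entries A), ∀ B : Fin (n + 1) → SL2R, entries B = M →
      (∀ p, (loopSL σ B p : M2).trace = l p + (l p)⁻¹) →
        ∃ T' : PIET σ, T'.IsLift B ∧ T'.top = corner σ l T.top M ∧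
          (∀ v, T'.breakSize v = T.breakSize v) ∧ IsEigen σ T' B l := by
  have hup : ∀ p, ∃ m : ℝ, m ≠ 0 ∧ upM (entries A) p *ᵥ vec (T.top p) = m • vec (T.bot (upPerm σ p)) := by
    intro p
    obtain ⟨m, hm, -⟩ := hA.up p
    exact ⟨m, factor_ne_zero hm, by rw [upM_entries, hm]⟩
  have hbot : ∀ q, (upM (entries A) ((upPerm σ).symm q) *ᵥ
      vec (corner σ l T.top (entries A) ((upPerm σ).symm q))) 1 ≠ 0 ∧
      botCorner σ l T.top (entries A) q = T.bot q := by
    intro q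
    rw [botCorner, h.corner_self h1]
    obtain ⟨m, hm0, hm⟩ := hup ((upPerm σ).symm q)
    rw [hm, Equiv.apply_symm_apply]
    refine ⟨by simpa using hm0, ?_⟩
    simp only [Pi.smul_apply, vec_zero, vec_one, smul_eq_mul, mul_one]
    exact mul_div_cancel_left₀ _ hm0
  have e1 : ∀ᶠ M in 𝓝 (entries A), ∀ p, cornerVec σ l T.top M p 1 ≠ 0 :=
    Filter.eventually_all.mpr fun p =>
      (contDiff_cornerVec σ l T.top p 1).continuous.continuousAt.eventually_ne
        (h.cornerVec_self_ne_zero h1 p)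
  have e2 : ∀ᶠ M in 𝓝 (entries A), ∀ p q, p < q → corner σ l T.top M p < corner σ l T.top M q := by
    refine Filter.eventually_all.mpr fun p => Filter.eventually_all.mpr fun q => ?_
    by_cases hpq : p < q
    · have hp := (contDiffAt_corner σ (h.cornerVec_self_ne_zero h1 p)).continuousAt
      have hq := (contDiffAt_corner σ (h.cornerVec_self_ne_zero h1 q)).continuousAt
      filter_upwards [hp.eventually_lt hq (by
        rw [h.corner_self h1, h.corner_self h1]; exact T.top_strictMono hpq)] with M hM _ using hM
    · exact Filter.Eventually.of_forall fun M hM => absurd hM hpq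
  have hcb : ∀ q, ContinuousAt (fun M => botCorner σ l T.top M q) (entries A) := fun q =>
    (contDiffAt_upM_corner σ (h.cornerVec_self_ne_zero h1 _) 0).continuousAt.div
      (contDiffAt_upM_corner σ (h.cornerVec_self_ne_zero h1 _) 1).continuousAt (hbot q).1
  have e3 : ∀ᶠ M in 𝓝 (entries A), ∀ q, (upM M ((upPerm σ).symm q) *ᵥ
      vec (corner σ l T.top M ((upPerm σ).symm q))) 1 ≠ 0 :=
    Filter.eventually_all.mpr fun q =>
      (contDiffAt_upM_corner σ (h.cornerVec_self_ne_zero h1 _) 1).continuousAt.eventually_ne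
        (hbot q).1
  have e4 : ∀ᶠ M in 𝓝 (entries A), ∀ p q, p < q →
      botCorner σ l T.top M p < botCorner σ l T.top M q := by
    refine Filter.eventually_all.mpr fun p => Filter.eventually_all.mpr fun q => ?_
    by_cases hpq : p < q
    · filter_upwards [(hcb p).eventually_lt (hcb q) (by
        rw [(hbot p).2, (hbot q).2]; exact T.bot_strictMono hpq)] with M hM _ using hM
    · exact Filter.Eventually.of_forall fun M hM => absurd hM hpq
  filter_upwards [e1, e2, e3, e4] with M h1M h2M h3M h4M
  rintro B rfl htr
  have heig : ∀ p, (loopSL σ B p : M2) *ᵥ vec (corner σ l T.top (entries B) p) =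
      l p • vec (corner σ l T.top (entries B) p) := by
    intro p
    have h5 : cornerVec σ l T.top (entries B) p =
        cornerVec σ l T.top (entries B) p 1 • vec (corner σ l T.top (entries B) p) := by
      ext i
      fin_cases i
      · simp [corner, mul_div_cancel₀ _ (h1M p)]
      · simp
    have h6 := mulVec_sub_inv_smul (h.ne_zero p) (htr p) (vec (T.top p))
    rw [← loopM_entries] at h6
    change loopM σ (entries B) p *ᵥ cornerVec σ l T.top (entries B) p =
      l p • cornerVec σ l T.top (entries B) p at h6
    rw [h5, mulVec_smul, smul_comm, loopM_entries] at h6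
    exact smul_right_injective _ (h1M p) h6
  have hstep : ∀ p, ∃ m : ℝ, (stepSL σ B p : M2) *ᵥ vec (corner σ l T.top (entries B) p) =
      m • vec (corner σ l T.top (entries B) (cornerPerm σ p)) := by
    intro p
    have h5 : (loopSL σ B (cornerPerm σ p) : M2) *ᵥ
        ((stepSL σ B p : M2) *ᵥ vec (corner σ l T.top (entries B) p)) =
        l p • ((stepSL σ B p : M2) *ᵥ vec (corner σ l T.top (entries B) p)) := by
      rw [mulVec_mulVec, ← Matrix.SpecialLinearGroup.coe_mul, loopSL_cornerPerm,
        Matrix.SpecialLinearGroup.coe_mul, ← mulVec_mulVec, heig, mulVec_smul]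
    exact ⟨_, eq_smul_vec_of_cross (cross_eq_zero_of_eigen (heig _) h5 (h.sq_cornerPerm p)
      (h.sq_ne_one h1 _))⟩
  have hupB : ∀ q, ∃ m : ℝ, m ≠ 0 ∧ (wordSL B (upWord ((upPerm σ).symm q)) : M2) *ᵥ
      vec (corner σ l T.top (entries B) ((upPerm σ).symm q)) =
        m • vec (botCorner σ l T.top (entries B) q) := by
    intro q
    refine ⟨_, h3M q, ?_⟩
    ext i
    rw [← upM_entries]
    fin_cases i
    · simp only [botCorner, Fin.zero_eta, Pi.smul_apply, vec_zero, smul_eq_mul]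
      exact (mul_div_cancel₀ _ (h3M q)).symm
    · simp
  have hdownB : ∀ q, ∃ m : ℝ, (wordSL B (downWord σ q) : M2) *ᵥ
      vec (botCorner σ l T.top (entries B) q) =
        m • vec (corner σ l T.top (entries B) (downPerm σ q)) := by
    intro q
    obtain ⟨m, hm0, hm⟩ := hupB q
    obtain ⟨k, hk⟩ := hstep ((upPerm σ).symm q)
    rw [stepSL, wordSL, stepWord, map_mul, Matrix.SpecialLinearGroup.coe_mul, ← mulVec_mulVec, hm,
      mulVec_smul, Equiv.apply_symm_apply, cornerPerm, Equiv.Perm.mul_apply,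
      Equiv.apply_symm_apply] at hk
    refine ⟨m⁻¹ * k, ?_⟩
    rw [mul_smul, ← hk, smul_smul, inv_mul_cancel₀ hm0, one_smul]
  have heq : ∀ {x y m : ℝ}, vec x = m • vec y → x = y := by
    intro x y m hxy
    have h6 := congrFun hxy 0
    have h7 := congrFun hxy 1
    simp at h6 h7
    rw [h6, ← h7, one_mul]
  let T' : PIET σ := PIET.ofData B (corner σ l T.top (entries B)) (botCorner σ l T.top (entries B))
    (fun p q hpq => h2M p q hpq) (fun p q hpq => h4M p q hpq)
    (by
      obtain ⟨m, hm⟩ := hdownB 0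
      simp only [downWord_zero, map_one, Matrix.SpecialLinearGroup.coe_one, one_mulVec,
        downPerm_zero] at hm
      exact heq hm)
    (by
      obtain ⟨m, -, hm⟩ := hupB (Fin.last (n + 1))
      have : (upPerm σ).symm (Fin.last (n + 1)) = Fin.last (n + 1) := by
        rw [Equiv.symm_apply_eq, upPerm_last]
      simp only [this, upWord_last, map_one, Matrix.SpecialLinearGroup.coe_one,
        one_mulVec] at hm
      exact (heq hm).symm)
    (fun j => by
      obtain ⟨m, -, hm⟩ := hupB j.castSucc
      have : (upPerm σ).symm j.castSucc = (σ j).castSucc := by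
        rw [Equiv.symm_apply_eq, upPerm_castSucc]
        simp
      simp only [this, upWord_castSucc, FreeGroup.lift_apply_of] at hm
      exact ⟨m, hm⟩)
    (fun j => by
      obtain ⟨m, hm⟩ := hdownB j.succ
      have hm0 := factor_ne_zero hm
      simp only [downWord_succ, downPerm_succ, map_inv, FreeGroup.lift_apply_of] at hm
      exact ⟨m⁻¹, by simpa only [inv_inv] using inv_mulVec_of_mulVec hm0 hm⟩)
  have hT' : T'.IsLift B := fun i => rfl
  have hbr : ∀ v, T'.breakSize v = T.breakSize v := by
    intro v
    obtain ⟨p, rfl⟩ := vertexOf_surjective σ v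
    obtain ⟨m, hm, hm'⟩ := hT'.loop p
    have h7 := congrFun (hm.symm.trans (heig p)) 1
    simp only [Pi.smul_apply, vec_one, smul_eq_mul, mul_one] at h7
    rw [h7] at hm'
    exact mul_left_cancel₀ (pow_ne_zero 2 (h.ne_zero p)) (hm'.trans (h p).2.symm)
  exact ⟨T', hT', rfl, hbr, fun p => ⟨heig p, by rw [hbr]; exact (h p).2⟩⟩

/-- Near the branches of an interval exchange the peripheral conjugacy classes determine the
peripheral traces. -/
theorem IsEigen.eventually_trace (h : IsEigen σ T A l) {c : Vertices σ → ℝ} (hc : ∀ v, 0 < c v)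
    (hT : ∀ v, T.breakSize v = c v) :
    ∀ᶠ M in 𝓝 (entries A), ∀ B : Fin (n + 1) → SL2R, entries B = M →
      repSL B ∈ relRep σ (boundaryClass σ c hc) →
        ∀ p, (loopSL σ B p : M2).trace = l p + (l p)⁻¹ := by
  have hl : ∀ p, 0 < (l p + (l p)⁻¹) * (l p + (l p)⁻¹) := by
    intro p
    have h0 := h.ne_zero p
    have : (l p + (l p)⁻¹) * (l p + (l p)⁻¹) = l p ^ 2 + 2 + ((l p)⁻¹) ^ 2 := by
      field_simp
      ring
    rw [this]
    positivity
  have e : ∀ᶠ M in 𝓝 (entries A), ∀ p, 0 < (loopM σ M p).trace * (l p + (l p)⁻¹) := by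
    refine Filter.eventually_all.mpr fun p => ?_
    have hc : Continuous fun M : MatTuple n => (loopM σ M p).trace * (l p + (l p)⁻¹) := by
      simp only [trace_fin_two]
      exact ((contDiff_loopM σ p 0 0).continuous.add
        (contDiff_loopM σ p 1 1).continuous).mul continuous_const
    refine continuousAt_const.eventually_lt hc.continuousAt ?_
    rw [loopM_entries, h.trace_loopSL]
    exact hl p
  filter_upwards [e] with M hM
  rintro B rfl hB p
  have h2 := hB p
  rw [repSL_eval] at h2
  have h3 := (h p).2
  rw [hT] at h3
  rcases trace_of_conjClass (hc _) h3 h2 with h4 | h4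
  · exact h4
  · have h5 := hM p
    rw [loopM_entries] at h5
    change 0 < (loopSL σ B p : M2).trace * _ at h5
    change (loopSL σ B p : M2).trace = _ at h4
    rw [h4] at h5
    have := hl p
    linarith

end MatTuple

end MoebiusIET

end

noncomputable section

namespace MoebiusIET

open scoped ContDiff

/-! ### Smooth normalisation -/

section Normalization

variable {n : ℕ} {σ : Equiv.Perm (Fin (n + 1))} {c : Vertices σ → ℝ}

variable (σ) in
/-- An eigenvector of the peripheral matrix of the distinguished loop. -/
def distVec (l : ℝ) (M : MatTuple n) : Fin 2 → ℝ := ![loopM σ M 0 0 0 - l, loopM σ M 0 1 0]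

variable (σ) in
/-- The normalising matrix in terms of the branches. -/
def normalizer (l t : Fin (n + 2) → ℝ) (M : MatTuple n) : M2 :=
  normMat (distVec σ (l 0) M) (corner σ l t M 0) (corner σ l t M (Fin.last (n + 1)))

variable (σ) in
/-- The top corners and the branches of the normalised interval exchange. -/
def normalized (l t : Fin (n + 2) → ℝ) (M : MatTuple n) : (Fin (n + 2) → ℝ) × MatTuple n :=
  (fun p => normPt (distVec σ (l 0) M) (corner σ l t M 0) (corner σ l t M (Fin.last (n + 1)))
      (corner σ l t M p),
    fun i j k => (((normalizer σ l t M).det)⁻¹ •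
      (normalizer σ l t M * Matrix.of (M i) * (normalizer σ l t M).adjugate)) j k)

theorem contDiff_distVec (l : ℝ) (a : Fin 2) :
    ContDiff ℝ ω fun M : MatTuple n => distVec σ l M a := by
  fin_cases a
  · simpa [distVec] using (contDiff_loopM σ 0 0 0).sub contDiff_const
  · simpa [distVec] using contDiff_loopM σ 0 1 0

variable {T : E σ c} {A : Fin (n + 1) → SL2R} {l : Fin (n + 2) → ℝ}

theorem breakSize_ne_one (hc1 : ∀ v, c v ≠ 1) (v : Vertices σ) : T.1.breakSize v ≠ 1 := by
  rw [T.2.2.2.2]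
  exact hc1 v

theorem E.loop_zero_eq (hA : T.1.IsLift A) (h : IsEigen σ T.1 A l) :
    (loopSL σ A 0 : M2) = !![(l 0)⁻¹, 0; 0, l 0] := by
  obtain ⟨m, hm, -⟩ := T.loop_zero hA
  have h1 := (h 0).1
  rw [hm, T.2.1] at h1
  have h2 := congrFun h1 1
  simp [mulVec, dotProduct, Fin.sum_univ_two] at h2
  rw [hm, h2]

theorem distVec_self (hA : T.1.IsLift A) (h : IsEigen σ T.1 A l) :
    distVec σ (l 0) (entries A) = ![(l 0)⁻¹ - l 0, 0] := by
  rw [distVec, loopM_entries, E.loop_zero_eq hA h]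
  simp

theorem inv_sub_ne_zero (h : IsEigen σ T.1 A l) (hc1 : ∀ v, c v ≠ 1) (p : Fin (n + 2)) :
    (l p)⁻¹ - l p ≠ 0 := by
  have := sub_inv_ne_zero (h.ne_zero p) (h.sq_ne_one (breakSize_ne_one hc1) p)
  exact fun h0 => this (by linarith)

theorem normalizer_self (hc1 : ∀ v, c v ≠ 1) (hA : T.1.IsLift A) (h : IsEigen σ T.1 A l) :
    normalizer σ l T.1.top (entries A) = ((l 0)⁻¹ - l 0) • (1 : M2) := by
  rw [normalizer, h.corner_self (breakSize_ne_one hc1), h.corner_self (breakSize_ne_one hc1),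
    T.2.1, T.2.2.1, distVec_self hA h, normMat]
  ext i j
  fin_cases i <;> fin_cases j <;> simp [cross]

theorem normalized_self (hc1 : ∀ v, c v ≠ 1) (hA : T.1.IsLift A) (h : IsEigen σ T.1 A l) :
    normalized σ l T.1.top (entries A) = (T.1.top, entries A) := by
  have hk := inv_sub_ne_zero h hc1 0
  rw [normalized, normalizer_self hc1 hA h]
  refine Prod.ext ?_ ?_
  · funext p
    simp only
    rw [h.corner_self (breakSize_ne_one hc1), h.corner_self (breakSize_ne_one hc1),
      h.corner_self (breakSize_ne_one hc1), T.2.1, T.2.2.1, distVec_self hA h]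
    simp only [normPt, cross, cons_val_zero, cons_val_one, vec_zero, vec_one]
    generalize (l 0)⁻¹ - l 0 = k at hk ⊢
    rw [div_eq_iff (by simpa using hk)]
    ring
  · funext i j k
    simp only [adjugate_smul, det_smul, adjugate_one, det_one, Fintype.card_fin, smul_mul_assoc,
      mul_smul_comm, one_mul, mul_one, smul_smul, Matrix.smul_apply, smul_eq_mul, of_apply]
    generalize (l 0)⁻¹ - l 0 = k at hk ⊢
    field_simp
    norm_num

theorem contDiffAt_normalized (hc1 : ∀ v, c v ≠ 1) (hA : T.1.IsLift A) (h : IsEigen σ T.1 A l) :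
    ContDiffAt ℝ ω (normalized σ l T.1.top) (entries A) := by
  have hk := inv_sub_ne_zero h hc1 0
  have hcor : ∀ p, ContDiffAt ℝ ω (fun M => corner σ l T.1.top M p) (entries A) := fun p =>
    contDiffAt_corner σ (h.cornerVec_self_ne_zero (breakSize_ne_one hc1) p)
  have hw : ∀ a, ContDiffAt ℝ ω (fun M => distVec σ (l 0) M a) (entries A) := fun a =>
    (contDiff_distVec (l 0) a).contDiffAt
  have hcross : ∀ p, ContDiffAt ℝ ω
      (fun M => cross (distVec σ (l 0) M) (vec (corner σ l T.1.top M p))) (entries A) := by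
    intro p
    simp only [cross, vec_zero, vec_one, mul_one]
    exact (hw 0).sub ((hw 1).mul (hcor p))
  have hN : ∀ a b, ContDiffAt ℝ ω (fun M => normalizer σ l T.1.top M a b) (entries A) := by
    intro a b
    simp only [normalizer, normMat]
    fin_cases a <;> fin_cases b
    · simpa using hcross _
    · simpa using ((hcross _).mul (hcor 0)).neg
    · simpa using (((hcor _).sub (hcor 0)).mul (hw 1)).neg
    · simpa using ((hcor _).sub (hcor 0)).mul (hw 0)
  have hdet : ContDiffAt ℝ ω (fun M => (normalizer σ l T.1.top M).det) (entries A) := by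
    simp only [det_fin_two]
    exact ((hN 0 0).mul (hN 1 1)).sub ((hN 0 1).mul (hN 1 0))
  have hadj : ∀ a b, ContDiffAt ℝ ω (fun M => (normalizer σ l T.1.top M).adjugate a b)
      (entries A) := by
    intro a b
    simp only [adjugate_fin_two]
    fin_cases a <;> fin_cases b
    · simpa using hN 1 1
    · simpa using (hN 0 1).neg
    · simpa using (hN 1 0).neg
    · simpa using hN 0 0
  refine ContDiffAt.prodMk ?_ ?_
  · refine contDiffAt_pi.mpr fun p => ?_
    simp only [normPt]
    refine ((hcross _).mul ((hcor p).sub (hcor 0))).div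
      (((hcor _).sub (hcor 0)).mul (hcross p)) ?_
    rw [h.corner_self (breakSize_ne_one hc1), h.corner_self (breakSize_ne_one hc1),
      h.corner_self (breakSize_ne_one hc1), T.2.1, T.2.2.1, distVec_self hA h]
    simpa [cross] using hk
  · refine contDiffAt_pi.mpr fun i => contDiffAt_pi.mpr fun j => contDiffAt_pi.mpr fun k => ?_
    simp only [Matrix.smul_apply, smul_eq_mul, Matrix.mul_apply, Fin.sum_univ_two, of_apply]
    have hM : ∀ a b, ContDiffAt ℝ ω (fun M : MatTuple n => M i a b) (entries A) := fun a b =>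
      (contDiff_entry i a b).contDiffAt
    refine (hdet.inv ?_).mul ((((((hN _ _).mul (hM _ _)).add ((hN _ _).mul (hM _ _))).mul
      (hadj _ _))).add (((((hN _ _).mul (hM _ _)).add ((hN _ _).mul (hM _ _))).mul (hadj _ _))))
    rw [normalizer_self hc1 hA h, det_smul]
    simpa using hk

/-- Nearby representations with the same peripheral classes are conjugate to representations of
normalised interval exchanges, with smooth dependence on the matrices. -/
theorem eventually_normalized (hc : ∀ v, 0 < c v) (hc1 : ∀ v, c v ≠ 1) (hA : T.1.IsLift A)
    (h : IsEigen σ T.1 A l) :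
    ∀ᶠ M in 𝓝 (entries A), ∀ B : Fin (n + 1) → SL2R, entries B = M →
      repSL B ∈ relRep σ (boundaryClass σ c hc) → ∃ (T' : E σ c) (K : SL2R),
        T'.1.IsLift (fun i => K * B i * K⁻¹) ∧
        normalized σ l T.1.top M = (T'.1.top, entries fun i => K * B i * K⁻¹) := by
  have hb1 := breakSize_ne_one (T := T) hc1
  have hpos : ∀ᶠ M in 𝓝 (entries A), 0 <
      cross (distVec σ (l 0) M) (vec (corner σ l T.1.top M 0)) *
        cross (distVec σ (l 0) M) (vec (corner σ l T.1.top M (Fin.last (n + 1)))) := by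
    have hcross : ∀ p, ContinuousAt
        (fun M => cross (distVec σ (l 0) M) (vec (corner σ l T.1.top M p))) (entries A) := by
      intro p
      simp only [cross, vec_zero, vec_one, mul_one]
      exact (contDiff_distVec (l 0) 0).continuous.continuousAt.sub
        ((contDiff_distVec (l 0) 1).continuous.continuousAt.mul
          (contDiffAt_corner σ (h.cornerVec_self_ne_zero hb1 p)).continuousAt)
    refine continuousAt_const.eventually_lt ((hcross _).mul (hcross _)) ?_
    rw [h.corner_self hb1, h.corner_self hb1, distVec_self hA h]
    have hk := inv_sub_ne_zero h hc1 0
    simp only [cross, cons_val_zero, cons_val_one, vec_zero, vec_one, mul_one, zero_mul, sub_zero]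
    exact mul_self_pos.mpr hk
  filter_upwards [h.eventually_reconstruct hA hb1, h.eventually_trace hc T.2.2.2.2, hpos] with
    M h1 h2 h3
  rintro B rfl hB
  obtain ⟨T₁, hT₁, htop, hbr, heig⟩ := h1 B rfl (h2 B rfl hB)
  have hw : (loopSL σ B 0 : M2) *ᵥ distVec σ (l 0) (entries B) =
      (l 0)⁻¹ • distVec σ (l 0) (entries B) := by
    have h4 := mulVec_sub_inv_smul (inv_ne_zero (h.ne_zero 0)) (D := loopSL σ B 0) (by
      rw [inv_inv, h2 B rfl hB, add_comm]) ![1, 0]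
    have h5 : ((loopSL σ B 0 : M2) - ((l 0)⁻¹)⁻¹ • 1) *ᵥ ![1, 0] =
        distVec σ (l 0) (entries B) := by
      rw [distVec, loopM_entries]
      ext i
      fin_cases i <;> simp [mulVec, dotProduct, Fin.sum_univ_two]
    rwa [h5] at h4
  obtain ⟨T', K, hK, htop', hconj⟩ := hT₁.exists_normalized
    (fun v => (hbr v).trans (T.2.2.2.2 v)) hw (by rw [htop]; exact h3)
  refine ⟨T', K, hK, Prod.ext ?_ ?_⟩
  · funext p
    change _ = T'.1.top p
    rw [htop', htop]
    rfl
  · funext i j k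
    change _ = ((K * B i * K⁻¹ : SL2R) : M2) j k
    rw [hconj, htop]
    rfl

end Normalization

end MoebiusIET

end

noncomputable section

namespace MoebiusIET

open scoped ContDiff

/-! ### Topology of the spaces of representations -/

section Topology

variable {n : ℕ}

theorem isInducing_entries : IsInducing (entries (n := n)) := by
  have h : IsInducing fun A : SL2R => (A : M2) := IsInducing.subtypeVal
  exact IsInducing.piMap fun _ => h

theorem continuous_entries : Continuous (entries (n := n)) := isInducing_entries.continuous

/-- Representations correspond to tuples of elements of the group. -/
def ofGensHomeomorph : (Fin (n + 1) → PSL2R) ≃ₜ Rep n where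
  toFun := Rep.ofGens
  invFun ρ i := ρ.eval (FreeGroup.of i)
  left_inv g := funext fun i => Rep.ofGens_eval_of g i
  right_inv ρ := Rep.ext_of fun i => Rep.ofGens_eval_of _ i
  continuous_toFun := by
    refine continuous_induced_rng.mpr ?_
    exact (continuous_id (X := Fin (n + 1) → PSL2R)).congr fun g =>
      funext fun i => (Rep.ofGens_eval_of g i).symm
  continuous_invFun := continuous_induced_dom

theorem isOpenQuotientMap_proj : IsOpenQuotientMap proj := QuotientGroup.isOpenQuotientMap_mk

theorem isOpenQuotientMap_repSL : IsOpenQuotientMap (repSL (n := n)) :=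
  (ofGensHomeomorph (n := n)).isOpenQuotientMap.comp
    (IsOpenQuotientMap.piMap fun _ => isOpenQuotientMap_proj)

theorem isOpenQuotientMap_orbit : IsOpenQuotientMap (Rep.orbit (n := n)) := by
  refine IsOpenQuotientMap.of_isOpenMap_isQuotientMap ?_ isQuotientMap_quotient_mk'
  intro U hU
  have hpre : Rep.orbit ⁻¹' (Rep.orbit '' U) =
      ⋃ g : PSL2R, (fun ρ : Rep n => Rep.ofGens fun i => g * ρ.eval (FreeGroup.of i) * g⁻¹) ⁻¹' U := by
    ext ρ
    simp only [Set.mem_preimage, Set.mem_image, Set.mem_iUnion]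
    constructor
    · rintro ⟨ρ', hρ', h⟩
      obtain ⟨g, hg⟩ := Quotient.exact h.symm
      refine ⟨g, ?_⟩
      convert hρ'
      exact Rep.ext_of fun i => by rw [Rep.ofGens_eval_of, hg]
    · rintro ⟨g, hg⟩
      refine ⟨_, hg, Quotient.sound ⟨g⁻¹, fun w => ?_⟩⟩
      obtain ⟨A, rfl⟩ := exists_repSL ρ
      obtain ⟨K, rfl⟩ := proj_surjective g
      have : (Rep.ofGens fun i => proj K * (repSL A).eval (FreeGroup.of i) * (proj K)⁻¹) =
          repSL fun i => K * A i * K⁻¹ := by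
        refine Rep.ext_of fun i => ?_
        rw [Rep.ofGens_eval_of, repSL_eval, repSL_eval, wordSL_conj]
        rfl
      rw [this, repSL_eval, repSL_eval, wordSL_conj]
      change _ = (proj K)⁻¹ * (proj K * proj (wordSL A w) * (proj K)⁻¹) * (proj K)⁻¹⁻¹
      group
  rw [← isQuotientMap_quotient_mk'.isOpen_preimage]
  change IsOpen (Rep.orbit ⁻¹' (Rep.orbit '' U))
  rw [hpre]
  refine isOpen_iUnion fun g => hU.preimage ?_
  refine (ofGensHomeomorph (n := n)).continuous.comp (continuous_pi fun i => ?_)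
  have : Continuous fun ρ : Rep n => ρ.eval (FreeGroup.of i) :=
    (continuous_apply i).comp (ofGensHomeomorph (n := n)).symm.continuous
  exact (continuous_const.mul this).mul continuous_const

theorem isOpenQuotientMap_orbit_repSL :
    IsOpenQuotientMap fun A : Fin (n + 1) → SL2R => (repSL A).orbit :=
  isOpenQuotientMap_orbit.comp isOpenQuotientMap_repSL

end Topology

/-! ### The projection to the space of conjugacy classes -/

section OrbitProjection

variable {n : ℕ} {σ : Equiv.Perm (Fin (n + 1))} {c : Vertices σ → ℝ}

theorem mem_relRep_of_orbit_eq {h : Vertices σ → ConjClasses PSL2R} {ρ ρ' : Rep n}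
    (hρ : ρ ∈ relRep σ h) (ho : ρ.orbit = ρ'.orbit) : ρ' ∈ relRep σ h := by
  obtain ⟨g, hg⟩ := Quotient.exact ho
  intro p
  rw [← hρ p, ConjClasses.mk_eq_mk_iff_isConj, isConj_comm, isConj_iff]
  exact ⟨g, (hg _).symm⟩

theorem E.rep_mem_relRep (hc : ∀ v, 0 < c v) (hc1 : ∀ v, c v ≠ 1) (T : E σ c) :
    T.1.rep ∈ relRep σ (boundaryClass σ c hc) := by
  obtain ⟨A, hA⟩ := T.1.exists_isLift
  rw [hA.rep_eq]
  exact hA.mem_relRep c hc hc1 T.2.2.2.2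

/-- The projection of the normalised family to the space of conjugacy classes. -/
def E.toOrbit (hc : ∀ v, 0 < c v) (hc1 : ∀ v, c v ≠ 1) (T : E σ c) :
    RelOrbitSpace σ (boundaryClass σ c hc) :=
  ⟨T.1.rep.orbit, Set.mem_image_of_mem _ (T.rep_mem_relRep hc hc1)⟩

theorem E.isInducing : IsInducing fun T : E σ c => (T.1.top, T.1.branch) := ⟨rfl⟩

theorem E.continuous_rep : Continuous fun T : E σ c => T.1.rep :=
  (ofGensHomeomorph (n := n)).continuous.comp (continuous_snd.comp E.isInducing.continuous)

theorem E.exists_nhds_entries {T : E σ c} {U : Set (E σ c)} (hU : U ∈ 𝓝 T)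
    {A : Fin (n + 1) → SL2R} (hA : T.1.IsLift A) :
    ∃ V ∈ 𝓝 (T.1.top, entries A), ∀ (T' : E σ c) (A' : Fin (n + 1) → SL2R),
      T'.1.IsLift A' → (T'.1.top, entries A') ∈ V → T' ∈ U := by
  rw [E.isInducing.nhds_eq_comap] at hU
  obtain ⟨V₁, hV₁, hVU⟩ := hU
  have hcont : Continuous fun x : (Fin (n + 2) → ℝ) × (Fin (n + 1) → SL2R) =>
      (x.1, fun i => proj (x.2 i)) := by
    refine continuous_fst.prodMk (continuous_pi fun i => ?_)
    exact isOpenQuotientMap_proj.continuous.comp ((continuous_apply i).comp continuous_snd)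
  have hbr : ∀ {T' : E σ c} {A' : Fin (n + 1) → SL2R}, T'.1.IsLift A' →
      (fun i => proj (A' i)) = T'.1.branch := fun h => funext h
  have h1 : (fun x : (Fin (n + 2) → ℝ) × (Fin (n + 1) → SL2R) =>
      (x.1, fun i => proj (x.2 i))) ⁻¹' V₁ ∈ 𝓝 (T.1.top, A) := by
    refine hcont.continuousAt.preimage_mem_nhds ?_
    simp only [hbr hA]
    exact hV₁
  have hind : IsInducing (Prod.map id entries :
      (Fin (n + 2) → ℝ) × (Fin (n + 1) → SL2R) → _ × MatTuple n) :=
    IsInducing.id.prodMap isInducing_entries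
  rw [hind.nhds_eq_comap] at h1
  obtain ⟨V, hV, hVV⟩ := h1
  refine ⟨V, hV, fun T' A' hA' hmem => hVU ?_⟩
  have h2 : (T'.1.top, A') ∈ Prod.map id entries ⁻¹' V := hmem
  have h3 := hVV h2
  simp only [Set.mem_preimage, hbr hA'] at h3
  exact h3

theorem E.toOrbit_injective (hc : ∀ v, 0 < c v) (hc1 : ∀ v, c v ≠ 1) :
    Function.Injective (E.toOrbit (σ := σ) hc hc1) := fun _ _ h =>
  E.eq_of_orbit_eq hc1 (congrArg Subtype.val h)

theorem E.continuous_toOrbit (hc : ∀ v, 0 < c v) (hc1 : ∀ v, c v ≠ 1) :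
    Continuous (E.toOrbit (σ := σ) hc hc1) :=
  (isOpenQuotientMap_orbit.continuous.comp E.continuous_rep).subtype_mk _

theorem E.isOpenMap_toOrbit (hc : ∀ v, 0 < c v) (hc1 : ∀ v, c v ≠ 1) :
    IsOpenMap (E.toOrbit (σ := σ) hc hc1) := by
  refine IsOpenMap.of_nhds_le fun T U hU => ?_
  obtain ⟨A, hA⟩ := T.1.exists_isLift
  obtain ⟨l, hl⟩ := hA.exists_isEigen
  obtain ⟨V, hV, hVU⟩ := E.exists_nhds_entries (Filter.mem_map.mp hU) hA
  rw [← normalized_self hc1 hA hl] at hV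
  have h1 := ((contDiffAt_normalized hc1 hA hl).continuousAt.eventually hV).and
    (eventually_normalized hc hc1 hA hl)
  have h2 := continuous_entries.continuousAt.eventually h1
  have h3 := Filter.image_mem_map (m := fun B : Fin (n + 1) → SL2R => (repSL B).orbit) h2
  rw [isOpenQuotientMap_orbit_repSL.map_nhds_eq] at h3
  have h4 : (repSL A).orbit = (E.toOrbit hc hc1 T).1 := by
    change _ = T.1.rep.orbit
    rw [hA.rep_eq]
  simp only [h4] at h3
  rw [nhds_subtype]
  refine ⟨_, h3, ?_⟩
  rintro ⟨_, ⟨ρ, hρ, rfl⟩⟩ ⟨B, ⟨hB1, hB2⟩, hBρ⟩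
  simp only at hBρ
  have hBrel : repSL B ∈ relRep σ (boundaryClass σ c hc) := mem_relRep_of_orbit_eq hρ hBρ.symm
  obtain ⟨T', K, hK, hnorm⟩ := hB2 B rfl hBrel
  have hT' := hVU T' _ hK (by rw [← hnorm]; exact hB1)
  have : E.toOrbit hc hc1 T' = ⟨ρ.orbit, Set.mem_image_of_mem _ hρ⟩ := by
    refine Subtype.ext ?_
    change T'.1.rep.orbit = ρ.orbit
    rw [hK.rep_eq, repSL_orbit_conj]
    exact hBρ
  rw [← this]
  exact hT'

theorem E.isOpenEmbedding_toOrbit (hc : ∀ v, 0 < c v) (hc1 : ∀ v, c v ≠ 1) :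
    IsOpenEmbedding (E.toOrbit (σ := σ) hc hc1) :=
  .of_continuous_injective_isOpenMap (E.continuous_toOrbit hc hc1) (E.toOrbit_injective hc hc1)
    (E.isOpenMap_toOrbit hc hc1)

theorem contDiff_conj (K L : SL2R) :
    ContDiff ℝ ω fun M : MatTuple n => (fun i j k => ((K : M2) * Matrix.of (M i) * (L : M2)) j k :
      MatTuple n) := by
  refine contDiff_pi.mpr fun i => contDiff_pi.mpr fun j => contDiff_pi.mpr fun k => ?_
  simp only [Matrix.mul_apply, Fin.sum_univ_two, of_apply]
  fun_prop

theorem exists_open_contDiffOn {V V' : Type} [NormedAddCommGroup V] [NormedSpace ℝ V]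
    [NormedAddCommGroup V'] [NormedSpace ℝ V'] {f : V → V'} {x : V} (hf : ContDiffAt ℝ ω f x)
    {P : V → Prop} (hP : ∀ᶠ y in 𝓝 x, P y) :
    ∃ W : Set V, IsOpen W ∧ x ∈ W ∧ ContDiffOn ℝ (⊤ : ℕ∞) f W ∧ ∀ y ∈ W, P y := by
  obtain ⟨W, hW, hWo, hx⟩ := eventually_nhds_iff.mp ((hf.eventually (by simp)).and hP)
  exact ⟨W, hWo, hx, fun y hy => ((hW y hy).1.of_le le_top).contDiffWithinAt,
    fun y hy => (hW y hy).2⟩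

/-- Smooth functions on the space of conjugacy classes and on the normalised family correspond. -/
theorem E.smooth_toOrbit_iff (hc : ∀ v, 0 < c v) (hc1 : ∀ v, c v ≠ 1) (T : E σ c)
    (g : RelOrbitSpace σ (boundaryClass σ c hc) → ℝ) :
    smoothRelOrbit σ (boundaryClass σ c hc) g (E.toOrbit hc hc1 T) ↔
      smoothE σ c (g ∘ E.toOrbit hc hc1) T := by
  constructor
  · rintro h ⟨⟨T', A⟩, hA⟩ rfl
    have hA : T'.1.IsLift A := hA
    have hmem : repSL A ∈ relRep σ (boundaryClass σ c hc) := hA.mem_relRep c hc hc1 T'.2.2.2.2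
    obtain ⟨W, hW, hAW, F, hF, hFg⟩ := h ⟨A, hmem⟩ (by
      refine Subtype.ext ?_
      change (repSL A).orbit = T'.1.rep.orbit
      rw [hA.rep_eq])
    refine ⟨Prod.snd ⁻¹' W, hW.preimage continuous_snd, hAW, fun x => F x.2,
      hF.comp contDiff_snd.contDiffOn (fun x hx => hx), ?_⟩
    rintro ⟨⟨T₁, A₁⟩, hA₁⟩ hmem₁
    have hA₁ : T₁.1.IsLift A₁ := hA₁
    have h2 := hFg ⟨A₁, hA₁.mem_relRep c hc hc1 T₁.2.2.2.2⟩ hmem₁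
    refine Eq.trans ?_ h2
    refine congrArg g (Subtype.ext ?_)
    change T₁.1.rep.orbit = (repSL A₁).orbit
    rw [hA₁.rep_eq]
  · rintro h ⟨B, hB⟩ hBT
    have hBT : (repSL B).orbit = T.1.rep.orbit := congrArg Subtype.val hBT
    obtain ⟨A₀, hA₀⟩ := T.1.exists_isLift
    rw [hA₀.rep_eq, repSL_orbit_eq_iff] at hBT
    obtain ⟨K, hK⟩ := hBT
    have hA : T.1.IsLift fun i => K * B i * K⁻¹ :=
      PIET.isLift_of_repSL_eq (hA₀.rep_eq.trans hK)
    obtain ⟨l, hl⟩ := hA.exists_isEigen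
    obtain ⟨W, hW, hTW, F, hF, hFg⟩ := h ⟨⟨T, _⟩, hA⟩ rfl
    have hnear : ∀ᶠ M in 𝓝 (entries fun i => K * B i * K⁻¹), normalized σ l T.1.top M ∈ W :=
      (contDiffAt_normalized hc1 hA hl).continuousAt.eventually (by
        rw [normalized_self hc1 hA hl]
        exact hW.mem_nhds hTW)
    obtain ⟨W', hW', hBW', hsm, hprop⟩ := exists_open_contDiffOn (contDiffAt_normalized hc1 hA hl)
      (hnear.and (eventually_normalized hc hc1 hA hl))
    have hC : ContDiff ℝ ω fun M : MatTuple n =>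
        (fun i j k => ((K : M2) * Matrix.of (M i) * ((K⁻¹ : SL2R) : M2)) j k : MatTuple n) :=
      contDiff_conj K K⁻¹
    refine ⟨_, hW'.preimage hC.continuous, hBW', fun M => F (normalized σ l T.1.top _),
      hF.comp (hsm.comp (hC.of_le le_top).contDiffOn fun M hM => hM)
        fun M hM => (hprop _ hM).1, ?_⟩
    rintro ⟨B', hB'⟩ hB'W
    obtain ⟨T', L, hL, hnorm⟩ := (hprop _ hB'W).2 (fun i => K * B' i * K⁻¹) rfl
      (mem_relRep_of_orbit_eq hB' (repSL_orbit_conj B' K).symm)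
    have h2 := hFg ⟨⟨T', _⟩, hL⟩ (by
      have := (hprop _ hB'W).1
      rw [hnorm] at this
      exact this)
    have h3 : E.toOrbit hc hc1 T' = ⟨(repSL B').orbit, Set.mem_image_of_mem _ hB'⟩ := by
      refine Subtype.ext ?_
      change T'.1.rep.orbit = _
      rw [hL.rep_eq, repSL_orbit_conj, repSL_orbit_conj]
    change g ⟨(repSL B').orbit, Set.mem_image_of_mem _ hB'⟩ = _
    rw [← h3]
    refine h2.trans ?_
    change F (T'.1.top, entries _) = F (normalized σ l T.1.top _)
    rw [← hnorm]

theorem E.isLocalDiffeoAt_toOrbit (hc : ∀ v, 0 < c v) (hc1 : ∀ v, c v ≠ 1) (T : E σ c) :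
    IsLocalDiffeoAt (smoothE σ c) (smoothRelOrbit σ (boundaryClass σ c hc))
      (E.toOrbit hc hc1) T := by
  have : Nonempty (E σ c) := ⟨T⟩
  refine ⟨(E.isOpenEmbedding_toOrbit hc hc1).toOpenPartialHomeomorph, ?_, ?_, ?_⟩
  · simp
  · intro x _
    simp
  · exact fun T' _ g => E.smooth_toOrbit_iff hc hc1 T' g

end OrbitProjection

end MoebiusIET

end

noncomputable section

/-! ### Points of a space that are separated from all others -/

section SeparatedPoints

variable {X : Type} {U : Set X}

open Classical in
/-- The map that collapses the complement of `U` to the point at infinity. -/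
def collapseCompl (U : Set X) (x : X) : OnePoint U := if h : x ∈ U then ((⟨x, h⟩ : U) : OnePoint U) else
  OnePoint.infty

theorem collapseCompl_of_mem {x : X} (h : x ∈ U) :
    collapseCompl U x = ((⟨x, h⟩ : U) : OnePoint U) := dif_pos h

theorem collapseCompl_eq_coe_iff {x : X} {u : U} : collapseCompl U x = (u : OnePoint U) ↔ x = u := by
  rw [collapseCompl]
  split_ifs with h
  · rw [OnePoint.coe_eq_coe, Subtype.ext_iff]
  · refine ⟨fun h' => absurd h' (OnePoint.infty_ne_coe u), fun h' => absurd (h' ▸ u.2) h⟩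

variable [TopologicalSpace X]

/-- A compact set of points that are separated from all others is closed. -/
theorem IsCompact.isClosed_of_disjoint_nhds {K : Set X} (hK : IsCompact K)
    (h : ∀ u ∈ K, ∀ x, x ≠ u → Disjoint (𝓝 u) (𝓝 x)) : IsClosed K := by
  rw [← isOpen_compl_iff, isOpen_iff_mem_nhds]
  intro x hx
  have hd : Disjoint (𝓝ˢ K) (𝓝 x) := hK.disjoint_nhdsSet_left.mpr fun u hu =>
    h u hu x fun hxu => hx (hxu ▸ hu)
  obtain ⟨s, hs, t, ht, hst⟩ := Filter.disjoint_iff.mp hd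
  exact Filter.mem_of_superset ht fun y hy hyK =>
    Set.disjoint_left.mp hst (subset_of_mem_nhdsSet hs hyK) hy

theorem continuous_collapseCompl (hU : IsOpen U)
    (h : ∀ u ∈ U, ∀ x, x ≠ u → Disjoint (𝓝 u) (𝓝 x)) : Continuous (collapseCompl U) := by
  refine continuous_def.mpr fun s hs => ?_
  rw [OnePoint.isOpen_def] at hs
  by_cases hinf : OnePoint.infty ∈ s
  · have hK := (hs.1 hinf).image continuous_subtype_val
    have hcl := hK.isClosed_of_disjoint_nhds (by
      rintro _ ⟨u, -, rfl⟩ x hx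
      exact h u u.2 x hx)
    convert hcl.isOpen_compl using 1
    ext x
    simp only [Set.mem_preimage, Set.mem_compl_iff, Set.mem_image, Subtype.exists, not_exists]
    by_cases hx : x ∈ U
    · rw [collapseCompl_of_mem hx]
      constructor
      · rintro h1 y hy ⟨h2, rfl⟩
        exact h2 h1
      · intro h1
        by_contra h2
        exact h1 x hx ⟨h2, rfl⟩
    · rw [collapseCompl, dif_neg hx]
      refine ⟨fun _ y hy h2 => hx (h2.2 ▸ hy), fun _ => hinf⟩
  · convert (hU.isOpenMap_subtype_val _ hs.2) using 1
    ext x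
    simp only [Set.mem_preimage, Set.mem_image, Subtype.exists, exists_and_right, exists_eq_right]
    by_cases hx : x ∈ U
    · rw [collapseCompl_of_mem hx]
      exact ⟨fun h => ⟨hx, h⟩, fun h => h.2⟩
    · rw [collapseCompl, dif_neg hx]
      exact ⟨fun h => absurd h hinf, fun h => absurd h.1 hx⟩

variable [LocallyCompactSpace X]

theorem t2Space_onePoint_of_disjoint_nhds (hU : IsOpen U)
    (h : ∀ u ∈ U, ∀ x, x ≠ u → Disjoint (𝓝 u) (𝓝 x)) : T2Space (OnePoint U) := by
  have : LocallyCompactSpace U := hU.locallyCompactSpace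
  have : T2Space U := by
    refine t2Space_iff_disjoint_nhds.mpr fun u v huv => ?_
    have := h u u.2 v fun h => huv (Subtype.ext h.symm)
    change Disjoint (𝓝 u) (𝓝 v)
    rw [nhds_subtype, nhds_subtype]
    exact Filter.disjoint_comap this
  infer_instance

/-- Points of `U` are not identified with other points in the largest Hausdorff quotient. -/
theorem T2Quotient.eq_of_mk_eq (hU : IsOpen U)
    (h : ∀ u ∈ U, ∀ x, x ≠ u → Disjoint (𝓝 u) (𝓝 x)) {u x : X} (hu : u ∈ U)
    (hux : T2Quotient.mk x = T2Quotient.mk u) : x = u := by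
  have := t2Space_onePoint_of_disjoint_nhds hU h
  have hc := continuous_collapseCompl hU h
  have h2 := congrArg (T2Quotient.lift hc) hux
  rw [T2Quotient.lift_mk, T2Quotient.lift_mk, collapseCompl_of_mem hu] at h2
  exact collapseCompl_eq_coe_iff.mp h2

/-- Open subsets of `U` remain open in the largest Hausdorff quotient. -/
theorem T2Quotient.isOpen_image_mk (hU : IsOpen U)
    (h : ∀ u ∈ U, ∀ x, x ≠ u → Disjoint (𝓝 u) (𝓝 x)) {V : Set X} (hV : IsOpen V) (hVU : V ⊆ U) :
    IsOpen (T2Quotient.mk '' V) := by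
  have := t2Space_onePoint_of_disjoint_nhds hU h
  have hc := continuous_collapseCompl hU h
  have h2 : IsOpen ((↑) '' ((↑) ⁻¹' V : Set U) : Set (OnePoint U)) :=
    OnePoint.isOpenEmbedding_coe.isOpenMap _ (hV.preimage continuous_subtype_val)
  convert h2.preimage (T2Quotient.continuous_lift hc) using 1
  ext y
  obtain ⟨x, rfl⟩ := T2Quotient.surjective_mk X y
  simp only [Set.mem_image, Set.mem_preimage, T2Quotient.lift_mk]
  constructor
  · rintro ⟨v, hv, hvx⟩
    have := T2Quotient.eq_of_mk_eq hU h (hVU hv) hvx.symm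
    subst this
    exact ⟨⟨x, hVU hv⟩, hv, (collapseCompl_of_mem (hVU hv)).symm⟩
  · rintro ⟨u, hu, hux⟩
    have := collapseCompl_eq_coe_iff.mp hux.symm
    subst this
    exact ⟨_, hu, rfl⟩

end SeparatedPoints

namespace MoebiusIET

/-! ### Irreducible representations -/

section Irreducible

variable {n : ℕ}

/-- No point of the projective line is fixed by all matrices. -/
def IsIrred (A : Fin (n + 1) → SL2R) : Prop :=
  ¬ ∃ x : OnePoint ℝ, ∀ i, moebius (proj (A i)) x = x

theorem moebius_coe_eq_self_iff (A : SL2R) (x : ℝ) :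
    moebius (proj A) (x : OnePoint ℝ) = x ↔ cross (vec x) ((A : M2) *ᵥ vec x) = 0 := by
  rw [moebius_proj_coe_eq_coe_iff]
  constructor
  · rintro ⟨j, hj⟩
    rw [hj]
    simp [cross]
    ring
  · exact fun h => ⟨_, eq_smul_vec_of_cross h⟩

theorem isIrred_iff (A : Fin (n + 1) → SL2R) :
    IsIrred A ↔ ¬ ∃ v : Metric.sphere (0 : Fin 2 → ℝ) 1, ∀ i, cross v.1 ((A i : M2) *ᵥ v.1) = 0 := by
  have hinf : ∀ B : SL2R, moebius (proj B) OnePoint.infty = OnePoint.infty ↔ B 1 0 = 0 :=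
    isAffine_proj_iff
  refine not_congr ⟨?_, ?_⟩
  · rintro ⟨x, hx⟩
    obtain ⟨v, hv0, hv⟩ : ∃ v : Fin 2 → ℝ, v ≠ 0 ∧ ∀ i, cross v ((A i : M2) *ᵥ v) = 0 := by
      induction x using OnePoint.rec with
      | infty =>
        refine ⟨![1, 0], fun h => by simpa using congrFun h 0, fun i => ?_⟩
        have := (hinf _).mp (hx i)
        simp [cross, mulVec, dotProduct, Fin.sum_univ_two, this]
      | coe x =>
        exact ⟨vec x, fun h => by simpa using congrFun h 1, fun i =>
          (moebius_coe_eq_self_iff _ _).mp (hx i)⟩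
    refine ⟨⟨‖v‖⁻¹ • v, ?_⟩, fun i => ?_⟩
    · rw [mem_sphere_zero_iff_norm, norm_smul, norm_inv, norm_norm,
        inv_mul_cancel₀ (norm_ne_zero_iff.mpr hv0)]
    · simp only
      rw [mulVec_smul, cross_smul_smul, hv, mul_zero]
  · rintro ⟨⟨v, hv⟩, h⟩
    have hv0 : v ≠ 0 := by
      rintro rfl
      simp at hv
    by_cases h1 : v 1 = 0
    · have hv0' : v 0 ≠ 0 := fun h0 => hv0 (by ext i; fin_cases i <;> assumption)
      refine ⟨OnePoint.infty, fun i => (hinf _).mpr ?_⟩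
      have := h i
      simp only [cross, mulVec, dotProduct, Fin.sum_univ_two, h1, mul_zero, add_zero, zero_mul,
        sub_zero] at this
      have h2 : v 0 * v 0 * (A i) 1 0 = 0 := by linarith
      exact (mul_eq_zero.mp h2).resolve_left (mul_ne_zero hv0' hv0')
    · refine ⟨((v 0 / v 1 : ℝ) : OnePoint ℝ), fun i => (moebius_coe_eq_self_iff _ _).mpr ?_⟩
      have hvv : v = v 1 • vec (v 0 / v 1) := by
        ext i
        fin_cases i
        · simp [mul_div_cancel₀ _ h1]
        · simp
      have := h i
      simp only at this
      rw [hvv, mulVec_smul, cross_smul_smul] at this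
      exact (mul_eq_zero.mp this).resolve_left (by simpa using h1)

theorem isOpen_isIrred : IsOpen {A : Fin (n + 1) → SL2R | IsIrred A} := by
  have hcl : IsClosed {x : (Fin (n + 1) → SL2R) × Metric.sphere (0 : Fin 2 → ℝ) 1 |
      ∀ i, cross x.2.1 ((x.1 i : M2) *ᵥ x.2.1) = 0} := by
    simp only [Set.ofPred_forall]
    refine isClosed_iInter fun i => isClosed_eq ?_ continuous_const
    have hA : ∀ a b, Continuous fun x : (Fin (n + 1) → SL2R) × Metric.sphere (0 : Fin 2 → ℝ) 1 =>
        (x.1 i) a b := fun a b => (Continuous.comp (g := fun A : SL2R => (A : M2))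
      continuous_subtype_val ((continuous_apply i).comp continuous_fst)).matrix_elem a b
    have hv : ∀ a, Continuous fun x : (Fin (n + 1) → SL2R) × Metric.sphere (0 : Fin 2 → ℝ) 1 =>
        x.2.1 a := fun a => (continuous_apply a).comp (continuous_subtype_val.comp continuous_snd)
    simp only [cross, mulVec, dotProduct, Fin.sum_univ_two]
    exact ((hv _).mul (((hA _ _).mul (hv _)).add ((hA _ _).mul (hv _)))).sub
      ((hv _).mul (((hA _ _).mul (hv _)).add ((hA _ _).mul (hv _))))
  have := (isClosedMap_fst_of_compactSpace _ hcl).isOpen_compl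
  convert this using 1
  ext A
  simp [isIrred_iff]

theorem norm_ne_zero_of_det {K : SL2R} : ‖(fun i j => K i j : Fin 2 → Fin 2 → ℝ)‖ ≠ 0 := by
  intro h
  have h1 := norm_eq_zero.mp h
  have h2 := det_eq_one K
  have h3 : ∀ i j, K i j = 0 := fun i j => congrFun (congrFun h1 i) j
  simp [h3] at h2

/-- Nonzero matrices of nonnegative determinant that intertwine two tuples up to signs. -/
def Intertwines (A B : Fin (n + 1) → SL2R) (M : Fin 2 → Fin 2 → ℝ) : Prop :=
  0 ≤ (Matrix.of M).det ∧ ∀ i, Matrix.of M * (A i : M2) = (B i : M2) * Matrix.of M ∨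
    Matrix.of M * (A i : M2) = -((B i : M2) * Matrix.of M)

theorem isClosed_intertwines :
    IsClosed {x : (Fin (n + 1) → SL2R) × (Fin (n + 1) → SL2R) |
      ∃ M : Metric.sphere (0 : Fin 2 → Fin 2 → ℝ) 1, Intertwines x.1 x.2 M.1} := by
  have hof : Continuous fun x : ((Fin (n + 1) → SL2R) × (Fin (n + 1) → SL2R)) ×
      Metric.sphere (0 : Fin 2 → Fin 2 → ℝ) 1 => (Matrix.of x.2.1 : M2) := by
    have : Continuous fun x : ((Fin (n + 1) → SL2R) × (Fin (n + 1) → SL2R)) ×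
        Metric.sphere (0 : Fin 2 → Fin 2 → ℝ) 1 => x.2.1 :=
      continuous_subtype_val.comp continuous_snd
    exact this
  have hA : ∀ i, Continuous fun x : ((Fin (n + 1) → SL2R) × (Fin (n + 1) → SL2R)) ×
      Metric.sphere (0 : Fin 2 → Fin 2 → ℝ) 1 => (x.1.1 i : M2) := fun i =>
    continuous_subtype_val.comp ((continuous_apply i).comp (continuous_fst.comp continuous_fst))
  have hB : ∀ i, Continuous fun x : ((Fin (n + 1) → SL2R) × (Fin (n + 1) → SL2R)) ×
      Metric.sphere (0 : Fin 2 → Fin 2 → ℝ) 1 => (x.1.2 i : M2) := fun i =>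
    continuous_subtype_val.comp ((continuous_apply i).comp (continuous_snd.comp continuous_fst))
  have hcl : IsClosed {x : ((Fin (n + 1) → SL2R) × (Fin (n + 1) → SL2R)) ×
      Metric.sphere (0 : Fin 2 → Fin 2 → ℝ) 1 | Intertwines x.1.1 x.1.2 x.2.1} := by
    simp only [Intertwines, Set.ofPred_and, Set.ofPred_forall, Set.ofPred_or]
    refine (isClosed_le continuous_const hof.matrix_det).inter (isClosed_iInter fun i => ?_)
    exact (isClosed_eq (hof.mul (hA i)) ((hB i).mul hof)).union
      (isClosed_eq (hof.mul (hA i)) ((hB i).mul hof).neg)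
  convert isClosedMap_fst_of_compactSpace _ hcl using 1
  ext x
  simp

theorem exists_intertwines_of_orbit_eq {A B : Fin (n + 1) → SL2R}
    (h : (repSL A).orbit = (repSL B).orbit) :
    ∃ M : Metric.sphere (0 : Fin 2 → Fin 2 → ℝ) 1, Intertwines A B M.1 := by
  obtain ⟨K, hK⟩ := (repSL_orbit_eq_iff A B).mp h
  set k : ℝ := ‖(fun i j => K i j : Fin 2 → Fin 2 → ℝ)‖⁻¹ with hk
  have hM : (Matrix.of (k • (fun i j => K i j : Fin 2 → Fin 2 → ℝ)) : M2) = k • (K : M2) := rfl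
  refine ⟨⟨k • (fun i j => K i j : Fin 2 → Fin 2 → ℝ), ?_⟩, ?_, fun i => ?_⟩
  · rw [mem_sphere_zero_iff_norm, norm_smul, hk, norm_inv, norm_norm,
      inv_mul_cancel₀ norm_ne_zero_of_det]
  · simp only
    rw [hM, det_smul, K.det_coe, mul_one]
    positivity
  · simp only
    rw [hM]
    have h1 : proj (B i) = proj (K * A i * K⁻¹) := congrFun (Rep.ofGens_injective hK) i
    rcases (proj_eq_iff _ _).mp h1 with h2 | h2
    · left
      have h3 : K * A i = B i * K := by rw [← h2]; group
      rw [smul_mul_assoc, mul_smul_comm, ← Matrix.SpecialLinearGroup.coe_mul, h3,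
        Matrix.SpecialLinearGroup.coe_mul]
    · right
      have h3 : K * A i = -(B i * K) := by
        rw [← neg_mul, ← h2]; group
      rw [smul_mul_assoc, mul_smul_comm, ← Matrix.SpecialLinearGroup.coe_mul, h3,
        Matrix.SpecialLinearGroup.coe_neg, Matrix.SpecialLinearGroup.coe_mul, smul_neg]

theorem orbit_eq_of_intertwines {A B : Fin (n + 1) → SL2R} (hA : IsIrred A)
    {M : Fin 2 → Fin 2 → ℝ} (hM : M ≠ 0) (h : Intertwines A B M) :
    (repSL A).orbit = (repSL B).orbit := by
  have hdet : 0 < (Matrix.of M).det := by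
    refine lt_of_le_of_ne h.1 fun h0 => ?_
    obtain ⟨v, hv0, hv⟩ := Matrix.exists_mulVec_eq_zero_iff.mpr h0.symm
    rw [isIrred_iff] at hA
    refine hA ⟨⟨‖v‖⁻¹ • v, ?_⟩, fun i => ?_⟩
    · rw [mem_sphere_zero_iff_norm, norm_smul, norm_inv, norm_norm,
        inv_mul_cancel₀ (norm_ne_zero_iff.mpr hv0)]
    · simp only
      rw [mulVec_smul, cross_smul_smul]
      have hw : Matrix.of M *ᵥ ((A i : M2) *ᵥ v) = 0 := by
        rw [mulVec_mulVec]
        rcases h.2 i with h1 | h1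
        · rw [h1, ← mulVec_mulVec, hv, mulVec_zero]
        · rw [h1, neg_mulVec, ← mulVec_mulVec, hv, mulVec_zero, neg_zero]
      by_contra hne
      have hcr : cross v ((A i : M2) *ᵥ v) ≠ 0 := fun h0 => hne (by rw [h0, mul_zero])
      generalize (A i : M2) *ᵥ v = w at hw hcr
      apply hM
      funext a b
      have hva := congrFun hv a
      have hwa := congrFun hw a
      simp only [mulVec, dotProduct, Fin.sum_univ_two, of_apply, Pi.zero_apply] at hva hwa
      refine (mul_eq_zero.mp ?_ : M a b = 0 ∨ cross v w = 0).resolve_right hcr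
      fin_cases b
      · simp only [cross, Fin.zero_eta]
        linear_combination w 1 * hva - v 1 * hwa
      · simp only [cross, Fin.mk_one]
        linear_combination v 0 * hwa - w 0 * hva
  set d := √(Matrix.of M).det with hd
  have hd0 : 0 < d := Real.sqrt_pos.mpr hdet
  have hd2 : d ^ 2 = (Matrix.of M).det := Real.sq_sqrt hdet.le
  let K : SL2R := ⟨d⁻¹ • Matrix.of M, by
    rw [det_smul, Fintype.card_fin, ← hd2, ← mul_pow, inv_mul_cancel₀ hd0.ne', one_pow]⟩
  have hKc : (K : M2) = d⁻¹ • Matrix.of M := rfl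
  rw [repSL_orbit_eq_iff]
  refine ⟨K, Rep.ext_of fun i => ?_⟩
  rw [repSL, repSL, Rep.ofGens_eval_of, Rep.ofGens_eval_of, proj_eq_iff]
  rcases h.2 i with h1 | h1
  · left
    rw [mul_inv_eq_iff_eq_mul]
    apply Subtype.ext
    rw [Matrix.SpecialLinearGroup.coe_mul, Matrix.SpecialLinearGroup.coe_mul, hKc, smul_mul_assoc,
      mul_smul_comm, h1]
  · right
    rw [mul_inv_eq_iff_eq_mul]
    apply Subtype.ext
    rw [Matrix.SpecialLinearGroup.coe_mul, Matrix.SpecialLinearGroup.coe_mul, hKc, smul_mul_assoc,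
      mul_smul_comm, h1, Matrix.SpecialLinearGroup.coe_neg, neg_mul, smul_neg]

/-- The conjugacy classes of irreducible representations. -/
def irredOrbits (n : ℕ) : Set (OrbitSpace n) :=
  (fun A : Fin (n + 1) → SL2R => (repSL A).orbit) '' {A | IsIrred A}

theorem isOpen_irredOrbits : IsOpen (irredOrbits n) :=
  isOpenQuotientMap_orbit_repSL.isOpenMap _ isOpen_isIrred

theorem disjoint_nhds_of_mem_irredOrbits {u : OrbitSpace n} (hu : u ∈ irredOrbits n)
    (x : OrbitSpace n) (hx : x ≠ u) : Disjoint (𝓝 u) (𝓝 x) := by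
  obtain ⟨A, hA, rfl⟩ := hu
  obtain ⟨B, rfl⟩ := isOpenQuotientMap_orbit_repSL.surjective x
  have hmem : (A, B) ∈ {x : (Fin (n + 1) → SL2R) × (Fin (n + 1) → SL2R) |
      ∃ M : Metric.sphere (0 : Fin 2 → Fin 2 → ℝ) 1, Intertwines x.1 x.2 M.1}ᶜ := by
    rintro ⟨M, hM⟩
    refine hx (orbit_eq_of_intertwines hA (fun h0 => ?_) hM).symm
    have := M.2
    rw [h0] at this
    simp at this
  have hnhds := isClosed_intertwines.isOpen_compl.mem_nhds hmem
  rw [nhds_prod_eq, Filter.mem_prod_iff] at hnhds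
  obtain ⟨s, hs, t, ht, hst⟩ := hnhds
  have hs' := Filter.image_mem_map (m := fun B : Fin (n + 1) → SL2R => (repSL B).orbit) hs
  have ht' := Filter.image_mem_map (m := fun B : Fin (n + 1) → SL2R => (repSL B).orbit) ht
  rw [isOpenQuotientMap_orbit_repSL.map_nhds_eq] at hs' ht'
  refine Filter.disjoint_iff.mpr ⟨_, hs', _, ht', Set.disjoint_left.mpr ?_⟩
  rintro _ ⟨A', hA', rfl⟩ ⟨B', hB', h⟩
  exact hst (Set.mk_mem_prod hA' hB') (exists_intertwines_of_orbit_eq h.symm)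

instance : LocallyCompactSpace SL2R :=
  have : LocallyCompactSpace M2 := inferInstanceAs (LocallyCompactSpace (Fin 2 → Fin 2 → ℝ))
  (Matrix.SpecialLinearGroup.isClosedEmbedding_val (n := Fin 2) (R := ℝ)).locallyCompactSpace

instance : LocallyCompactSpace (OrbitSpace n) :=
  (isOpenQuotientMap_orbit_repSL (n := n)).locallyCompactSpace

end Irreducible

/-! ### The projection to the character variety -/

section CharProjection

variable {n : ℕ} {σ : Equiv.Perm (Fin (n + 1))} {c : Vertices σ → ℝ}

/-- The projection of the normalised family to the relative character variety. -/
def E.toChar (hc : ∀ v, 0 < c v) (hc1 : ∀ v, c v ≠ 1) (T : E σ c) :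
    RelCharVar σ (boundaryClass σ c hc) :=
  ⟨T.1.rep.char, Set.mem_image_of_mem _ (T.rep_mem_relRep hc hc1)⟩

/-- The projection from conjugacy classes to the character variety. -/
def relOrbitToChar (h : Vertices σ → ConjClasses PSL2R) (o : RelOrbitSpace σ h) : RelCharVar σ h :=
  ⟨T2Quotient.mk o.1, by
    obtain ⟨_, ρ, hρ, rfl⟩ := o
    exact Set.mem_image_of_mem _ hρ⟩

theorem smoothRelChar_iff (h : Vertices σ → ConjClasses PSL2R) (g : RelCharVar σ h → ℝ)
    {o : RelOrbitSpace σ h} (ho : o.1 ∈ irredOrbits n) :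
    smoothRelChar σ h g (relOrbitToChar h o) ↔ smoothRelOrbit σ h (g ∘ relOrbitToChar h) o := by
  constructor
  · intro H A hA
    exact H A (congrArg (relOrbitToChar h) hA)
  · intro H A hA
    refine H A (Subtype.ext ?_)
    exact T2Quotient.eq_of_mk_eq isOpen_irredOrbits
      (fun u hu x hx => disjoint_nhds_of_mem_irredOrbits hu x hx) ho (congrArg Subtype.val hA)

theorem E.isLocalDiffeoAt_toChar (hc : ∀ v, 0 < c v) (hc1 : ∀ v, c v ≠ 1) (T : E σ c)
    (hT : ¬ ∃ x : OnePoint ℝ, ∀ i, moebius (T.1.branch i) x = x) :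
    IsLocalDiffeoAt (smoothE σ c) (smoothRelChar σ (boundaryClass σ c hc))
      (E.toChar hc hc1) T := by
  have hsep : ∀ u ∈ irredOrbits n, ∀ x, x ≠ u → Disjoint (𝓝 u) (𝓝 x) := fun u hu x hx =>
    disjoint_nhds_of_mem_irredOrbits hu x hx
  set S : Set (E σ c) := E.toOrbit hc hc1 ⁻¹' (Subtype.val ⁻¹' irredOrbits n) with hS
  have hSo : IsOpen S := (isOpen_irredOrbits.preimage continuous_subtype_val).preimage
    (E.continuous_toOrbit hc hc1)
  have hTS : T ∈ S := by
    obtain ⟨A, hA⟩ := T.1.exists_isLift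
    refine ⟨A, ?_, ?_⟩
    · rintro ⟨x, hx⟩
      exact hT ⟨x, fun i => by rw [← hA i]; exact hx i⟩
    · change (repSL A).orbit = T.1.rep.orbit
      rw [hA.rep_eq]
  have hinj : Set.InjOn (E.toChar hc hc1) S := by
    intro T₁ _ T₂ h₂ h
    refine E.eq_of_orbit_eq hc1 ?_
    exact T2Quotient.eq_of_mk_eq isOpen_irredOrbits hsep h₂ (congrArg Subtype.val h)
  have hcont : Continuous (E.toChar (σ := σ) hc hc1) :=
    ((T2Quotient.continuous_mk _).comp (isOpenQuotientMap_orbit.continuous.comp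
      E.continuous_rep)).subtype_mk _
  have hopen : ∀ V ⊆ S, IsOpen V → IsOpen (E.toChar hc hc1 '' V) := by
    intro V hVS hV
    obtain ⟨O, hO, hOV⟩ := isOpen_induced_iff.mp ((E.isOpenMap_toOrbit hc hc1) V hV)
    have h1 := T2Quotient.isOpen_image_mk isOpen_irredOrbits hsep (hO.inter isOpen_irredOrbits)
      Set.inter_subset_right
    refine isOpen_induced_iff.mpr ⟨_, h1, ?_⟩
    ext ⟨y, hy⟩
    constructor
    · rintro ⟨u, ⟨huO, hu⟩, huy⟩
      obtain ⟨ρ, hρ, rfl⟩ := hy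
      have hρu : ρ.orbit = u := T2Quotient.eq_of_mk_eq isOpen_irredOrbits hsep hu huy.symm
      have h2 : (⟨ρ.orbit, Set.mem_image_of_mem _ hρ⟩ : RelOrbitSpace σ (boundaryClass σ c hc)) ∈
          Subtype.val ⁻¹' O := by
        change ρ.orbit ∈ O
        rwa [hρu]
      rw [hOV] at h2
      obtain ⟨T', hT', h3⟩ := h2
      refine ⟨T', hT', Subtype.ext ?_⟩
      exact congrArg T2Quotient.mk (congrArg Subtype.val h3)
    · rintro ⟨T', hT', h⟩
      have h2 : E.toOrbit hc hc1 T' ∈ Subtype.val ⁻¹' O := by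
        rw [hOV]
        exact ⟨T', hT', rfl⟩
      exact ⟨T'.1.rep.orbit, ⟨h2, hVS hT'⟩, congrArg Subtype.val h⟩
  have hom : IsOpenMap (S.domRestrict (E.toChar hc hc1)) := by
    intro V hV
    have := hopen (Subtype.val '' V) (by rintro _ ⟨x, -, rfl⟩; exact x.2)
      (hSo.isOpenMap_subtype_val V hV)
    rwa [Set.image_image] at this
  have : Nonempty (E σ c) := ⟨T⟩
  refine ⟨OpenPartialHomeomorph.ofContinuousOpenRestrict (hinj.toPartialEquiv _ _)
    hcont.continuousOn hom hSo, hTS, fun x _ => rfl, fun T' hT' g => ?_⟩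
  exact (smoothRelChar_iff _ g hT').trans (E.smooth_toOrbit_iff hc hc1 T' _)

end CharProjection

end MoebiusIET

end

noncomputable section

namespace MoebiusIET

open scoped ContDiff

/-! ### Derivatives of matrix valued curves -/

/-- Entrywise derivative at `0` of a curve of matrices. -/
def HasMatDeriv (N : ℝ → M2) (N' : M2) : Prop := ∀ a b, HasDerivAt (fun s => N s a b) (N' a b) 0

theorem HasMatDeriv.const (C : M2) : HasMatDeriv (fun _ => C) 0 := fun _ _ => hasDerivAt_const _ _

theorem HasMatDeriv.congr {N : ℝ → M2} {N' N'' : M2} (h : HasMatDeriv N N') (h' : N' = N'') :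
    HasMatDeriv N N'' := h' ▸ h

theorem HasMatDeriv.mul {N P : ℝ → M2} {N' P' : M2} (hN : HasMatDeriv N N')
    (hP : HasMatDeriv P P') : HasMatDeriv (fun s => N s * P s) (N' * P 0 + N 0 * P') := by
  intro a b
  simp only [Matrix.mul_apply, Matrix.add_apply, Fin.sum_univ_two]
  have := ((hN a 0).fun_mul (hP 0 b)).fun_add ((hN a 1).fun_mul (hP 1 b))
  exact this.congr_deriv (by ring)

theorem HasMatDeriv.adjugate {N : ℝ → M2} {N' : M2} (hN : HasMatDeriv N N') :
    HasMatDeriv (fun s => (N s).adjugate) N'.adjugate := by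
  intro a b
  simp only [adjugate_fin_two]
  fin_cases a <;> fin_cases b
  · simpa using hN 1 1
  · simpa using (hN 0 1).fun_neg
  · simpa using (hN 1 0).fun_neg
  · simpa using hN 0 0

theorem HasMatDeriv.trace {N : ℝ → M2} {N' : M2} (hN : HasMatDeriv N N') :
    HasDerivAt (fun s => (N s).trace) N'.trace 0 := by
  simp only [trace_fin_two]
  exact (hN 0 0).fun_add (hN 1 1)

theorem HasMatDeriv.det {N : ℝ → M2} {N' : M2} (hN : HasMatDeriv N N') :
    HasDerivAt (fun s => (N s).det) ((N 0).adjugate * N').trace 0 := by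
  simp only [det_fin_two]
  have := ((hN 0 0).fun_mul (hN 1 1)).fun_sub ((hN 0 1).fun_mul (hN 1 0))
  refine this.congr_deriv ?_
  simp only [trace_fin_two, adjugate_fin_two, Matrix.mul_apply, Fin.sum_univ_two, of_apply, cons_val',
    cons_val_zero, cons_val_one, cons_val_fin_one]
  ring

theorem adjugate_eq (M : M2) : M.adjugate = M.trace • 1 - M := by
  ext i j
  fin_cases i <;> fin_cases j <;> simp [adjugate_fin_two, trace_fin_two]

section Derivatives

variable {n : ℕ} (σ : Equiv.Perm (Fin (n + 1)))

/-- The line through `M` in the direction `V`. -/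
def matLine (M : MatTuple n) (V : Fin (n + 1) → M2) (s : ℝ) : MatTuple n :=
  M + s • (fun i j k => V i j k : MatTuple n)

theorem matLine_zero (M : MatTuple n) (V : Fin (n + 1) → M2) : matLine M V 0 = M := by
  simp [matLine]

theorem hasMatDeriv_matLine (M : MatTuple n) (V : Fin (n + 1) → M2) (i : Fin (n + 1)) :
    HasMatDeriv (fun s => Matrix.of (matLine M V s i)) (V i) := by
  intro a b
  simp only [matLine, of_apply, Pi.add_apply, Pi.smul_apply, smul_eq_mul]
  simpa using ((hasDerivAt_id (0 : ℝ)).mul_const (V i a b)).const_add (M i a b)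

/-- Infinitesimal conjugation acts on peripheral loops by infinitesimal conjugation. -/
theorem hasMatDeriv_walkM_conj (A : Fin (n + 1) → SL2R) (ξ : M2) (p : Fin (n + 2)) (k : ℕ) :
    HasMatDeriv
      (fun s => walkM σ (matLine (entries A) (fun i => ξ * (A i : M2) - (A i : M2) * ξ) s) p k)
      (ξ * walkM σ (entries A) p k - walkM σ (entries A) p k * ξ) := by
  have hup : ∀ p, HasMatDeriv
      (fun s => upM (matLine (entries A) (fun i => ξ * (A i : M2) - (A i : M2) * ξ) s) p)
      (ξ * upM (entries A) p - upM (entries A) p * ξ) := by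
    intro p
    induction p using Fin.lastCases with
    | last => simpa [upM] using HasMatDeriv.const 1
    | cast i => simpa [upM, of_entries] using hasMatDeriv_matLine (entries A) _ i
  have hdown : ∀ q, HasMatDeriv
      (fun s => downM σ (matLine (entries A) (fun i => ξ * (A i : M2) - (A i : M2) * ξ) s) q)
      (ξ * downM σ (entries A) q - downM σ (entries A) q * ξ) := by
    intro q
    induction q using Fin.cases with
    | zero => simpa [downM] using HasMatDeriv.const 1
    | succ j =>
      have h := (hasMatDeriv_matLine (entries A)
        (fun i => ξ * (A i : M2) - (A i : M2) * ξ) (σ j)).adjugate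
      simp only [downM, Fin.cases_succ, of_entries]
      refine h.congr ?_
      rw [adjugate_eq, adjugate_eq, trace_sub, trace_mul_comm, sub_self, zero_smul, zero_sub,
        mul_sub, sub_mul, mul_smul_comm, smul_mul_assoc, mul_one, one_mul]
      abel
  have hstep : ∀ p, HasMatDeriv
      (fun s => stepM σ (matLine (entries A) (fun i => ξ * (A i : M2) - (A i : M2) * ξ) s) p)
      (ξ * stepM σ (entries A) p - stepM σ (entries A) p * ξ) := by
    intro p
    have h := (hdown (upPerm σ p)).mul (hup p)
    rw [matLine_zero] at h
    refine h.congr ?_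
    rw [stepM]
    noncomm_ring
  induction k with
  | zero => simpa [walkM] using HasMatDeriv.const 1
  | succ k ih =>
    have h := (hstep ((cornerPerm σ ^ k) p)).mul ih
    rw [matLine_zero] at h
    refine h.congr ?_
    rw [walkM]
    noncomm_ring

/-- The contribution of the upward half of a step to the variation of a peripheral trace. -/
def upVar (X : Fin (n + 1) → M2) (p : Fin (n + 2)) : M2 :=
  Fin.lastCases (motive := fun _ => M2) 0 X p

/-- The contribution of the downward half of a step to the variation of a peripheral trace. -/
def downVar (X : Fin (n + 1) → M2) (p : Fin (n + 2)) : M2 :=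
  Fin.cases (motive := fun _ => M2) 0 (fun i => (X i).adjugate) p

theorem hasMatDeriv_stepM (A : Fin (n + 1) → SL2R) (X : Fin (n + 1) → M2) (p : Fin (n + 2)) :
    HasMatDeriv (fun s => stepM σ (matLine (entries A) (fun i => (A i : M2) * X i) s) p)
      (downVar X (cornerPerm σ p) * (stepSL σ A p : M2) + (stepSL σ A p : M2) * upVar X p) := by
  have hup : HasMatDeriv (fun s => upM (matLine (entries A) (fun i => (A i : M2) * X i) s) p)
      (upM (entries A) p * upVar X p) := by
    induction p using Fin.lastCases with
    | last => simpa [upM, upVar] using HasMatDeriv.const 1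
    | cast i => simpa [upM, upVar, of_entries] using hasMatDeriv_matLine (entries A) _ i
  have hdown : ∀ q, HasMatDeriv
      (fun s => downM σ (matLine (entries A) (fun i => (A i : M2) * X i) s) q)
      (downVar X (downPerm σ q) * downM σ (entries A) q) := by
    intro q
    induction q using Fin.cases with
    | zero => simpa [downM, downVar] using HasMatDeriv.const 1
    | succ j =>
      have h := (hasMatDeriv_matLine (entries A) (fun i => (A i : M2) * X i) (σ j)).adjugate
      rw [adjugate_mul_distrib] at h
      simpa [downM, downVar, of_entries] using h
  have h := (hdown (upPerm σ p)).mul hup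
  rw [matLine_zero] at h
  rw [← stepM_entries, stepM]
  refine h.congr ?_
  rw [cornerPerm, Equiv.Perm.mul_apply]
  noncomm_ring

theorem loopSL_pow_mul_walk (A : Fin (n + 1) → SL2R) (p : Fin (n + 2)) (k : ℕ) :
    loopSL σ A ((cornerPerm σ ^ k) p) * wordSL A (walkWord σ p k) =
      wordSL A (walkWord σ p k) * loopSL σ A p := by
  induction k with
  | zero => simp [walkWord]
  | succ k ih =>
    rw [wordSL, walkWord, map_mul]
    change loopSL σ A _ * (stepSL σ A _ * wordSL A _) = stepSL σ A _ * wordSL A _ * _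
    rw [pow_succ', Equiv.Perm.mul_apply, ← mul_assoc, loopSL_cornerPerm, mul_assoc, ih, mul_assoc]

theorem trace_loopSL_eq_of_vertexOf_eq (A : Fin (n + 1) → SL2R) {p q : Fin (n + 2)}
    (h : vertexOf σ p = vertexOf σ q) : (loopSL σ A p : M2).trace = (loopSL σ A q : M2).trace := by
  obtain ⟨k, -, rfl⟩ := ((vertexOf_eq_iff σ p q).mp h).exists_pow_eq'
  have h := loopSL_pow_mul_walk σ A p k
  rw [← eq_mul_inv_iff_mul_eq] at h
  rw [h, Matrix.SpecialLinearGroup.coe_mul, trace_mul_comm, ← Matrix.SpecialLinearGroup.coe_mul,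
    ← mul_assoc, inv_mul_cancel, one_mul]

/-- The logarithmic variation of a walk. -/
def walkVar (A : Fin (n + 1) → SL2R) (X : Fin (n + 1) → M2) (p : Fin (n + 2)) (k : ℕ) : M2 :=
  ∑ j ∈ Finset.range k,
    (((wordSL A (walkWord σ p j))⁻¹ : SL2R) * upVar X ((cornerPerm σ ^ j) p) *
        (wordSL A (walkWord σ p j) : M2) +
      ((wordSL A (walkWord σ p (j + 1)))⁻¹ : SL2R) * downVar X ((cornerPerm σ ^ (j + 1)) p) *
        (wordSL A (walkWord σ p (j + 1)) : M2))

theorem walkVar_succ (A : Fin (n + 1) → SL2R) (X : Fin (n + 1) → M2) (p : Fin (n + 2)) (k : ℕ) :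
    walkVar σ A X p (k + 1) = walkVar σ A X p k +
      (((wordSL A (walkWord σ p k))⁻¹ : SL2R) * upVar X ((cornerPerm σ ^ k) p) *
        (wordSL A (walkWord σ p k) : M2) +
      ((wordSL A (walkWord σ p (k + 1)))⁻¹ : SL2R) * downVar X ((cornerPerm σ ^ (k + 1)) p) *
        (wordSL A (walkWord σ p (k + 1)) : M2)) := Finset.sum_range_succ _ _

theorem hasMatDeriv_walkM (A : Fin (n + 1) → SL2R) (X : Fin (n + 1) → M2) (p : Fin (n + 2))
    (k : ℕ) :
    HasMatDeriv (fun s => walkM σ (matLine (entries A) (fun i => (A i : M2) * X i) s) p k)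
      ((wordSL A (walkWord σ p k) : M2) * walkVar σ A X p k) := by
  induction k with
  | zero => simpa [walkM, walkVar] using HasMatDeriv.const 1
  | succ k ih =>
    have h := (hasMatDeriv_stepM σ A X ((cornerPerm σ ^ k) p)).mul ih
    rw [matLine_zero, walkM_entries, stepM_entries] at h
    refine h.congr ?_
    have hw : wordSL A (walkWord σ p (k + 1)) =
        stepSL σ A ((cornerPerm σ ^ k) p) * wordSL A (walkWord σ p k) := by
      rw [wordSL, walkWord, map_mul]
      rfl
    have hcancel : ∀ (w : SL2R) (Y : M2), (w : M2) * (((w⁻¹ : SL2R) : M2) * Y) = Y := by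
      intro w Y
      rw [← mul_assoc, ← Matrix.SpecialLinearGroup.coe_mul, mul_inv_cancel,
        Matrix.SpecialLinearGroup.coe_one, one_mul]
    rw [walkVar_succ, mul_add, mul_add, mul_assoc ((((wordSL A (walkWord σ p (k + 1)))⁻¹ : SL2R)) : M2),
      hcancel, hw, Matrix.SpecialLinearGroup.coe_mul, mul_assoc (stepSL σ A _ : M2),
      mul_assoc (stepSL σ A _ : M2), mul_assoc ((((wordSL A (walkWord σ p k))⁻¹ : SL2R)) : M2),
      hcancel, pow_succ', Equiv.Perm.mul_apply]
    noncomm_ring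

theorem trace_loop_walk (A : Fin (n + 1) → SL2R) (Y : M2) (p : Fin (n + 2)) (k : ℕ) :
    ((loopSL σ A p : M2) * (((wordSL A (walkWord σ p k))⁻¹ : SL2R) * Y *
      (wordSL A (walkWord σ p k) : M2))).trace =
      ((loopSL σ A ((cornerPerm σ ^ k) p) : M2) * Y).trace := by
  have h := loopSL_pow_mul_walk σ A p k
  rw [← eq_mul_inv_iff_mul_eq] at h
  rw [h, ← mul_assoc, trace_mul_comm, ← mul_assoc, ← mul_assoc]
  simp only [Matrix.SpecialLinearGroup.coe_mul]

/-- The variation of a peripheral trace is a sum over the corners of the vertex. -/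
theorem hasDerivAt_trace_loopM [DecidableEq (Vertices σ)] (A : Fin (n + 1) → SL2R)
    (X : Fin (n + 1) → M2) (p : Fin (n + 2)) :
    HasDerivAt (fun s => (loopM σ (matLine (entries A) (fun i => (A i : M2) * X i) s) p).trace)
      (∑ q, if vertexOf σ q = vertexOf σ p then
        ((loopSL σ A q : M2) * upVar X q).trace + ((loopSL σ A q : M2) * downVar X q).trace
        else 0) 0 := by
  have h := (hasMatDeriv_walkM σ A X p (Function.minimalPeriod (cornerPerm σ) p)).trace
  refine h.congr_deriv ?_
  change ((loopSL σ A p : M2) * walkVar σ A X p _).trace = _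
  rw [walkVar, Finset.mul_sum, trace_sum]
  simp only [mul_add, trace_add, trace_loop_walk]
  rw [Finset.sum_add_distrib,
    sum_range_minimalPeriod σ (fun q => ((loopSL σ A q : M2) * upVar X q).trace)]
  simp only [pow_succ', Equiv.Perm.mul_apply]
  rw [sum_range_minimalPeriod σ (fun q =>
      ((loopSL σ A (cornerPerm σ q) : M2) * downVar X (cornerPerm σ q)).trace),
    sum_vertex_cornerPerm σ (fun q => ((loopSL σ A q : M2) * downVar X q).trace),
    ← Finset.sum_add_distrib]
  refine Finset.sum_congr rfl fun q _ => ?_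
  split_ifs <;> simp

end Derivatives

end MoebiusIET

end

noncomputable section

namespace MoebiusIET

open scoped ContDiff

/-! ### The equations of the normalised family -/

section Constraint

variable {n : ℕ} (σ : Equiv.Perm (Fin (n + 1)))

/-- The indices of the equations that define the normalised family. -/
abbrev ConstraintIdx : Type := Fin (n + 1) ⊕ Vertices σ ⊕ Fin 3

/-- The equations of the normalised family: the determinants of the branches, the traces of the
peripheral matrices and three equations for the normalisation. -/
def constraint (M : MatTuple n) : ConstraintIdx σ → ℝ :=
  Sum.elim (fun i => (Matrix.of (M i)).det) (Sum.elim (fun v => (loopM σ M v.out).trace)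
    ![loopM σ M 0 0 1, loopM σ M 0 1 0,
      loopM σ M (Fin.last (n + 1)) 0 0 + loopM σ M (Fin.last (n + 1)) 0 1 -
        loopM σ M (Fin.last (n + 1)) 1 0 - loopM σ M (Fin.last (n + 1)) 1 1])

theorem contDiff_constraint : ContDiff ℝ ω (constraint σ) := by
  have h := fun p a b => contDiff_loopM σ p a b
  refine contDiff_pi.mpr ?_
  rintro (i | v | k)
  · simp only [constraint, Sum.elim_inl, det_fin_two, of_apply]
    fun_prop
  · simp only [constraint, Sum.elim_inr, Sum.elim_inl, trace_fin_two]
    exact (h _ _ _).add (h _ _ _)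
  · simp only [constraint, Sum.elim_inr]
    fin_cases k
    · exact h _ _ _
    · exact h _ _ _
    · exact (((h _ _ _).add (h _ _ _)).sub (h _ _ _)).sub (h _ _ _)

theorem vertexOf_out (v : Vertices σ) : vertexOf σ v.out = v := Quotient.out_eq v

theorem fderiv_constraint_apply (M : MatTuple n) (V : Fin (n + 1) → M2) {k : ConstraintIdx σ}
    {d : ℝ} (h : HasDerivAt (fun s => constraint σ (matLine M V s) k) d 0) :
    fderiv ℝ (constraint σ) M (fun i j k => V i j k) k = d := by
  have h1 := ((contDiff_constraint σ).differentiable (by simp) M).hasFDerivAt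
  rw [← matLine_zero M V] at h1
  have h2 : HasDerivAt (matLine M V) (fun i j k => V i j k : MatTuple n) 0 := by
    have := ((hasDerivAt_id (0 : ℝ)).smul_const (fun i j k => V i j k : MatTuple n)).const_add M
    rw [one_smul] at this
    exact this
  have h3 := hasDerivAt_pi.mp (h1.comp_hasDerivAt (0 : ℝ) h2) k
  rw [matLine_zero] at h3
  exact h3.unique h

/-- The components of the derivative of the equations along infinitesimal conjugations. -/
theorem fderiv_constraint_conj (A : Fin (n + 1) → SL2R) (ξ : M2) :
    fderiv ℝ (constraint σ) (entries A) (fun i j k => (ξ * (A i : M2) - (A i : M2) * ξ) j k) =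
      Sum.elim (fun _ => 0) (Sum.elim (fun _ => 0)
        (![(ξ * (loopSL σ A 0 : M2) - (loopSL σ A 0 : M2) * ξ) 0 1,
          (ξ * (loopSL σ A 0 : M2) - (loopSL σ A 0 : M2) * ξ) 1 0,
          cross ((ξ * (loopSL σ A (Fin.last (n + 1)) : M2) -
            (loopSL σ A (Fin.last (n + 1)) : M2) * ξ) *ᵥ vec 1) (vec 1)])) := by
  have hloop : ∀ p, HasMatDeriv
      (fun s => loopM σ (matLine (entries A) (fun i => ξ * (A i : M2) - (A i : M2) * ξ) s) p)
      (ξ * (loopSL σ A p : M2) - (loopSL σ A p : M2) * ξ) := by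
    intro p
    have := hasMatDeriv_walkM_conj σ A ξ p (Function.minimalPeriod (cornerPerm σ) p)
    change HasMatDeriv _ (ξ * loopM σ (entries A) p - loopM σ (entries A) p * ξ) at this
    rwa [loopM_entries] at this
  ext k
  refine fderiv_constraint_apply σ (entries A) _ ?_
  rcases k with i | v | k
  · have h := (hasMatDeriv_matLine (entries A) (fun i => ξ * (A i : M2) - (A i : M2) * ξ) i).det
    refine h.congr_deriv ?_
    rw [matLine_zero, of_entries, mul_sub, trace_sub, ← mul_assoc (A i : M2).adjugate (A i : M2),
      ← mul_assoc, adjugate_mul, trace_mul_comm, ← mul_assoc, mul_adjugate]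
    simp
  · refine (hloop v.out).trace.congr_deriv ?_
    rw [trace_sub, trace_mul_comm, sub_self]
    rfl
  · fin_cases k
    · exact hloop 0 0 1
    · exact hloop 0 1 0
    · have h := hloop (Fin.last (n + 1))
      refine ((((h 0 0).fun_add (h 0 1)).fun_sub (h 1 0)).fun_sub (h 1 1)).congr_deriv ?_
      simp [cross, mulVec, dotProduct, Fin.sum_univ_two]
      ring

theorem fderiv_constraint_det (A : Fin (n + 1) → SL2R) (X : Fin (n + 1) → M2) (i : Fin (n + 1)) :
    fderiv ℝ (constraint σ) (entries A) (fun i j k => ((A i : M2) * X i) j k) (Sum.inl i) =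
      (X i).trace := by
  refine fderiv_constraint_apply σ (entries A) _ ?_
  have h := (hasMatDeriv_matLine (entries A) (fun i => (A i : M2) * X i) i).det
  refine h.congr_deriv ?_
  rw [matLine_zero, of_entries, ← mul_assoc, adjugate_mul, (A i).det_coe, one_smul, one_mul]

theorem sum_fderiv_constraint_trace (A : Fin (n + 1) → SL2R) (X : Fin (n + 1) → M2)
    (y : Vertices σ → ℝ) :
    ∑ v, y v * fderiv ℝ (constraint σ) (entries A) (fun i j k => ((A i : M2) * X i) j k)
        (Sum.inr (Sum.inl v)) =
      ∑ i, (y (vertexOf σ i.castSucc) * ((loopSL σ A i.castSucc : M2) * X i).trace +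
        y (vertexOf σ i.succ) * ((loopSL σ A i.succ : M2) * (X i).adjugate).trace) := by
  classical
  have h : ∀ v, fderiv ℝ (constraint σ) (entries A) (fun i j k => ((A i : M2) * X i) j k)
      (Sum.inr (Sum.inl v)) = ∑ q, if vertexOf σ q = v then
        ((loopSL σ A q : M2) * upVar X q).trace + ((loopSL σ A q : M2) * downVar X q).trace
        else 0 := by
    intro v
    refine fderiv_constraint_apply σ (entries A) _ ?_
    have := hasDerivAt_trace_loopM σ A X v.out
    rwa [vertexOf_out] at this
  simp only [h, Finset.mul_sum, mul_ite, mul_zero]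
  rw [Finset.sum_comm]
  simp only [Finset.sum_ite_eq, Finset.mem_univ, if_true, mul_add]
  rw [Finset.sum_add_distrib, Finset.sum_add_distrib]
  congr 1
  · rw [Fin.sum_univ_castSucc]
    simp [upVar]
  · rw [Fin.sum_univ_succ (n := n + 1)]
    simp [downVar]

variable {σ}

theorem eq_zero_of_pairing_eq_zero {T : PIET σ} {A : Fin (n + 1) → SL2R} {l : Fin (n + 2) → ℝ}
    (hn : 1 ≤ n) (h : IsEigen σ T A l) (h1 : ∀ v, T.breakSize v ≠ 1) {y : Vertices σ → ℝ}
    (hy : ∀ (i : Fin (n + 1)) (X : M2), X.trace = 0 →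
      y (vertexOf σ i.castSucc) * ((loopSL σ A i.castSucc : M2) * X).trace +
        y (vertexOf σ i.succ) * ((loopSL σ A i.succ : M2) * X.adjugate).trace = 0) : y = 0 := by
  set D : Fin (n + 2) → SL2R := loopSL σ A with hD
  have key : ∀ (f : Fin (n + 2) → ℝ), (∀ i : Fin (n + 1), f i.castSucc = f i.succ) →
      ∀ p, f p = f 0 := by
    intro f hf p
    induction p using Fin.induction with
    | zero => rfl
    | succ i ih => rw [← hf, ih]
  have h10 := key (fun p => y (vertexOf σ p) * (D p) 1 0) fun i => by
    have := hy i !![0, 1; 0, 0] (by simp [trace_fin_two])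
    simp [trace_fin_two, Matrix.mul_apply, Fin.sum_univ_two, adjugate_fin_two, -cons_mul] at this
    linarith
  have h01 := key (fun p => y (vertexOf σ p) * (D p) 0 1) fun i => by
    have := hy i !![0, 0; 1, 0] (by simp [trace_fin_two])
    simp [trace_fin_two, Matrix.mul_apply, Fin.sum_univ_two, adjugate_fin_two, -cons_mul] at this
    linarith
  have hdiag := key (fun p => y (vertexOf σ p) * ((D p) 0 0 - (D p) 1 1)) fun i => by
    have := hy i !![1, 0; 0, -1] (by simp [trace_fin_two])
    simp [trace_fin_two, Matrix.mul_apply, Fin.sum_univ_two, adjugate_fin_two, -cons_mul] at this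
    linarith
  generalize y (vertexOf σ 0) * (D 0) 1 0 = β at h10
  generalize y (vertexOf σ 0) * (D 0) 0 1 = γ at h01
  generalize y (vertexOf σ 0) * ((D 0) 0 0 - (D 0) 1 1) = δ at hdiag
  have hquad : ∀ p, β * T.top p ^ 2 - δ * T.top p - γ = 0 := by
    intro p
    obtain ⟨e0, e1⟩ := (mulVec_vec_eq_iff ..).mp (h p).1
    rw [← h10 p, ← h01 p, ← hdiag p]
    linear_combination y (vertexOf σ p) * (T.top p * e1 - e0)
  obtain ⟨p, q, r, hpq, hqr⟩ : ∃ p q r : Fin (n + 2), p < q ∧ q < r :=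
    ⟨⟨0, by omega⟩, ⟨1, by omega⟩, ⟨2, by omega⟩, Fin.mk_lt_mk.mpr (by omega),
      Fin.mk_lt_mk.mpr (by omega)⟩
  have hpq' := T.top_strictMono hpq
  have hqr' := T.top_strictMono hqr
  have e1 : β * (T.top p + T.top q) - δ = 0 := by
    have : (T.top q - T.top p) * (β * (T.top p + T.top q) - δ) = 0 := by
      linear_combination hquad q - hquad p
    exact (mul_eq_zero.mp this).resolve_left (by linarith)
  have e2 : β * (T.top q + T.top r) - δ = 0 := by
    have : (T.top r - T.top q) * (β * (T.top q + T.top r) - δ) = 0 := by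
      linear_combination hquad r - hquad q
    exact (mul_eq_zero.mp this).resolve_left (by linarith)
  have hβ : β = 0 := by
    have : (T.top r - T.top p) * β = 0 := by linear_combination e2 - e1
    exact (mul_eq_zero.mp this).resolve_left (by linarith)
  have hδ : δ = 0 := by rw [hβ] at e1; linarith
  have hγ : γ = 0 := by have := hquad p; rw [hβ, hδ] at this; linarith
  rw [hβ] at h10
  rw [hγ] at h01
  rw [hδ] at hdiag
  funext v
  obtain ⟨p, rfl⟩ := vertexOf_surjective σ v
  by_contra hne
  have d10 := (mul_eq_zero.mp (h10 p)).resolve_left hne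
  have d01 := (mul_eq_zero.mp (h01 p)).resolve_left hne
  have dd := (mul_eq_zero.mp (hdiag p)).resolve_left hne
  obtain ⟨-, e1⟩ := (mulVec_vec_eq_iff ..).mp (h p).1
  have hdet := det_eq_one (D p)
  rw [d10, zero_mul, zero_add] at e1
  apply h.sq_ne_one h1 p
  rw [d10, mul_zero, sub_zero] at hdet
  have : (D p) 0 0 = l p := by
    change (D p) 1 1 = l p at e1
    linarith
  change (D p) 1 1 = l p at e1
  rw [this, e1] at hdet
  linarith

theorem surjective_fderiv_constraint {c : Vertices σ → ℝ} (hn : 1 ≤ n) (hc1 : ∀ v, c v ≠ 1)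
    {T : E σ c} {A : Fin (n + 1) → SL2R} (hA : T.1.IsLift A) {l : Fin (n + 2) → ℝ}
    (hl : IsEigen σ T.1 A l) : Function.Surjective (fderiv ℝ (constraint σ) (entries A)) := by
  classical
  set L := (fderiv ℝ (constraint σ) (entries A)).toLinearMap with hL
  change Function.Surjective L
  rw [← LinearMap.range_eq_top]
  by_contra hne
  obtain ⟨φ, hφ0, hφ⟩ := Submodule.exists_le_ker_of_lt_top _ (lt_top_iff_ne_top.mpr hne)
  have hφL : ∀ V, φ (L V) = 0 := fun V => hφ (LinearMap.mem_range_self L V)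
  obtain ⟨a, ha⟩ : ∃ a : ConstraintIdx σ → ℝ, ∀ w, φ w = ∑ k, w k * a k := by
    refine ⟨fun k => φ (Pi.single k 1), fun w => ?_⟩
    rw [LinearMap.pi_apply_eq_sum_univ φ w]
    refine Finset.sum_congr rfl fun k _ => ?_
    rw [smul_eq_mul]
    congr 2
    ext j
    simp [Pi.single_apply, eq_comm]
  apply hφ0
  suffices h : a = 0 by
    ext w
    simp [ha, h]
  have hD0 := E.loop_zero_eq hA hl
  have hl1 := hl.sq_ne_one (breakSize_ne_one hc1)
  have hconj : ∀ ξ : M2,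
      (ξ 0 1 * l 0 - (l 0)⁻¹ * ξ 0 1) * a (Sum.inr (Sum.inr 0)) +
      (ξ 1 0 * (l 0)⁻¹ - l 0 * ξ 1 0) * a (Sum.inr (Sum.inr 1)) +
      cross ((ξ * (loopSL σ A (Fin.last (n + 1)) : M2) -
            (loopSL σ A (Fin.last (n + 1)) : M2) * ξ) *ᵥ vec 1) (vec 1) *
        a (Sum.inr (Sum.inr 2)) = 0 := by
    intro ξ
    have h := hφL (fun i j k => (ξ * (A i : M2) - (A i : M2) * ξ) j k)
    rw [hL, ContinuousLinearMap.coe_coe, fderiv_constraint_conj, ha, Fintype.sum_sum_type,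
      Fintype.sum_sum_type, Fin.sum_univ_three, hD0] at h
    simpa [Matrix.mul_apply, Fin.sum_univ_two, -cons_mul] using h
  have hz2 : a (Sum.inr (Sum.inr 2)) = 0 := by
    have h := hconj !![1, 0; 0, 0]
    obtain ⟨e0, e1⟩ := (mulVec_vec_eq_iff ..).mp (hl (Fin.last (n + 1))).1
    rw [T.2.2.1, mul_one, mul_one] at e0
    rw [T.2.2.1, mul_one] at e1
    have hdet := det_eq_one (loopSL σ A (Fin.last (n + 1)))
    set D := loopSL σ A (Fin.last (n + 1))
    set m := l (Fin.last (n + 1)) with hm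
    have hm0 : m ≠ 0 := hl.ne_zero _
    have h2 : cross ((!![1, 0; 0, 0] * (D : M2) - (D : M2) * !![1, 0; 0, 0]) *ᵥ vec 1) (vec 1) =
        m - m⁻¹ := by
      have h3 : D 0 0 - D 1 0 = m⁻¹ := by
        refine eq_inv_of_mul_eq_one_right ?_
        linear_combination hdet + (D 0 0) * (-e1) + (D 1 0) * e0
      have h4 : cross ((!![1, 0; 0, 0] * (D : M2) - (D : M2) * !![1, 0; 0, 0]) *ᵥ vec 1) (vec 1) =
          D 0 1 + D 1 0 := by
        simp only [cross, mulVec, dotProduct, Matrix.sub_apply, Matrix.mul_apply, Fin.sum_univ_two,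
          vec_zero, vec_one, of_apply, cons_val', cons_val_zero, cons_val_one, cons_val_fin_one]
        ring
      rw [h4, ← h3]
      linarith
    rw [h2] at h
    simp only [of_apply, cons_val', cons_val_zero, cons_val_one, cons_val_fin_one, mul_zero,
      zero_mul, sub_zero, zero_add, add_zero] at h
    exact (mul_eq_zero.mp h).resolve_left (sub_inv_ne_zero hm0 (hl1 _))
  have hz0 : a (Sum.inr (Sum.inr 0)) = 0 := by
    have h := hconj !![0, 1; 0, 0]
    rw [hz2] at h
    simp only [of_apply, cons_val', cons_val_zero, cons_val_one, cons_val_fin_one, mul_zero,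
      zero_mul, sub_zero, add_zero, one_mul, mul_one] at h
    exact (mul_eq_zero.mp h).resolve_left (sub_inv_ne_zero (hl.ne_zero 0) (hl1 0))
  have hz1 : a (Sum.inr (Sum.inr 1)) = 0 := by
    have h := hconj !![0, 0; 1, 0]
    rw [hz2] at h
    simp only [of_apply, cons_val', cons_val_zero, cons_val_one, cons_val_fin_one, mul_zero,
      zero_mul, sub_zero, add_zero, zero_add, one_mul, mul_one] at h
    exact (mul_eq_zero.mp h).resolve_left (inv_sub_ne_zero hl hc1 0)
  have hX : ∀ (i : Fin (n + 1)) (X : M2), X.trace * a (Sum.inl i) +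
      (a (Sum.inr (Sum.inl (vertexOf σ i.castSucc))) * ((loopSL σ A i.castSucc : M2) * X).trace +
        a (Sum.inr (Sum.inl (vertexOf σ i.succ))) *
          ((loopSL σ A i.succ : M2) * X.adjugate).trace) = 0 := by
    intro i X
    have h := hφL (fun j b k => ((A j : M2) * (Pi.single i X : Fin (n + 1) → M2) j) b k)
    rw [hL, ContinuousLinearMap.coe_coe, ha, Fintype.sum_sum_type, Fintype.sum_sum_type,
      Fin.sum_univ_three, hz0, hz1, hz2] at h
    have h2 := sum_fderiv_constraint_trace σ A (Pi.single i X : Fin (n + 1) → M2)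
      (fun v => a (Sum.inr (Sum.inl v)))
    simp only [fderiv_constraint_det, mul_zero, add_zero] at h
    rw [Finset.sum_congr rfl fun v _ => mul_comm _ (a (Sum.inr (Sum.inl v))), h2,
      Finset.sum_eq_single i, Finset.sum_eq_single i] at h
    · simpa using h
    · intro j _ hj
      simp [Pi.single_eq_of_ne hj]
    · simp
    · intro j _ hj
      simp [Pi.single_eq_of_ne hj]
    · simp
  have hy : (fun v => a (Sum.inr (Sum.inl v))) = 0 :=
    eq_zero_of_pairing_eq_zero hn hl (breakSize_ne_one hc1) fun i X hX0 => by
      have := hX i X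
      rwa [hX0, zero_mul, zero_add] at this
  funext k
  rcases k with i | v | k
  · have h := hX i 1
    have h1 := congrFun hy (vertexOf σ i.castSucc)
    have h2 := congrFun hy (vertexOf σ i.succ)
    simp only [Pi.zero_apply] at h1 h2
    rw [h1, h2, zero_mul, zero_mul, add_zero, add_zero, trace_one] at h
    simpa using h
  · exact congrFun hy v
  · fin_cases k
    · exact hz0
    · exact hz1
    · exact hz2

end Constraint

end MoebiusIET

end

noncomputable section

open scoped ContDiff in
/-- The solutions of equations with surjective derivative are straightened by smooth coordinates. -/
theorem exists_coordinates_of_surjective_fderiv {V ι : Type} [NormedAddCommGroup V]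
    [NormedSpace ℝ V] [FiniteDimensional ℝ V] [Fintype ι] {C : V → ι → ℝ} {x : V} {m : ℕ}
    (hC : ContDiffAt ℝ ω C x) (hs : Function.Surjective (fderiv ℝ C x))
    (hdim : Module.finrank ℝ V = Fintype.card ι + m) {W : Set V} (hW : W ∈ 𝓝 x) :
    ∃ (L : V →L[ℝ] EuclideanSpace ℝ (Fin m))
      (H : OpenPartialHomeomorph V ((ι → ℝ) × EuclideanSpace ℝ (Fin m))),
      x ∈ H.source ∧ H.source ⊆ W ∧ (∀ y, H y = (C y, L y)) ∧
        ContDiffOn ℝ (⊤ : ℕ∞) H.symm H.target := by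
  set D := fderiv ℝ C x with hD
  have hker : Module.finrank ℝ D.ker = Module.finrank ℝ (EuclideanSpace ℝ (Fin m)) := by
    have h1 := LinearMap.finrank_range_add_finrank_ker D.toLinearMap
    rw [LinearMap.range_eq_top.mpr hs, finrank_top, Module.finrank_fintype_fun_eq_card, hdim] at h1
    rw [finrank_euclideanSpace_fin]
    exact Nat.add_left_cancel h1
  obtain ⟨P, hP⟩ := LinearMap.exists_leftInverse_of_injective D.ker.subtype
    (LinearMap.ker_eq_bot.mpr D.ker.injective_subtype)
  let e : D.ker ≃ₗ[ℝ] EuclideanSpace ℝ (Fin m) := LinearEquiv.ofFinrankEq _ _ hker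
  let L : V →L[ℝ] EuclideanSpace ℝ (Fin m) := (e.toLinearMap ∘ₗ P).toContinuousLinearMap
  have hL : ∀ v, L v = e (P v) := fun v => rfl
  have hinj : Function.Injective (D.prod L) := by
    rw [injective_iff_map_eq_zero]
    intro v hv
    obtain ⟨h1, h2⟩ := Prod.mk_inj.mp hv
    have h3 : P v = 0 := by
      change L v = 0 at h2
      rw [hL] at h2
      exact e.map_eq_zero_iff.mp h2
    have h4 := LinearMap.congr_fun hP ⟨v, h1⟩
    have h5 : P v = ⟨v, h1⟩ := h4
    rw [h3] at h5
    exact (congrArg Subtype.val h5).symm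
  have hfr : Module.finrank ℝ V =
      Module.finrank ℝ ((ι → ℝ) × EuclideanSpace ℝ (Fin m)) := by
    rw [hdim, Module.finrank_prod, Module.finrank_fintype_fun_eq_card, finrank_euclideanSpace_fin]
  let Φ : V ≃L[ℝ] (ι → ℝ) × EuclideanSpace ℝ (Fin m) :=
    (LinearMap.linearEquivOfInjective (D.prod L).toLinearMap hinj hfr).toContinuousLinearEquiv
  let G : V → (ι → ℝ) × EuclideanSpace ℝ (Fin m) := fun y => (C y, L y)
  have hG : ContDiffAt ℝ ω G x := hC.prodMk L.contDiff.contDiffAt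
  have hG' : HasFDerivAt G (Φ : V →L[ℝ] (ι → ℝ) × EuclideanSpace ℝ (Fin m)) x :=
    ((hC.differentiableAt (by simp)).hasFDerivAt).prodMk L.hasFDerivAt
  let H₀ := hG.toOpenPartialHomeomorph G hG' (by simp)
  have hH₀ : ∀ y, H₀ y = G y := fun y => rfl
  have hx : x ∈ H₀.source := hG.mem_toOpenPartialHomeomorph_source hG' (by simp)
  have hloc : ContDiffAt ℝ ω H₀.symm (G x) := hG.to_localInverse hG' (by simp)
  obtain ⟨U, hU, hUo, hxU⟩ := eventually_nhds_iff.mp (hloc.eventually (by simp))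
  have hS : IsOpen (interior W ∩ (H₀.source ∩ H₀ ⁻¹' U)) :=
    isOpen_interior.inter (H₀.isOpen_inter_preimage hUo)
  refine ⟨L, H₀.restrOpen _ hS, ?_, ?_, fun y => rfl, ?_⟩
  · rw [OpenPartialHomeomorph.restrOpen_source]
    exact ⟨hx, mem_interior_iff_mem_nhds.mpr hW, hx, hxU⟩
  · rw [OpenPartialHomeomorph.restrOpen_source]
    exact fun y hy => interior_subset hy.2.1
  · intro y hy
    have h1 : (H₀.restrOpen _ hS).symm y ∈ (H₀.restrOpen _ hS).source :=
      (H₀.restrOpen _ hS).map_target hy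
    have h2 : H₀ ((H₀.restrOpen _ hS).symm y) = y := (H₀.restrOpen _ hS).right_inv hy
    rw [OpenPartialHomeomorph.restrOpen_source] at h1
    have h3 : y ∈ U := by
      have := h1.2.2.2
      rwa [Set.mem_preimage, h2] at this
    exact ((hU y h3).of_le le_top).contDiffWithinAt

namespace MoebiusIET

open scoped ContDiff

/-! ### Local sections of the projection to the projective group -/

section LocalSection

variable {n : ℕ}

/-- The pairing of the entries of two tuples of matrices. -/
def pairing (M N : Fin 2 → Fin 2 → ℝ) : ℝ := ∑ j, ∑ k, M j k * N j k

/-- The tuples of matrices that form acute angles with those of a given tuple. -/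
def acute (A : Fin (n + 1) → SL2R) : Set (MatTuple n) :=
  {M | ∀ i, 0 < pairing (fun j k => A i j k) (M i)}

theorem isOpen_acute (A : Fin (n + 1) → SL2R) : IsOpen (acute A) := by
  have : acute A = ⋂ i, {M | 0 < pairing (fun j k => A i j k) (M i)} := by
    ext M
    simp [acute]
  rw [this]
  refine isOpen_iInter_of_finite fun i => isOpen_lt continuous_const ?_
  simp only [pairing, Fin.sum_univ_two]
  fun_prop

theorem entries_mem_acute (A : Fin (n + 1) → SL2R) : entries A ∈ acute A := by
  intro i
  have hdet := det_eq_one (A i)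
  simp only [pairing, entries, Fin.sum_univ_two]
  nlinarith [sq_nonneg (A i 0 0 - A i 1 1), sq_nonneg (A i 0 1 + A i 1 0)]

theorem eq_of_mem_acute {A B B' : Fin (n + 1) → SL2R} (hB : entries B ∈ acute A)
    (hB' : entries B' ∈ acute A) (h : ∀ i, proj (B i) = proj (B' i)) : B = B' := by
  funext i
  rcases (proj_eq_iff ..).mp (h i) with h1 | h1
  · exact h1.symm
  · exfalso
    have h2 := hB i
    have h3 := hB' i
    simp only [pairing, entries, Fin.sum_univ_two, h1, Matrix.SpecialLinearGroup.coe_neg,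
      Matrix.neg_apply] at h2 h3
    linarith

open Classical in
/-- The section of the projection with values at acute angles with a given tuple. -/
def acuteSection (A : Fin (n + 1) → SL2R) (g : Fin (n + 1) → PSL2R) : Fin (n + 1) → SL2R :=
  if h : ∃ B, entries B ∈ acute A ∧ (fun i => proj (B i)) = g then h.choose else A

theorem acuteSection_apply {A B : Fin (n + 1) → SL2R} (hB : entries B ∈ acute A) :
    acuteSection A (fun i => proj (B i)) = B := by
  have h : ∃ B', entries B' ∈ acute A ∧ (fun i => proj (B' i)) = fun i => proj (B i) :=
    ⟨B, hB, rfl⟩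
  rw [acuteSection, dif_pos h]
  exact eq_of_mem_acute h.choose_spec.1 hB (congrFun h.choose_spec.2)

/-- The domain of `acuteSection`. -/
def acuteDomain (A : Fin (n + 1) → SL2R) : Set (Fin (n + 1) → PSL2R) :=
  (fun B i => proj (B i)) '' (entries ⁻¹' acute A)

theorem isOpenQuotientMap_piMap_proj :
    IsOpenQuotientMap fun (B : Fin (n + 1) → SL2R) i => proj (B i) :=
  IsOpenQuotientMap.piMap fun _ => isOpenQuotientMap_proj

theorem isOpen_acuteDomain (A : Fin (n + 1) → SL2R) : IsOpen (acuteDomain A) :=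
  isOpenQuotientMap_piMap_proj.isOpenMap _ ((isOpen_acute A).preimage continuous_entries)

theorem continuousOn_acuteSection (A : Fin (n + 1) → SL2R) :
    ContinuousOn (acuteSection A) (acuteDomain A) := by
  rintro _ ⟨B, hB, rfl⟩
  refine ContinuousAt.continuousWithinAt ?_
  rw [ContinuousAt, acuteSection_apply hB, ← isOpenQuotientMap_piMap_proj.map_nhds_eq,
    Filter.tendsto_map'_iff]
  refine Filter.Tendsto.congr' ?_ Filter.tendsto_id
  filter_upwards [((isOpen_acute A).preimage continuous_entries).mem_nhds hB] with B' hB'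
  exact (acuteSection_apply hB').symm

end LocalSection

/-! ### The equations near a normalised interval exchange -/

section Chart

variable {n : ℕ} {σ : Equiv.Perm (Fin (n + 1))} {c : Vertices σ → ℝ} {T : E σ c}
  {A : Fin (n + 1) → SL2R} {l : Fin (n + 2) → ℝ}

theorem E.last_row (hl : IsEigen σ T.1 A l) :
    (loopSL σ A (Fin.last (n + 1))) 0 0 + (loopSL σ A (Fin.last (n + 1))) 0 1 =
      l (Fin.last (n + 1)) ∧
    (loopSL σ A (Fin.last (n + 1))) 1 0 + (loopSL σ A (Fin.last (n + 1))) 1 1 =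
      l (Fin.last (n + 1)) := by
  have h := (mulVec_vec_eq_iff ..).mp (hl (Fin.last (n + 1))).1
  rw [T.2.2.1] at h
  simpa only [mul_one] using h

theorem PIET.top_eq_of_isLift {T T' : PIET σ} {A : Fin (n + 1) → SL2R} (h : T.IsLift A)
    (h' : T'.IsLift A) (hTT' : ∀ v, T.breakSize v = T'.breakSize v)
    (h1 : ∀ v, T.breakSize v ≠ 1) : T.top = T'.top := by
  funext p
  obtain ⟨m, hm⟩ := h.top_conj (K := 1) (T' := T') (by simpa using h') hTT' h1 p
  obtain ⟨h2, h3⟩ := (mulVec_vec_eq_iff ..).mp hm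
  simp at h2 h3
  rw [h2, ← h3, one_mul]

/-- Near the matrices of a normalised interval exchange, the solutions of the equations are the
matrices of the normalised interval exchanges. -/
theorem E.eventually_constraint_iff (hc : ∀ v, 0 < c v) (hc1 : ∀ v, c v ≠ 1)
    (hA : T.1.IsLift A) (hl : IsEigen σ T.1 A l) :
    ∀ᶠ M in 𝓝 (entries A),
      (constraint σ M = constraint σ (entries A) →
        ∃ (T' : E σ c) (B : Fin (n + 1) → SL2R), T'.1.IsLift B ∧ entries B = M) ∧
      ∀ (T' : E σ c) (B : Fin (n + 1) → SL2R), T'.1.IsLift B → entries B = M →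
        constraint σ M = constraint σ (entries A) ∧ T'.1.top = corner σ l T.1.top M := by
  have hb1 := breakSize_ne_one (T := T) hc1
  have hlast : ∀ᶠ M in 𝓝 (entries A), loopM σ M (Fin.last (n + 1)) 1 0 +
      loopM σ M (Fin.last (n + 1)) 1 1 ≠ (l (Fin.last (n + 1)))⁻¹ := by
    refine ((contDiff_loopM σ _ 1 0).continuous.add
      (contDiff_loopM σ _ 1 1).continuous).continuousAt.eventually_ne ?_
    have := (E.last_row hl).2
    change loopM σ (entries A) _ 1 0 + loopM σ (entries A) _ 1 1 ≠ _
    rw [loopM_entries, this]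
    exact sub_ne_zero.mp (sub_inv_ne_zero (hl.ne_zero _) (hl.sq_ne_one hb1 _))
  have hD0 := E.loop_zero_eq hA hl
  filter_upwards [hl.eventually_reconstruct hA hb1, hl.eventually_trace hc T.2.2.2.2, hlast]
    with M h1 h2 h3
  constructor
  · intro hM
    have hdet : ∀ i, (Matrix.of (M i)).det = 1 := by
      intro i
      have := congrFun hM (Sum.inl i)
      change (Matrix.of (M i)).det = (A i : M2).det at this
      rw [this, (A i).det_coe]
    let B : Fin (n + 1) → SL2R := fun i => ⟨Matrix.of (M i), hdet i⟩
    have hB : entries B = M := rfl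
    have htr : ∀ p, (loopSL σ B p : M2).trace = l p + (l p)⁻¹ := by
      intro p
      have h4 := congrFun hM (Sum.inr (Sum.inl (vertexOf σ p)))
      change (loopM σ (entries B) _).trace = (loopM σ (entries A) _).trace at h4
      rw [loopM_entries, loopM_entries,
        trace_loopSL_eq_of_vertexOf_eq σ B (vertexOf_out σ (vertexOf σ p)),
        trace_loopSL_eq_of_vertexOf_eq σ A (vertexOf_out σ (vertexOf σ p)), hl.trace_loopSL] at h4
      exact h4
    have e01 := congrFun hM (Sum.inr (Sum.inr 0))
    change loopM σ (entries B) 0 0 1 = loopM σ (entries A) 0 0 1 at e01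
    have e10 := congrFun hM (Sum.inr (Sum.inr 1))
    change loopM σ (entries B) 0 1 0 = loopM σ (entries A) 0 1 0 at e10
    rw [loopM_entries, loopM_entries, hD0] at e01 e10
    have e01 : (loopSL σ B 0) 0 1 = 0 := by simpa using e01
    have e10 : (loopSL σ B 0) 1 0 = 0 := by simpa using e10
    have elast := congrFun hM (Sum.inr (Sum.inr 2))
    change loopM σ (entries B) _ 0 0 + loopM σ (entries B) _ 0 1 - loopM σ (entries B) _ 1 0 -
      loopM σ (entries B) _ 1 1 = loopM σ (entries A) _ 0 0 + loopM σ (entries A) _ 0 1 -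
      loopM σ (entries A) _ 1 0 - loopM σ (entries A) _ 1 1 at elast
    rw [loopM_entries, loopM_entries] at elast
    rw [← hB, loopM_entries] at h3
    obtain ⟨r0, r1⟩ := E.last_row hl
    obtain ⟨T', hT', -, hbr, heig⟩ := h1 B hB htr
    have hb1' : ∀ v, T'.breakSize v ≠ 1 := fun v => by rw [hbr]; exact hb1 v
    refine ⟨⟨T', ?_, ?_, ?_, fun v => (hbr v).trans (T.2.2.2.2 v)⟩, B, hT', hB⟩
    · obtain ⟨k0, k1⟩ := (mulVec_vec_eq_iff ..).mp (heig 0).1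
      have hd := det_eq_one (loopSL σ B 0)
      rw [e01] at k0 hd
      rw [e10, zero_mul, zero_add] at k1
      rw [k1, e10] at hd
      by_contra ht
      have h5 : (loopSL σ B 0) 0 0 = l 0 := mul_right_cancel₀ ht (by linarith)
      rw [h5] at hd
      exact heig.sq_ne_one hb1' 0 (by linarith)
    · set D := loopSL σ B (Fin.last (n + 1)) with hD
      have hvec : (D : M2) *ᵥ vec 1 = ((D : M2) 1 0 + (D : M2) 1 1) • vec 1 := by
        refine (mulVec_vec_eq_iff ..).mpr ⟨?_, by ring⟩
        linarith
      have h5 := cross_mulVec (D : M2) (vec (T'.top (Fin.last (n + 1)))) (vec 1)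
      rw [(heig (Fin.last (n + 1))).1, hvec, cross_smul_smul, D.det_coe] at h5
      simp only [cross, vec_zero, vec_one, mul_one] at h5
      have h6 : l (Fin.last (n + 1)) * ((D : M2) 1 0 + (D : M2) 1 1) ≠ 1 := fun h =>
        h3 (eq_inv_of_mul_eq_one_right h)
      by_contra ht
      exact h6 (mul_right_cancel₀ (sub_ne_zero.mpr ht) (by linarith))
    · rw [hT'.rep_eq, repSL_eval]
      exact (isAffine_proj_iff _).mpr e10
  · rintro T' B hB rfl
    have htr := h2 B rfl (hB.mem_relRep c hc hc1 T'.2.2.2.2)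
    refine ⟨?_, ?_⟩
    · obtain ⟨l', hl'⟩ := hB.exists_isEigen
      funext k
      rcases k with i | v | k
      · change (B i : M2).det = (A i : M2).det
        rw [(B i).det_coe, (A i).det_coe]
      · change (loopM σ (entries B) v.out).trace = (loopM σ (entries A) v.out).trace
        rw [loopM_entries, loopM_entries, htr, hl.trace_loopSL]
      · have hD0' := E.loop_zero_eq hB hl'
        fin_cases k
        · change loopM σ (entries B) 0 0 1 = loopM σ (entries A) 0 0 1
          rw [loopM_entries, loopM_entries, hD0, hD0']
          simp
        · change loopM σ (entries B) 0 1 0 = loopM σ (entries A) 0 1 0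
          rw [loopM_entries, loopM_entries, hD0, hD0']
          simp
        · change loopM σ (entries B) _ 0 0 + loopM σ (entries B) _ 0 1 -
            loopM σ (entries B) _ 1 0 - loopM σ (entries B) _ 1 1 = loopM σ (entries A) _ 0 0 +
            loopM σ (entries A) _ 0 1 - loopM σ (entries A) _ 1 0 - loopM σ (entries A) _ 1 1
          rw [loopM_entries, loopM_entries]
          obtain ⟨r0, r1⟩ := E.last_row hl
          obtain ⟨s0, s1⟩ := E.last_row hl'
          linarith
    · obtain ⟨T₁, hT₁, htop, hbr, -⟩ := h1 B rfl htr
      rw [← htop]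
      exact PIET.top_eq_of_isLift hB hT₁
        (fun v => by rw [hbr, T.2.2.2.2, T'.2.2.2.2]) (breakSize_ne_one hc1)

end Chart

end MoebiusIET

end

noncomputable section

namespace MoebiusIET

open scoped ContDiff

/-! ### Charts of the normalised family -/

section Manifold

variable {n : ℕ} {σ : Equiv.Perm (Fin (n + 1))} {c : Vertices σ → ℝ}

theorem finrank_matTuple (hσ : IsGenusOne σ) :
    Module.finrank ℝ (MatTuple n) = Fintype.card (ConstraintIdx σ) + 2 * n := by
  rw [IsGenusOne] at hσ
  simp only [Module.finrank_pi_fintype, Module.finrank_self, Fintype.card_sum, Fintype.card_fin,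
    hσ, Finset.sum_const, Finset.card_univ, smul_eq_mul]
  ring

/-- A smooth parametrisation of a neighbourhood in the normalised family, together with its
inverse in terms of the branches. -/
theorem E.exists_parametrization (hσ : IsGenusOne σ) (hc : ∀ v, 0 < c v) (hc1 : ∀ v, c v ≠ 1)
    {T : E σ c} {A : Fin (n + 1) → SL2R} (hA : T.1.IsLift A) :
    ∃ (O : Set (MatTuple n)) (Y : Set (EuclideanSpace ℝ (Fin (2 * n))))
      (L : MatTuple n →L[ℝ] EuclideanSpace ℝ (Fin (2 * n)))
      (ψ : EuclideanSpace ℝ (Fin (2 * n)) → (Fin (n + 2) → ℝ) × MatTuple n),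
      IsOpen O ∧ entries A ∈ O ∧ O ⊆ acute A ∧ IsOpen Y ∧ ContDiffOn ℝ (⊤ : ℕ∞) ψ Y ∧
      (∀ y ∈ Y, ∃ (T' : E σ c) (B : Fin (n + 1) → SL2R), T'.1.IsLift B ∧ entries B ∈ O ∧
        ψ y = (T'.1.top, entries B) ∧ L (entries B) = y) ∧
      ∀ (T' : E σ c) (B : Fin (n + 1) → SL2R), T'.1.IsLift B → entries B ∈ O →
        L (entries B) ∈ Y ∧ ψ (L (entries B)) = (T'.1.top, entries B) := by
  obtain ⟨l, hl⟩ := hA.exists_isEigen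
  have hb1 := breakSize_ne_one (T := T) hc1
  have hcor : ContDiffAt ℝ ω (fun M => (corner σ l T.1.top M, M)) (entries A) :=
    (contDiffAt_pi.mpr fun p => contDiffAt_corner σ (hl.cornerVec_self_ne_zero hb1 p)).prodMk
      contDiffAt_id
  obtain ⟨W, hWo, hAW, hsm, hW⟩ := exists_open_contDiffOn hcor
    (((isOpen_acute A).eventually_mem (entries_mem_acute A)).and
      (E.eventually_constraint_iff hc hc1 hA hl))
  obtain ⟨L, H, hAH, hHW, hH, hHs⟩ := exists_coordinates_of_surjective_fderiv
    (contDiff_constraint σ).contDiffAt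
    (surjective_fderiv_constraint (one_le_of_isGenusOne σ hσ) hc1 hA hl)
    (finrank_matTuple hσ) (hWo.mem_nhds hAW)
  have hι : ContDiff ℝ (⊤ : ℕ∞) fun y : EuclideanSpace ℝ (Fin (2 * n)) =>
      (constraint σ (entries A), y) := contDiff_const.prodMk contDiff_id
  have hsymm : ContDiffOn ℝ (⊤ : ℕ∞) (fun y : EuclideanSpace ℝ (Fin (2 * n)) =>
      H.symm (constraint σ (entries A), y))
      ((fun y => (constraint σ (entries A), y)) ⁻¹' H.target) :=
    hHs.comp hι.contDiffOn fun y hy => hy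
  refine ⟨H.source, (fun y => (constraint σ (entries A), y)) ⁻¹' H.target, L,
    fun y => (fun M => (corner σ l T.1.top M, M)) (H.symm (constraint σ (entries A), y)),
    H.open_source, hAH, fun M hM => (hW M (hHW hM)).1, H.open_target.preimage hι.continuous,
    hsm.comp hsymm fun y hy => hHW (H.map_target hy), fun y hy => ?_, fun T' B hB hBO => ?_⟩
  · have hmem := H.map_target hy
    have h1 := (hH _).symm.trans (H.right_inv hy)
    obtain ⟨h2, h3⟩ := Prod.mk_inj.mp h1
    obtain ⟨T', B, hB, hBM⟩ := (hW _ (hHW hmem)).2.1 h2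
    refine ⟨T', B, hB, hBM ▸ hmem, ?_, hBM ▸ h3⟩
    have h4 := ((hW _ (hHW hmem)).2.2 T' B hB hBM).2
    exact Prod.ext h4.symm hBM.symm
  · obtain ⟨h1, h2⟩ := (hW _ (hHW hBO)).2.2 T' B hB rfl
    have h3 : (constraint σ (entries A), L (entries B)) = H (entries B) := by rw [hH, h1]
    have h4 : H.symm (constraint σ (entries A), L (entries B)) = entries B := by
      rw [h3, H.left_inv hBO]
    refine ⟨?_, ?_⟩
    · change (constraint σ (entries A), L (entries B)) ∈ H.target
      rw [h3]
      exact H.map_source hBO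
    · simp only [h4, h2]

/-- Multiplication of tuples of matrices. -/
def mulTuple (K : Fin (n + 1) → SL2R) (M : MatTuple n) : MatTuple n :=
  fun i j k => ((K i : M2) * Matrix.of (M i)) j k

theorem contDiff_mulTuple (K : Fin (n + 1) → SL2R) : ContDiff ℝ ω (mulTuple K) := by
  refine contDiff_pi.mpr fun i => contDiff_pi.mpr fun j => contDiff_pi.mpr fun k => ?_
  simp only [mulTuple, Matrix.mul_apply, Fin.sum_univ_two, of_apply]
  fun_prop

theorem mulTuple_entries (K A : Fin (n + 1) → SL2R) :
    mulTuple K (entries A) = entries fun i => K i * A i := rfl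

theorem E.isLocalDiffeoAt_chart (hσ : IsGenusOne σ) (hc : ∀ v, 0 < c v) (hc1 : ∀ v, c v ≠ 1)
    (T : E σ c) : ∃ φ : E σ c → EuclideanSpace ℝ (Fin (2 * n)),
      IsLocalDiffeoAt (smoothE σ c) (smoothEuclidean (2 * n)) φ T := by
  obtain ⟨A, hA⟩ := T.1.exists_isLift
  obtain ⟨O, Y, L, ψ, hO, hAO, hOA, hY, hψ, hpar, hinv⟩ := E.exists_parametrization hσ hc hc1 hA
  let s : E σ c → Fin (n + 1) → SL2R := fun T' => acuteSection A T'.1.branch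
  have hs : ∀ {T' : E σ c} {B : Fin (n + 1) → SL2R}, T'.1.IsLift B → entries B ∈ acute A →
      s T' = B := by
    intro T' B hB hBA
    have : T'.1.branch = fun i => proj (B i) := (funext hB).symm
    simp only [s, this, acuteSection_apply hBA]
  let S : Set (E σ c) := (fun T' => T'.1.branch) ⁻¹' acuteDomain A ∩ (entries ∘ s) ⁻¹' O
  have hbr : Continuous fun T' : E σ c => T'.1.branch :=
    continuous_snd.comp E.isInducing.continuous
  have hcs : ContinuousOn (entries ∘ s) ((fun T' : E σ c => T'.1.branch) ⁻¹' acuteDomain A) :=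
    continuous_entries.comp_continuousOn
      ((continuousOn_acuteSection A).comp hbr.continuousOn fun _ h => h)
  have hSo : IsOpen S :=
    hcs.isOpen_inter_preimage ((isOpen_acuteDomain A).preimage hbr) hO
  have hmemS : ∀ {T' : E σ c} {B : Fin (n + 1) → SL2R}, T'.1.IsLift B → entries B ∈ O →
      T' ∈ S := by
    intro T' B hB hBO
    refine ⟨⟨B, hOA hBO, funext hB⟩, ?_⟩
    simp only [Set.mem_preimage, Function.comp_apply, hs hB (hOA hBO)]
    exact hBO
  have hlift : ∀ {T' : E σ c}, T' ∈ S → T'.1.IsLift (s T') := by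
    rintro T' ⟨⟨B, hB, hBT⟩, -⟩
    have : T'.1.IsLift B := congrFun hBT
    rwa [hs this hB]
  let φ : E σ c → EuclideanSpace ℝ (Fin (2 * n)) := fun T' => L (entries (s T'))
  have hφ : ∀ {T'}, T' ∈ S → φ T' ∈ Y ∧ ψ (φ T') = (T'.1.top, entries (s T')) :=
    fun hT' => hinv _ _ (hlift hT') hT'.2
  have hφpar : ∀ y ∈ Y, ∃ T' ∈ S, φ T' = y ∧ ψ y = (T'.1.top, entries (s T')) := by
    intro y hy
    obtain ⟨T', B, hB, hBO, h1, h2⟩ := hpar y hy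
    have h3 := hs hB (hOA hBO)
    refine ⟨T', hmemS hB hBO, ?_, ?_⟩
    · simp only [φ, h3, h2]
    · rw [h1, h3]
  have hinj : Set.InjOn φ S := by
    intro T₁ h₁ T₂ h₂ h
    have h3 := (hφ h₁).2.symm.trans ((congrArg ψ h).trans (hφ h₂).2)
    obtain ⟨h4, h5⟩ := Prod.mk_inj.mp h3
    refine Subtype.ext (PIET.ext_of_top_branch h4 (funext fun i => ?_))
    rw [← hlift h₁ i, ← hlift h₂ i, entries_injective h5]
  have hcont : ContinuousOn φ S := L.continuous.comp_continuousOn (hcs.mono fun _ h => h.1)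
  have hψc : ∀ {T'}, T' ∈ S → ContinuousAt ψ (φ T') := fun hT' =>
    hψ.continuousOn.continuousAt (hY.mem_nhds (hφ hT').1)
  have hom : IsOpenMap (S.domRestrict φ) := by
    refine IsOpenMap.of_nhds_le ?_
    rintro ⟨T', hT'⟩ U hU
    rw [Filter.mem_map, nhds_subtype] at hU
    obtain ⟨U', hU', hUU⟩ := hU
    obtain ⟨V, hV, hVU⟩ := E.exists_nhds_entries hU' (hlift hT')
    rw [← (hφ hT').2] at hV
    filter_upwards [(hψc hT').eventually hV, hY.mem_nhds (hφ hT').1] with y hyV hyY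
    obtain ⟨T₁, hT₁, rfl, h2⟩ := hφpar y hyY
    have h3 : (⟨T₁, hT₁⟩ : S) ∈ Subtype.val ⁻¹' U' :=
      hVU T₁ _ (hlift hT₁) (by rw [← h2]; exact hyV)
    exact hUU h3
  have : Nonempty (E σ c) := ⟨T⟩
  refine ⟨φ, OpenPartialHomeomorph.ofContinuousOpenRestrict (hinj.toPartialEquiv _ _)
    hcont hom hSo, hmemS hA hAO, fun x _ => rfl, fun T' (hT' : T' ∈ S) g => ?_⟩
  constructor
  · rintro h ⟨⟨T', B⟩, hB⟩ rfl
    have hB : T'.1.IsLift B := hB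
    obtain ⟨W, hW, hTW, F, hF, hFg⟩ := h (φ T') rfl
    let K : Fin (n + 1) → SL2R := fun i => s T' i * (B i)⁻¹
    have hK : ∀ i, proj (K i) = 1 := by
      intro i
      change proj (s T' i) * (proj (B i))⁻¹ = 1
      rw [hB i, hlift hT' i, mul_inv_cancel]
    have hKB : mulTuple K (entries B) = entries (s T') := by
      rw [mulTuple_entries]
      congr 1
      funext i
      simp [K]
    have hKc : ContDiff ℝ (⊤ : ℕ∞) fun x : (Fin (n + 2) → ℝ) × MatTuple n => mulTuple K x.2 :=
      ((contDiff_mulTuple K).of_le le_top).comp contDiff_snd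
    have hLK := L.contDiff (n := (⊤ : ℕ∞)).comp hKc
    refine ⟨(fun x => mulTuple K x.2) ⁻¹' acute A ∩ (fun x => L (mulTuple K x.2)) ⁻¹' W,
      ((isOpen_acute A).preimage hKc.continuous).inter (hW.preimage hLK.continuous), ?_,
      fun x => F (L (mulTuple K x.2)), hF.comp hLK.contDiffOn fun x hx => hx.2, ?_⟩
    · refine ⟨?_, ?_⟩
      · change mulTuple K (entries B) ∈ acute A
        rw [hKB]
        exact hOA hT'.2
      · change L (mulTuple K (entries B)) ∈ W
        rw [hKB]
        exact hTW
    · rintro ⟨⟨T₁, B₁⟩, hB₁⟩ ⟨h1, h2⟩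
      have hB₁ : T₁.1.IsLift B₁ := hB₁
      have h3 : T₁.1.IsLift fun i => K i * B₁ i := fun i => by
        change proj (K i) * proj (B₁ i) = _
        rw [hK, one_mul, hB₁ i]
      have h4 : φ T₁ = L (mulTuple K (entries B₁)) := by
        simp only [φ]
        rw [hs h3 h1, mulTuple_entries]
      change g (φ T₁) = F (L (mulTuple K (entries B₁)))
      rw [h4]
      exact hFg _ h2
  · rintro h _ rfl
    obtain ⟨W, hW, hTW, F, hF, hFg⟩ := h ⟨⟨T', s T'⟩, hlift hT'⟩ rfl
    have hTW : (T'.1.top, entries (s T')) ∈ W := hTW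
    rw [← (hφ hT').2] at hTW
    refine ⟨Y ∩ ψ ⁻¹' W, hψ.continuousOn.isOpen_inter_preimage hY hW, ⟨(hφ hT').1, hTW⟩,
      fun y => F (ψ y), hF.comp (hψ.mono fun y hy => hy.1) fun y hy => hy.2, ?_⟩
    rintro y ⟨hyY, hyW⟩
    obtain ⟨T₁, hT₁, h1, h2⟩ := hφpar y hyY
    have hyW : ψ y ∈ W := hyW
    rw [h2] at hyW
    have h3 := hFg ⟨⟨T₁, s T₁⟩, hlift hT₁⟩ hyW
    change g y = F (ψ y)
    rw [h2, ← h1]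
    exact h3

end Manifold

end MoebiusIET

end

theorem mainTheorem5 {n : ℕ} (σ : Equiv.Perm (Fin (n + 1))) (hσ : MoebiusIET.IsGenusOne σ)
    (c : MoebiusIET.Vertices σ → ℝ) (hc : ∀ v, 0 < c v) (hc1 : ∀ v, c v ≠ 1) :
    -- `E_σ(c)` is a smooth manifold of dimension `2n`
    (∀ T : MoebiusIET.E σ c, ∃ φ : MoebiusIET.E σ c → EuclideanSpace ℝ (Fin (2 * n)),
      MoebiusIET.IsLocalDiffeoAt (MoebiusIET.smoothE σ c) (MoebiusIET.smoothEuclidean (2 * n))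
        φ T) ∧
    -- the projection to the relative character variety (the Hausdorff quotient)
    (∃ hmem : ∀ T : MoebiusIET.E σ c,
        T.1.rep.char ∈ MoebiusIET.RelCharVar σ (MoebiusIET.boundaryClass σ c hc),
      ∀ T : MoebiusIET.E σ c,
        (¬ ∃ x : OnePoint ℝ, ∀ i, MoebiusIET.moebius (T.1.branch i) x = x) →
        MoebiusIET.IsLocalDiffeoAt (MoebiusIET.smoothE σ c)
          (MoebiusIET.smoothRelChar σ (MoebiusIET.boundaryClass σ c hc))
          (fun T' => ⟨T'.1.rep.char, hmem T'⟩) T) ∧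
    -- the projection to the space of conjugacy classes, without exception
    (∃ hmem : ∀ T : MoebiusIET.E σ c,
        T.1.rep.orbit ∈ MoebiusIET.RelOrbitSpace σ (MoebiusIET.boundaryClass σ c hc),
      ∀ T : MoebiusIET.E σ c,
        MoebiusIET.IsLocalDiffeoAt (MoebiusIET.smoothE σ c)
          (MoebiusIET.smoothRelOrbit σ (MoebiusIET.boundaryClass σ c hc))
          (fun T' => ⟨T'.1.rep.orbit, hmem T'⟩) T) ∧
    -- a conjugacy class contains at most one normalised representative
    (∀ T T' : MoebiusIET.E σ c, T.1.rep.orbit = T'.1.rep.orbit → T = T') ∧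
    -- and the class of a piecewise Möbius IET with break sizes `c` contains one exactly when the
    -- distinguished loop has no fixed point in the domain besides the left end point
    (∀ T : MoebiusIET.PIET σ, (∀ v, T.breakSize v = c v) →
      ((∃ T' : MoebiusIET.E σ c, T'.1.rep.orbit = T.rep.orbit) ↔
        ∀ x ∈ Set.Ioc (T.top 0) (T.top (Fin.last (n + 1))),
          MoebiusIET.moebius (T.rep.eval (MoebiusIET.peripheralLoop σ 0)) x ≠ x)) :=
  ⟨MoebiusIET.E.isLocalDiffeoAt_chart hσ hc hc1,
    ⟨fun T => Set.mem_image_of_mem _ (T.rep_mem_relRep hc hc1),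
      fun T hT => MoebiusIET.E.isLocalDiffeoAt_toChar hc hc1 T hT⟩,
    ⟨fun T => Set.mem_image_of_mem _ (T.rep_mem_relRep hc hc1),
      fun T => MoebiusIET.E.isLocalDiffeoAt_toOrbit hc hc1 T⟩,
    fun _ _ h => MoebiusIET.E.eq_of_orbit_eq hc1 h,
    fun T hT => MoebiusIET.exists_normalized_iff hc1 T hT⟩
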